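/- Let $n\in\{2,3\}$, $L>0$, $T>0$, $\sigma\neq 0$, $Q=(0,L]^n$, and $\|w\|=\big(\int_Q|w(x)|^2dx\big)^{1/2}$. All functions of $x\in\mathbf R^n$ are periodic with period $L$ in each coordinate. Let $(u,p)$ be a classical solution of the incompressible Navier--Stokes equations in negative direction of time $$\frac{\partial u}{\partial t}+\frac{\sigma^2}{2}\Delta u-(u,\nabla)u-\nabla p+f=0,\quad 0\le t<T,\qquad \operatorname{div}u=0,\qquad u(T,x)=\varphi(x),$$ with zero space average $\int_Q u(t,x)\,dx=0$ for $0\le t\le T$, where $u$ is of class $C^3$ on $[0,T]\times\mathbf R^n$ and $p(t,\cdot)$ is of class $C^2$. Put $\omega=\operatorname{curl}u$ and $g=\operatorname{curl}f$, where for $n=2$ the curl is the scalar $\operatorname{curl}v=\partial v^2/\partial x^1-\partial v^1/\partial x^2$. Let $U$ be the periodic Biot--Savart operator. With $w_m=L^{-n}\int_Q w(x)e^{-i(2\pi/L)(m,x)}dx$, $$Uw(x)=\frac{iL}{2\pi}\sum_{m\in\mathbf Z^3,\,m\ne0}\frac{m\times w_m}{|m|^2}\,e^{i(2\pi/L)(m,x)}\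 \ (n=3),\qquad Uw(x)=\frac{iL}{2\pi}\sum_{m\in\mathbf Z^2,\,m\ne0}\frac{w_m}{|m|^2}\begin{pmatrix}m^2\\-m^1\end{pmatrix}e^{i(2\pi/L)(m,x)}\ \ (n=2).$$ For $N\ge1$ put $h=T/N$ and $t_k=kh$. A frozen-velocity approximation of the vorticity with $N$ steps consists of functions $\tilde\omega_k$, $k=N-1,\dots,0$, each continuous on $[t_k,t_{k+1}]\times\mathbf R^n$ and with $\partial_t\tilde\omega_k$ and the space derivatives up to order two continuous on $[t_k,t_{k+1})\times\mathbf R^n$, such that, with the frozen velocity $\hat u_k(x)=U\tilde\omega_k(t_{k+1},\cdot)(x)$, $$\frac{\partial\tilde\omega_k}{\partial t}+\frac{\sigma^2}{2}\Delta\tilde\omega_k-(\hat u_k,\nabla)\tilde\omega_k+(\tilde\omega_k,\nabla)\hat u_k+g=0,\qquad t_k\le t<t_{k+1},$$ (for $n=2$, where $\tilde\omega_k$ is scalar, the term $(\tilde\omega_k,\nabla)\hat u_k$ is absent), and $$\tilde\omega_{N-1}(t_N,\cdot)=\operatorname{curl}\varphi,\qquad \tilde\omega_k(t_{k+1},\cdot)=\tilde\omega_{k+1}(t_{k+1},\cdot),\quad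 k=N-2,\dots,0.$$ Theorem. The approximation $\tilde\omega_k$ converges to $\omega$ with order $1$ in the $L^2$-norm: there is a constant $K$, which may depend on $n,L,T,\sigma$ and on the data and solution $f,\varphi,u,p$ but not on $N$, $k$, $t$ or the approximation, such that for every $N\ge1$ and every frozen-velocity approximation $(\tilde\omega_k)$ with $N$ steps $$\|\omega(t,\cdot)-\tilde\omega_k(t,\cdot)\|\le K\,h,\qquad t_k\le t\le t_{k+1},\quad k=0,\dots,N-1.$$ -/

import Mathlib

open Set MeasureTheory
open scoped Laplacian

noncomputable section

namespace PeriodicNSE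

/-- Euclidean space `ℝⁿ`. -/
abbrev E (n : ℕ) : Type := EuclideanSpace ℝ (Fin n)

/-- The period cell `Q = (0, L]ⁿ`. -/
def cell (n : ℕ) (L : ℝ) : Set (E n) := {x | ∀ i, x i ∈ Ioc 0 L}

/-- `w` is periodic with period `L` in each coordinate direction. -/
def IsPeriodic {n : ℕ} {F : Type*} (L : ℝ) (w : E n → F) : Prop :=
  ∀ (x : E n) (i : Fin n), w (x + L • EuclideanSpace.single i (1 : ℝ)) = w x

/-- The `L²(Q)` norm. -/
def l2Norm {n : ℕ} {F : Type*} [NormedAddCommGroup F] (L : ℝ) (w : E n → F) : ℝ :=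
  Real.sqrt (∫ x in cell n L, ‖w x‖ ^ 2)

/-- The partial derivative `∂w/∂xⁱ`. -/
def partialDeriv {n : ℕ} {F : Type*} [NormedAddCommGroup F] [NormedSpace ℝ F]
    (i : Fin n) (w : E n → F) (x : E n) : F :=
  fderiv ℝ w x (EuclideanSpace.single i (1 : ℝ))

/-- The divergence of a vector field on `ℝⁿ`. -/
def div {n : ℕ} (v : E n → E n) (x : E n) : ℝ := ∑ i, partialDeriv i v x i

/-- The advection operator `(v, ∇)w = ∑ⱼ vʲ ∂w/∂xʲ`. -/
def advect {n : ℕ} {F : Type*} [NormedAddCommGroup F] [NormedSpace ℝ F]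
    (v : E n → E n) (w : E n → F) (x : E n) : F :=
  ∑ j, v x j • partialDeriv j w x

/-- The scalar curl of a planar vector field. -/
def curl2 (v : E 2 → E 2) (x : E 2) : ℝ :=
  partialDeriv 0 v x 1 - partialDeriv 1 v x 0

/-- The curl of a vector field on `ℝ³`. -/
def curl3 (v : E 3 → E 3) (x : E 3) : E 3 :=
  !₂[partialDeriv 1 v x 2 - partialDeriv 2 v x 1,
     partialDeriv 2 v x 0 - partialDeriv 0 v x 2,
     partialDeriv 0 v x 1 - partialDeriv 1 v x 0]

/-- The exponential `exp (i (2π/L) (m, x))`, `m ∈ ℤⁿ`. -/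
def character {n : ℕ} (L : ℝ) (m : Fin n → ℤ) (x : E n) : ℂ :=
  Complex.exp (Complex.I * ((2 * Real.pi / L * ∑ j, (m j : ℝ) * x j : ℝ) : ℂ))

/-- The Fourier coefficient `w_m = L⁻ⁿ ∫_Q w(x) exp (-i (2π/L) (m, x)) dx`. -/
def coeff {n : ℕ} (L : ℝ) (w : E n → ℝ) (m : Fin n → ℤ) : ℂ :=
  ((L ^ n : ℝ) : ℂ)⁻¹ * ∫ x in cell n L, (w x : ℂ) * character L (-m) x

/-- `|m|²` for a lattice vector `m ∈ ℤⁿ`. -/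
def normSq {n : ℕ} (m : Fin n → ℤ) : ℂ := ∑ j, (m j : ℂ) ^ 2

/-- The periodic Biot-Savart operator `U` in dimension two:
`Uω = (iL/2π) ∑_{m ≠ 0} |m|⁻² exp (i (2π/L) (m, x)) (ω_m m², -ω_m m¹)`.
The term `m = 0` vanishes. The sum is real for real `ω`; `re` only changes its type. -/
def biotSavart2 (L : ℝ) (w : E 2 → ℝ) (x : E 2) : E 2 :=
  WithLp.toLp 2 fun i =>
    (Complex.I * L / (2 * Real.pi) * ∑' m : Fin 2 → ℤ, (normSq m)⁻¹ * character L m x *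
      (![coeff L w m * m 1, -(coeff L w m * m 0)] : Fin 2 → ℂ) i).re

/-- The periodic Biot-Savart operator `U` in dimension three:
`Uω = (iL/2π) ∑_{m ≠ 0} |m|⁻² exp (i (2π/L) (m, x)) m × ω_m`.
The term `m = 0` vanishes. The sum is real for real `ω`; `re` only changes its type. -/
def biotSavart3 (L : ℝ) (w : E 3 → E 3) (x : E 3) : E 3 :=
  WithLp.toLp 2 fun i =>
    (Complex.I * L / (2 * Real.pi) * ∑' m : Fin 3 → ℤ, (normSq m)⁻¹ * character L m x *
      crossProduct (fun j => (m j : ℂ)) (fun j => coeff L (fun y => w y j) m) i).re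

/-- `(u, p)` is a classical solution, with `u` of class `C³` on `[0, T] × ℝⁿ`, of the
`L`-periodic incompressible Navier-Stokes equations in negative direction of time,
`∂u/∂t + (σ²/2) Δu - (u, ∇)u - ∇p + f = 0`, `div u = 0`, `u(T, ·) = φ`,
with zero space average. At `t = 0` the time derivative is the one-sided one. -/
structure IsNSESolution {n : ℕ} (L T σ : ℝ) (f : ℝ → E n → E n) (φ : E n → E n)
    (u : ℝ → E n → E n) (p : ℝ → E n → ℝ) : Prop where
  smooth_velocity : ContDiffOn ℝ 3 (fun q : ℝ × E n => u q.1 q.2) (Icc 0 T ×ˢ univ)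
  smooth_pressure : ∀ t ∈ Ico 0 T, ContDiff ℝ 2 (p t)
  periodic_velocity : ∀ t ∈ Icc 0 T, IsPeriodic L (u t)
  periodic_pressure : ∀ t ∈ Ico 0 T, IsPeriodic L (p t)
  periodic_force : ∀ t ∈ Ico 0 T, IsPeriodic L (f t)
  momentum : ∀ t ∈ Ico 0 T, ∀ x,
    derivWithin (fun s => u s x) (Icc 0 T) t + (σ ^ 2 / 2) • (Δ (u t)) x
      - advect (u t) (u t) x - gradient (p t) x + f t x = 0
  div_free : ∀ t ∈ Icc 0 T, ∀ x, div (u t) x = 0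
  terminal : u T = φ
  mean_zero : ∀ t ∈ Icc 0 T, ∫ x in cell n L, u t x = 0

/-- The regularity of a classical solution of a backward parabolic equation on `[a, b)`:
`w` is continuous on `[a, b] × ℝⁿ`, and `∂w/∂t` and the space derivatives of `w` up to order
two exist and are continuous on `[a, b) × ℝⁿ`. -/
structure IsClassicalOn {n : ℕ} {F : Type*} [NormedAddCommGroup F] [NormedSpace ℝ F]
    (a b : ℝ) (w : ℝ → E n → F) : Prop where
  continuous : ContinuousOn (fun q : ℝ × E n => w q.1 q.2) (Icc a b ×ˢ univ)
  time_diff : ∀ t ∈ Ico a b, ∀ x, DifferentiableWithinAt ℝ (fun s => w s x) (Icc a b) t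
  time_cont : ContinuousOn
    (fun q : ℝ × E n => derivWithin (fun s => w s q.2) (Icc a b) q.1) (Ico a b ×ˢ univ)
  space_diff : ∀ t ∈ Ico a b, ContDiff ℝ 2 (w t)
  space_cont_one : ContinuousOn
    (fun q : ℝ × E n => fderiv ℝ (w q.1) q.2) (Ico a b ×ˢ univ)
  space_cont_two : ContinuousOn
    (fun q : ℝ × E n => fderiv ℝ (fderiv ℝ (w q.1)) q.2) (Ico a b ×ˢ univ)

/-- The grid points `t_k = k h` with `h = T / N`. -/
def gridTime (T : ℝ) (N k : ℕ) : ℝ := k * (T / N)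

/-- `w k`, `k = 0, …, N - 1`, is the frozen-velocity approximation of the vorticity on
`[t_k, t_{k+1}]` in dimension two: with the frozen velocity `û_k = U w_k(t_{k+1}, ·)`,
`∂w_k/∂t + (σ²/2) Δw_k - (û_k, ∇)w_k + curl f = 0` on `[t_k, t_{k+1})`, and
`w_k(t_{k+1}, ·)` is `curl φ` for `k = N - 1` and `w_{k+1}(t_{k+1}, ·)` for `k < N - 1`. -/
structure IsFrozenApprox2 (L T σ : ℝ) (f : ℝ → E 2 → E 2) (φ : E 2 → E 2) (N : ℕ)
    (w : ℕ → ℝ → E 2 → ℝ) : Prop where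
  classical : ∀ k < N, IsClassicalOn (gridTime T N k) (gridTime T N (k + 1)) (w k)
  periodic : ∀ k < N, ∀ t ∈ Icc (gridTime T N k) (gridTime T N (k + 1)), IsPeriodic L (w k t)
  equation : ∀ k < N, ∀ t ∈ Ico (gridTime T N k) (gridTime T N (k + 1)), ∀ x,
    derivWithin (fun s => w k s x) (Icc (gridTime T N k) (gridTime T N (k + 1))) t
      + (σ ^ 2 / 2) * (Δ (w k t)) x
      - advect (biotSavart2 L (w k (gridTime T N (k + 1)))) (w k t) x
      + curl2 (f t) x = 0
  terminal : ∀ k < N, w k (gridTime T N (k + 1)) =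
    if k + 1 = N then curl2 φ else w (k + 1) (gridTime T N (k + 1))

/-- `w k`, `k = 0, …, N - 1`, is the frozen-velocity approximation of the vorticity on
`[t_k, t_{k+1}]` in dimension three: with the frozen velocity `û_k = U w_k(t_{k+1}, ·)`,
`∂w_k/∂t + (σ²/2) Δw_k - (û_k, ∇)w_k + (w_k, ∇)û_k + curl f = 0` on `[t_k, t_{k+1})`, and
`w_k(t_{k+1}, ·)` is `curl φ` for `k = N - 1` and `w_{k+1}(t_{k+1}, ·)` for `k < N - 1`. -/
structure IsFrozenApprox3 (L T σ : ℝ) (f : ℝ → E 3 → E 3) (φ : E 3 → E 3) (N : ℕ)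
    (w : ℕ → ℝ → E 3 → E 3) : Prop where
  classical : ∀ k < N, IsClassicalOn (gridTime T N k) (gridTime T N (k + 1)) (w k)
  periodic : ∀ k < N, ∀ t ∈ Icc (gridTime T N k) (gridTime T N (k + 1)), IsPeriodic L (w k t)
  equation : ∀ k < N, ∀ t ∈ Ico (gridTime T N k) (gridTime T N (k + 1)), ∀ x,
    derivWithin (fun s => w k s x) (Icc (gridTime T N k) (gridTime T N (k + 1))) t
      + (σ ^ 2 / 2) • (Δ (w k t)) x
      - advect (biotSavart3 L (w k (gridTime T N (k + 1)))) (w k t) x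
      + advect (w k t) (biotSavart3 L (w k (gridTime T N (k + 1)))) x
      + curl3 (f t) x = 0
  terminal : ∀ k < N, w k (gridTime T N (k + 1)) =
    if k + 1 = N then curl3 φ else w (k + 1) (gridTime T N (k + 1))

end PeriodicNSE

end

/-! Fix one step [a,b] and let z be the difference of the exact and the approximate vorticity. Since
u has zero average and zero divergence, the Biot-Savart operator recovers u(b) from its curl, so the
frozen velocity is û = u(b) − V with V = U z(b). Subtracting the equations gives z_t = −(σ²/2)Δz +
(û,∇)z + R. In the energy identity for y = ‖z‖² the transport term vanishes because div û = 0, and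
y' equals the dissipation σ²‖∇z‖² plus twice the integral of z·R. As time runs backwards, a lower
bound of y' is what controls growth.

In the plane R = (u(t) − u(b) + V, ∇)ω. The first part is O(b − a) because u is Lipschitz in time;
the second is bounded by ‖z(b)‖ because U gains one derivative. In space the stretching term adds
further products of the same kind, a term linear in z, and one term (z,∇)V in which only the `L²`
norm of ∇V is available. For that term the Sobolev embedding H¹ ⊂ L⁶ and interpolation give a bound
by the dissipation, which the viscosity absorbs, plus a multiple of (1 + ‖z(b)‖⁴)‖z‖². With Y = y(b)
and h = b − a, in both dimensions

y' ≥ −(C(1 + Y²) y + C(h² + Y)).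

These are `exists_energy_inequality2` and `exists_energy_inequality3`. They rest on
`sum_gradInvLap_exterior` (inversion of the curl), `exists_velocityError2` and
`exists_velocityError3` (H¹ control of V), `IsNSESolution.exterior_equation` (the vorticity
equation), and, in space, `exists_integral_sq_mul_abs_le`.

`exists_sqrt_energy_le` then sums the steps. As long as Y ≤ 1, Gronwall gives y ≤ e^{3Ch}(Y + Ch³)
on a step, hence y ≤ K₁h² after at most N steps from zero error, and this is consistent with Y ≤ 1
when K₁h² ≤ 1. If K₁h² > 1, then N is bounded by T²K₁, and a crude bound over finitely many steps
suffices because h is bounded below. -/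

open scoped Pointwise

/-! ### Periodic functions as functions on the torus; integration by parts over the cell -/

namespace PeriodicNSE

variable {n : ℕ} {L : ℝ}

/-- The covering of the unit torus by `ℝⁿ` that has the period `L`. -/
noncomputable def toTorus (n : ℕ) (L : ℝ) (x : E n) : UnitAddTorus (Fin n) :=
  fun i => ((x i / L : ℝ) : UnitAddCircle)

/-- The normalized Haar measure of the unit torus. -/
noncomputable def torusMeasure (n : ℕ) : Measure (UnitAddTorus (Fin n)) :=
  Measure.pi fun _ => AddCircle.haarAddCircle

instance : IsProbabilityMeasure (torusMeasure n) := by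
  unfold torusMeasure; infer_instance

instance : (torusMeasure n).IsAddLeftInvariant := by
  unfold torusMeasure; infer_instance

theorem toTorus_add (x y : E n) : toTorus n L (x + y) = toTorus n L x + toTorus n L y := by
  funext i
  simp [toTorus, add_div]

/-- Each coordinate map to the circle is an open quotient map. Openness is what makes the property
pass to products, which fails for plain quotient maps; the scaling by 1/L is a homeomorphism. This
provides continuous lifts of periodic functions to the torus. -/
theorem isOpenQuotientMap_toTorus (hL : 0 < L) : IsOpenQuotientMap (toTorus n L) := by
  have h1 : IsOpenQuotientMap (Pi.map fun (_ : Fin n) (s : ℝ) => (s : UnitAddCircle)) :=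
    IsOpenQuotientMap.piMap fun _ => QuotientAddGroup.isOpenQuotientMap_mk
  let e : E n ≃ₜ (Fin n → ℝ) :=
    (PiLp.homeomorph 2 fun _ : Fin n => ℝ).trans (Homeomorph.smulOfNeZero L⁻¹ (inv_ne_zero hL.ne'))
  have h2 := h1.comp e.isOpenQuotientMap
  convert! h2 using 1
  funext x i
  simp [toTorus, e, PiLp.homeomorph, div_eq_inv_mul]

theorem IsPeriodic.eq_of_int {F : Type*} {w : E n → F} (hw : IsPeriodic L w) {x y : E n}
    (h : ∀ i, ∃ k : ℤ, y i = x i + k * L) : w y = w x := by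
  choose k hk using h
  have key : ∀ s : Finset (Fin n), ∀ x : E n,
      w (x + ∑ i ∈ s, k i • (L • EuclideanSpace.single i (1 : ℝ))) = w x := by
    intro s
    induction s using Finset.induction_on with
    | empty => simp
    | insert a s ha ih =>
      intro x
      have hp : Function.Periodic w (L • EuclideanSpace.single a (1 : ℝ)) := fun x => hw x a
      rw [Finset.sum_insert ha, add_comm (k a • _), ← add_assoc, (hp.zsmul (k a)), ih]
  have : y = x + ∑ i, k i • (L • EuclideanSpace.single i (1 : ℝ)) := by
    ext j
    simp [hk, Finset.sum_apply, Pi.single_apply, mul_comm]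
  rw [this, key]

theorem IsPeriodic.eq_of_toTorus {F : Type*} (hL : 0 < L) {w : E n → F} (hw : IsPeriodic L w)
    {x y : E n} (h : toTorus n L x = toTorus n L y) : w x = w y := by
  refine hw.eq_of_int fun i => ?_
  have hi := congrFun h i
  simp only [toTorus] at hi
  rw [← sub_eq_zero, ← AddCircle.coe_sub, AddCircle.coe_eq_zero_iff] at hi
  obtain ⟨k, hk⟩ := hi
  refine ⟨k, ?_⟩
  simp only [zsmul_eq_mul, mul_one] at hk
  field_simp at hk
  linarith

theorem IsPeriodic.exists_lift {F : Type*} [TopologicalSpace F] (hL : 0 < L) {w : E n → F}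
    (hw : IsPeriodic L w) (hc : Continuous w) :
    ∃ W : C(UnitAddTorus (Fin n), F), ∀ x, W (toTorus n L x) = w x := by
  have hq := (isOpenQuotientMap_toTorus (n := n) hL).isQuotientMap
  let p : C(E n, UnitAddTorus (Fin n)) := ⟨toTorus n L, hq.continuous⟩
  have hq' : Topology.IsQuotientMap p := hq
  refine ⟨hq'.lift ⟨w, hc⟩ fun x y hxy => hw.eq_of_toTorus hL hxy, fun x => ?_⟩
  exact DFunLike.congr_fun (hq'.lift_comp ⟨w, hc⟩ fun x y hxy => hw.eq_of_toTorus hL hxy) x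

theorem measurableSet_cell : MeasurableSet (cell n L) := by
  have : cell n L = ⋂ i, (fun x : E n => x i) ⁻¹' Ioc 0 L := by ext; simp [cell]
  rw [this]
  exact MeasurableSet.iInter fun i => (by fun_prop : Measurable fun x : E n => x i) measurableSet_Ioc

/-- The dilation by L carries the unit cell to `cell n L` and multiplies volume by Lⁿ. Through this
identity the invariance of Haar measure and Parseval's identity on the torus become statements about
the cell. -/
theorem setIntegral_cell_toTorus {F : Type*} [NormedAddCommGroup F] [NormedSpace ℝ F] (hL : 0 < L)
    (W : UnitAddTorus (Fin n) → F) :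
    ∫ x in cell n L, W (toTorus n L x) = L ^ n • ∫ t, W t ∂torusMeasure n := by
  have h1 := (PiLp.volume_preserving_toLp (Fin n)).setIntegral_preimage_emb
    (MeasurableEquiv.toLp 2 (Fin n → ℝ)).measurableEmbedding
    (fun x => W (toTorus n L x)) (cell n L)
  have h2 : ∫ t, W t ∂torusMeasure n = _ := UnitAddTorus.integral_preimage W 0
  have h3 := Measure.setIntegral_comp_smul_of_pos volume
    (fun y : Fin n → ℝ => W (toTorus n L (WithLp.toLp 2 y)))
    {y | ∀ i, y i ∈ Ioc ((0 : Fin n → ℝ) i) ((0 : Fin n → ℝ) i + 1)} hL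
  have h4 : L • {y : Fin n → ℝ | ∀ i, y i ∈ Ioc ((0 : Fin n → ℝ) i) ((0 : Fin n → ℝ) i + 1)}
      = WithLp.toLp 2 ⁻¹' (cell n L) := by
    ext y
    rw [Set.mem_smul_set_iff_inv_smul_mem₀ hL.ne']
    simp only [Pi.zero_apply, zero_add, mem_Ioc, mem_ofPred_eq, Pi.smul_apply, smul_eq_mul,
      mem_preimage, cell]
    refine forall_congr' fun i => ?_
    rw [inv_mul_le_iff₀ hL, mul_one, mul_pos_iff_of_pos_left (by positivity)]
  have h5 : ∀ y : Fin n → ℝ, toTorus n L (WithLp.toLp 2 (L • y)) = fun i => (y i : UnitAddCircle) := by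
    intro y; funext i
    simp [toTorus, hL.ne']
  simp only [h5] at h3
  rw [h2, h3, h4, ← h1, smul_smul]
  simp [hL.ne']

theorem cell_subset_closedBall : cell n L ⊆ Metric.closedBall 0 (Real.sqrt (n * L ^ 2)) := by
  intro x hx
  rw [mem_closedBall_zero_iff, EuclideanSpace.norm_eq]
  refine Real.sqrt_le_sqrt ?_
  calc ∑ i, ‖x i‖ ^ 2 ≤ ∑ _i : Fin n, L ^ 2 := by
        refine Finset.sum_le_sum fun i _ => ?_
        rw [Real.norm_eq_abs, sq_abs]
        exact pow_le_pow_left₀ (hx i).1.le (hx i).2 2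
    _ = n * L ^ 2 := by simp

instance : IsFiniteMeasure (volume.restrict (cell n L)) :=
  isFiniteMeasure_restrict.2
    (Metric.isBounded_closedBall.subset cell_subset_closedBall).measure_lt_top.ne

theorem integrableOn_cell {F : Type*} [NormedAddCommGroup F] {w : E n → F} (hw : Continuous w) :
    IntegrableOn w (cell n L) :=
  (hw.continuousOn.integrableOn_compact (isCompact_closedBall (0 : E n) (Real.sqrt (n * L ^ 2)))).mono_set
    cell_subset_closedBall

theorem IsPeriodic.exists_bound {F : Type*} [NormedAddCommGroup F] (hL : 0 < L) {w : E n → F}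
    (hw : IsPeriodic L w) (hc : Continuous w) : ∃ M, 0 ≤ M ∧ ∀ x, ‖w x‖ ≤ M := by
  obtain ⟨W, hW⟩ := hw.exists_lift hL hc
  exact ⟨‖W‖, norm_nonneg _, fun x => hW x ▸ W.norm_coe_le_norm _⟩

theorem IsPeriodic.integral_translate {F : Type*} [NormedAddCommGroup F] [NormedSpace ℝ F]
    (hL : 0 < L) {w : E n → F} (hw : IsPeriodic L w) (hc : Continuous w) (a : E n) :
    ∫ x in cell n L, w (a + x) = ∫ x in cell n L, w x := by
  obtain ⟨W, hW⟩ := hw.exists_lift hL hc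
  simp_rw [← hW, toTorus_add]
  rw [setIntegral_cell_toTorus hL fun t => W (toTorus n L a + t), setIntegral_cell_toTorus hL,
    integral_add_left_eq_self]

theorem IsPeriodic.fderiv {F : Type*} [NormedAddCommGroup F] [NormedSpace ℝ F]
    {w : E n → F} (hw : IsPeriodic L w) : IsPeriodic L (fderiv ℝ w) := by
  intro x i
  have : w = fun y => w (y + L • EuclideanSpace.single i 1) := funext fun y => (hw y i).symm
  conv_rhs => rw [this]
  rw [fderiv_comp_add_right]

theorem IsPeriodic.partialDeriv {F : Type*} [NormedAddCommGroup F] [NormedSpace ℝ F]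
    {w : E n → F} (hw : IsPeriodic L w) (i : Fin n) : IsPeriodic L (partialDeriv i w) := by
  intro x j
  simp only [PeriodicNSE.partialDeriv, hw.fderiv x j]

theorem IsPeriodic.comp {F G : Type*} {w : E n → F} (hw : IsPeriodic L w) (g : F → G) :
    IsPeriodic L fun x => g (w x) := fun x i => congrArg g (hw x i)

theorem IsPeriodic.comp₂ {F G H : Type*} {w : E n → F} {v : E n → G} (hw : IsPeriodic L w)
    (hv : IsPeriodic L v) (g : F → G → H) :
    IsPeriodic L fun x => g (w x) (v x) := fun x i => by simp only [hw x i, hv x i]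

theorem isPeriodic_sum {F ι : Type*} [AddCommMonoid F] {s : Finset ι} {w : ι → E n → F}
    (hw : ∀ i ∈ s, IsPeriodic L (w i)) : IsPeriodic L fun x => ∑ i ∈ s, w i x :=
  fun x j => Finset.sum_congr rfl fun i hi => hw i hi x j

theorem continuous_partialDeriv {F : Type*} [NormedAddCommGroup F] [NormedSpace ℝ F]
    {w : E n → F} (hc : ContDiff ℝ 1 w) (i : Fin n) : Continuous (partialDeriv i w) :=
  (hc.continuous_fderiv one_ne_zero).clm_apply continuous_const

/-- The integral of s ↦ w(s eᵢ + x) over the cell does not depend on s, by translation invariance;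
differentiating under the integral at s = 0 gives the claim without Fubini or boundary terms. The
dominating constant is the bound of the continuous periodic derivative. -/
theorem IsPeriodic.integral_partialDeriv {F : Type*} [NormedAddCommGroup F] [NormedSpace ℝ F]
    [CompleteSpace F]
    (hL : 0 < L) {w : E n → F} (hw : IsPeriodic L w) (hc : ContDiff ℝ 1 w) (i : Fin n) :
    ∫ x in cell n L, PeriodicNSE.partialDeriv i w x = 0 := by
  obtain ⟨M, -, hM⟩ := (hw.partialDeriv i).exists_bound hL (continuous_partialDeriv hc i)
  have hc0 := hc.continuous
  have hc1 := continuous_partialDeriv hc i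
  have hd : ∀ (x : E n) (s : ℝ), HasDerivAt (fun s : ℝ => w (s • EuclideanSpace.single i 1 + x))
      (PeriodicNSE.partialDeriv i w (s • EuclideanSpace.single i 1 + x)) s := by
    intro x s
    have h1 := (hc.differentiable one_ne_zero (s • EuclideanSpace.single i 1 + x)).hasFDerivAt
    have h2 : HasDerivAt (fun s : ℝ => s • EuclideanSpace.single i (1 : ℝ) + x)
        (EuclideanSpace.single i (1 : ℝ)) s := by
      simpa using ((hasDerivAt_id s).smul_const (EuclideanSpace.single i (1 : ℝ))).add_const x
    exact h1.comp_hasDerivAt s h2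
  have key := hasDerivAt_integral_of_dominated_loc_of_deriv_le
    (μ := volume.restrict (cell n L)) (bound := fun _ => M)
    (F := fun (s : ℝ) x => w (s • EuclideanSpace.single i 1 + x))
    (F' := fun (s : ℝ) x => PeriodicNSE.partialDeriv i w (s • EuclideanSpace.single i 1 + x))
    (x₀ := (0 : ℝ)) (s := univ) Filter.univ_mem
    (Filter.Eventually.of_forall fun s => Continuous.aestronglyMeasurable (by fun_prop))
    (integrableOn_cell (by fun_prop)) (Continuous.aestronglyMeasurable (by fun_prop))
    (Filter.Eventually.of_forall fun x s _ => hM _) (integrable_const _)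
    (Filter.Eventually.of_forall fun x s _ => hd x s)
  have h1 := key.2
  simp_rw [hw.integral_translate hL hc.continuous] at h1
  have h2 := h1.unique (hasDerivAt_const _ _)
  simpa using h2

theorem partialDeriv_mul {𝔸 : Type*} [NormedCommRing 𝔸] [NormedAlgebra ℝ 𝔸] {v w : E n → 𝔸}
    {x : E n} (hv : DifferentiableAt ℝ v x) (hw : DifferentiableAt ℝ w x) (i : Fin n) :
    partialDeriv i (fun x => v x * w x) x
      = v x * partialDeriv i w x + partialDeriv i v x * w x := by
  simp only [PeriodicNSE.partialDeriv]
  rw [fderiv_fun_mul hv hw]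
  simp [mul_comm]

theorem IsPeriodic.integral_mul_partialDeriv {𝔸 : Type*} [NormedCommRing 𝔸] [NormedAlgebra ℝ 𝔸]
    [CompleteSpace 𝔸] (hL : 0 < L) {v w : E n → 𝔸} (hv : IsPeriodic L v)
    (hw : IsPeriodic L w) (hvc : ContDiff ℝ 1 v) (hwc : ContDiff ℝ 1 w) (i : Fin n) :
    ∫ x in cell n L, v x * PeriodicNSE.partialDeriv i w x
      = -∫ x in cell n L, PeriodicNSE.partialDeriv i v x * w x := by
  have h := (hv.comp₂ hw (· * ·)).integral_partialDeriv hL (hvc.mul hwc) i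
  simp_rw [fun x => partialDeriv_mul (hvc.differentiable one_ne_zero x)
    (hwc.differentiable one_ne_zero x) i] at h
  rw [integral_add] at h
  · exact eq_neg_of_add_eq_zero_left h
  · exact integrableOn_cell (hvc.continuous.mul (continuous_partialDeriv hwc i))
  · exact integrableOn_cell ((continuous_partialDeriv hvc i).mul hwc.continuous)

end PeriodicNSE

/-! ### Characters, Fourier coefficients and Parseval's identity -/

namespace PeriodicNSE

variable {n : ℕ} {L : ℝ}

theorem character_eq_mFourier (m : Fin n → ℤ) (x : E n) :
    character L m x = UnitAddTorus.mFourier m (toTorus n L x) := by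
  simp only [character, UnitAddTorus.mFourier, toTorus, ContinuousMap.coe_mk, fourier_coe_apply,
    ← Complex.exp_sum]
  congr 1
  push_cast
  rw [Finset.mul_sum, Finset.mul_sum]
  refine Finset.sum_congr rfl fun i _ => ?_
  ring

theorem norm_character (m : Fin n → ℤ) (x : E n) : ‖character L m x‖ = 1 := by
  rw [character, mul_comm, Complex.norm_exp_ofReal_mul_I]

theorem isPeriodic_character (hL : 0 < L) (m : Fin n → ℤ) : IsPeriodic L (character L m) := by
  intro x i
  rw [character_eq_mFourier, character_eq_mFourier]
  congr 1
  funext j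
  simp only [toTorus]
  rw [← sub_eq_zero, ← AddCircle.coe_sub, AddCircle.coe_eq_zero_iff]
  by_cases h : j = i
  · subst h
    refine ⟨1, ?_⟩
    simp [hL.ne', add_div]
  · refine ⟨0, ?_⟩
    simp [h]

/-- The real-linear form with the components `2πi m_j / L`. -/
noncomputable def waveForm (L : ℝ) (m : Fin n → ℤ) : E n →L[ℝ] ℂ :=
  ∑ j, (2 * Real.pi * Complex.I / L * m j : ℂ) • (Complex.ofRealCLM.comp (EuclideanSpace.proj j))

theorem waveForm_single (m : Fin n → ℤ) (j : Fin n) :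
    waveForm L m (EuclideanSpace.single j 1) = 2 * Real.pi * Complex.I / L * m j := by
  simp [waveForm, apply_ite Complex.ofReal]

theorem character_eq_exp (m : Fin n → ℤ) (x : E n) :
    character L m x = Complex.exp (waveForm L m x) := by
  simp only [character, waveForm]
  congr 1
  simp [Finset.mul_sum]
  refine Finset.sum_congr rfl fun i _ => ?_
  ring

theorem hasFDerivAt_character (m : Fin n → ℤ) (x : E n) :
    HasFDerivAt (character L m) (character L m x • waveForm L m) x := by
  have h := (waveForm L m).hasFDerivAt (x := x)
  have h2 := h.cexp
  rw [funext (character_eq_exp (L := L) m)]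
  exact h2

theorem contDiff_character (m : Fin n → ℤ) {k : WithTop ℕ∞} : ContDiff ℝ k (character L m) := by
  rw [funext (character_eq_exp (L := L) m)]
  exact (waveForm L m).contDiff.cexp

theorem partialDeriv_character (m : Fin n → ℤ) (j : Fin n) (x : E n) :
    partialDeriv j (character L m) x = 2 * Real.pi * Complex.I / L * m j * character L m x := by
  rw [partialDeriv, (hasFDerivAt_character m x).fderiv]
  simp [waveForm_single, mul_comm]

theorem partialDeriv_ofReal {w : E n → ℝ} {x : E n} (hw : DifferentiableAt ℝ w x) (j : Fin n) :
    partialDeriv j (fun x => (w x : ℂ)) x = ((partialDeriv j w x : ℝ) : ℂ) := by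
  have := Complex.ofRealCLM.hasFDerivAt.comp x hw.hasFDerivAt
  exact congrArg (fun f => f (EuclideanSpace.single j 1)) this.fderiv

theorem partialDeriv_re {w : E n → ℂ} {x : E n} (hw : DifferentiableAt ℝ w x) (j : Fin n) :
    partialDeriv j (fun x => (w x).re) x = (partialDeriv j w x).re := by
  have := Complex.reCLM.hasFDerivAt.comp x hw.hasFDerivAt
  exact congrArg (fun f => f (EuclideanSpace.single j 1)) this.fderiv

/-- Integration by parts against the character of −m: its sign cancels the sign of the frequency. -/
theorem coeff_partialDeriv (hL : 0 < L) {w : E n → ℝ} (hw : IsPeriodic L w) (hc : ContDiff ℝ 1 w)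
    (j : Fin n) (m : Fin n → ℤ) :
    coeff L (partialDeriv j w) m = 2 * Real.pi * Complex.I / L * m j * coeff L w m := by
  have hcc : ContDiff ℝ 1 fun x => (w x : ℂ) := Complex.ofRealCLM.contDiff.comp hc
  have h := (isPeriodic_character hL (-m)).integral_mul_partialDeriv hL (hw.comp (fun s : ℝ => (s : ℂ)))
    (contDiff_character _) hcc j
  simp only [coeff]
  simp_rw [partialDeriv_ofReal (hc.differentiable one_ne_zero _), partialDeriv_character] at h
  have h0 : ∀ x, ((partialDeriv j w x : ℝ) : ℂ) * character L (-m) x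
      = character L (-m) x * ((partialDeriv j w x : ℝ) : ℂ) := fun x => mul_comm _ _
  simp_rw [h0]
  rw [h, mul_left_comm]
  congr 1
  rw [neg_eq_neg_one_mul]
  simp only [← integral_const_mul]
  refine integral_congr_ae (Filter.Eventually.of_forall fun x => ?_)
  simp
  ring

theorem exists_torus_lift (hL : 0 < L) {w : E n → ℝ} (hw : IsPeriodic L w) (hc : Continuous w) :
    ∃ W : C(UnitAddTorus (Fin n), ℂ), (∀ x, W (toTorus n L x) = w x) ∧
      ∀ m, UnitAddTorus.mFourierCoeff W m = coeff L w m := by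
  obtain ⟨W, hW⟩ := (hw.comp (fun s : ℝ => (s : ℂ))).exists_lift hL (by fun_prop)
  refine ⟨W, hW, fun m => ?_⟩
  have h := setIntegral_cell_toTorus hL fun t => UnitAddTorus.mFourier (-m) t • W t
  have h2 : UnitAddTorus.mFourierCoeff W m = ∫ t, UnitAddTorus.mFourier (-m) t • W t ∂torusMeasure n :=
    rfl
  rw [coeff, h2, eq_inv_mul_iff_mul_eq₀ (by simp [hL.ne'])]
  rw [Complex.real_smul] at h
  rw [← h]
  refine integral_congr_ae (Filter.Eventually.of_forall fun x => ?_)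
  simp [hW, character_eq_mFourier, mul_comm]

theorem setIntegral_cell_norm_sq (hL : 0 < L) {W : C(UnitAddTorus (Fin n), ℂ)} :
    HasSum (fun m => L ^ n * ‖UnitAddTorus.mFourierCoeff W m‖ ^ 2)
      (∫ x in cell n L, ‖W (toTorus n L x)‖ ^ 2) := by
  have h := setIntegral_cell_toTorus hL fun t => ‖W t‖ ^ 2
  rw [h, smul_eq_mul]
  refine HasSum.mul_left _ ?_
  have h2 : HasSum
      (fun m => ‖UnitAddTorus.mFourierCoeff (ContinuousMap.toLp 2 (torusMeasure n) ℂ W) m‖ ^ 2)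
      (∫ t, ‖ContinuousMap.toLp 2 (torusMeasure n) ℂ W t‖ ^ 2 ∂torusMeasure n) :=
    UnitAddTorus.hasSum_sq_mFourierCoeff _
  have h3 : ∀ m, UnitAddTorus.mFourierCoeff (ContinuousMap.toLp 2 (torusMeasure n) ℂ W) m
      = UnitAddTorus.mFourierCoeff W m := UnitAddTorus.mFourierCoeff_toLp W
  simp only [h3] at h2
  convert! h2 using 1
  refine integral_congr_ae ?_
  filter_upwards [ContinuousMap.coeFn_toLp (p := 2) (𝕜 := ℂ) (torusMeasure n) W] with t ht
  rw [← ht]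

theorem hasSum_sq_coeff (hL : 0 < L) {w : E n → ℝ} (hw : IsPeriodic L w) (hc : Continuous w) :
    HasSum (fun m => L ^ n * ‖coeff L w m‖ ^ 2) (∫ x in cell n L, w x ^ 2) := by
  obtain ⟨W, hW, hm⟩ := exists_torus_lift hL hw hc
  have h := setIntegral_cell_norm_sq hL (W := W)
  simpa [hW, hm] using h

theorem hasSum_coeff_mul_character (hL : 0 < L) {w : E n → ℝ} (hw : IsPeriodic L w)
    (hc : Continuous w) (hs : Summable (coeff L w)) (x : E n) :
    HasSum (fun m => coeff L w m * character L m x) (w x : ℂ) := by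
  obtain ⟨W, hW, hm⟩ := exists_torus_lift hL hw hc
  have h := UnitAddTorus.hasSum_mFourier_series_apply_of_summable
    (f := W) (by rwa [funext hm]) (toTorus n L x)
  simpa [hW, hm, character_eq_mFourier] using h

end PeriodicNSE

/-! ### Absolutely convergent trigonometric series -/

namespace PeriodicNSE

variable {n : ℕ} {L : ℝ}

/-- The trigonometric series with coefficients `c`. -/
noncomputable def fourierSeries (L : ℝ) (c : (Fin n → ℤ) → ℂ) (x : E n) : ℂ :=
  ∑' m, c m * character L m x

theorem summable_mul_character {c : (Fin n → ℤ) → ℂ} (hc : Summable c) (x : E n) :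
    Summable fun m => c m * character L m x := by
  refine Summable.of_norm ?_
  simpa [norm_character] using hc.norm

theorem isPeriodic_fourierSeries (hL : 0 < L) (c : (Fin n → ℤ) → ℂ) :
    IsPeriodic L (fourierSeries L c) := by
  intro x i
  simp only [fourierSeries, isPeriodic_character hL _ x i]

theorem continuous_character (m : Fin n → ℤ) : Continuous (character L m) :=
  (contDiff_character m (k := 0)).continuous

theorem continuous_fourierSeries {c : (Fin n → ℤ) → ℂ} (hc : Summable c) :
    Continuous (fourierSeries L c) :=
  continuous_tsum (fun m => continuous_const.mul (continuous_character m)) hc.norm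
    fun m x => by simp [norm_character]

theorem fourierSeries_sub {c d : (Fin n → ℤ) → ℂ} (hc : Summable c) (hd : Summable d) (x : E n) :
    fourierSeries L (fun m => c m - d m) x = fourierSeries L c x - fourierSeries L d x := by
  simp only [fourierSeries, sub_mul]
  exact (summable_mul_character hc x).tsum_sub (summable_mul_character hd x)

/-- Termwise differentiation with the majorant |c_m|·‖`waveForm L m`‖, which is summable because the
norm of the form is at most a constant times the sum of the |m_j|. The same majorant gives
continuity of the differentiated series. -/
theorem hasFDerivAt_fourierSeries {c : (Fin n → ℤ) → ℂ}
    (hd : ∀ j, Summable fun m => (m j : ℂ) * c m) (hc : Summable c) (x : E n) :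
    HasFDerivAt (fourierSeries L c) (∑' m, (c m * character L m x) • waveForm L m) x ∧
      (Summable fun m => (c m * character L m x) • waveForm L m) ∧
      Continuous fun x : E n => ∑' m, (c m * character L m x) • waveForm L m := by
  have hb : Summable fun m => ‖c m‖ * ‖waveForm L m‖ := by
    have h1 : Summable fun m : Fin n → ℤ => ∑ j, ‖(2 * Real.pi * Complex.I / L : ℂ)‖ * ‖(m j : ℂ) * c m‖ *
        ‖Complex.ofRealCLM.comp (EuclideanSpace.proj j : E n →L[ℝ] ℝ)‖ :=
      summable_sum fun j _ => ((hd j).norm.mul_left _).mul_right _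
    refine Summable.of_nonneg_of_le (fun m => by positivity) (fun m => ?_) h1
    calc ‖c m‖ * ‖waveForm L m‖ ≤ ‖c m‖ * ∑ j, ‖(2 * Real.pi * Complex.I / L * m j : ℂ) •
          (Complex.ofRealCLM.comp (EuclideanSpace.proj j : E n →L[ℝ] ℝ))‖ := by
          gcongr; exact norm_sum_le _ _
      _ = _ := by
          rw [Finset.mul_sum]
          refine Finset.sum_congr rfl fun j _ => ?_
          rw [norm_smul, norm_mul, norm_mul]
          ring
  have hle : ∀ m (x : E n), ‖(c m * character L m x) • waveForm L m‖ ≤ ‖c m‖ * ‖waveForm L m‖ := by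
    intro m x
    rw [norm_smul, norm_mul, norm_character, mul_one]
  refine ⟨?_, ?_, ?_⟩
  · refine hasFDerivAt_tsum (x₀ := x) hb (fun m y => ?_) hle (summable_mul_character hc x) x
    rw [← smul_smul]
    exact (hasFDerivAt_character m y).const_mul (c m)
  · exact Summable.of_norm_bounded hb fun m => hle m x
  · refine continuous_tsum (fun m => ?_) hb hle
    have := continuous_character (L := L) m
    fun_prop

theorem contDiff_fourierSeries {c : (Fin n → ℤ) → ℂ}
    (hd : ∀ j, Summable fun m => (m j : ℂ) * c m) (hc : Summable c) :
    ContDiff ℝ 1 (fourierSeries L c) := by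
  rw [contDiff_one_iff_hasFDerivAt]
  exact ⟨_, (hasFDerivAt_fourierSeries hd hc 0).2.2, fun x => (hasFDerivAt_fourierSeries hd hc x).1⟩

theorem partialDeriv_fourierSeries {c : (Fin n → ℤ) → ℂ}
    (hd : ∀ j, Summable fun m => (m j : ℂ) * c m) (hc : Summable c) (j : Fin n) (x : E n) :
    partialDeriv j (fourierSeries L c) x
      = fourierSeries L (fun m => 2 * Real.pi * Complex.I / L * m j * c m) x := by
  obtain ⟨h1, h2, -⟩ := hasFDerivAt_fourierSeries (L := L) hd hc x
  rw [partialDeriv, h1.fderiv]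
  have h3 := (ContinuousLinearMap.apply ℝ ℂ (EuclideanSpace.single j (1 : ℝ) : E n)).map_tsum h2
  simp only [ContinuousLinearMap.apply_apply] at h3
  rw [h3, fourierSeries]
  refine tsum_congr fun m => ?_
  simp [waveForm_single]
  ring

theorem integral_character (hL : 0 < L) {m : Fin n → ℤ} (hm : m ≠ 0) :
    ∫ x in cell n L, character L m x = 0 := by
  obtain ⟨j, hj⟩ := Function.ne_iff.1 hm
  have h := (isPeriodic_character hL m).integral_partialDeriv hL (contDiff_character m) j
  simp_rw [partialDeriv_character, integral_const_mul] at h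
  refine (mul_eq_zero.1 h).resolve_left ?_
  have : (m j : ℂ) ≠ 0 := by exact_mod_cast hj
  simp [hL.ne', Real.pi_ne_zero, this]

theorem measureReal_cell (hL : 0 < L) : volume.real (cell n L) = L ^ n := by
  have h := setIntegral_cell_toTorus (n := n) hL fun _ => (1 : ℝ)
  simpa using h

/-- Absolute convergence allows integrating the series term by term, so orthogonality identifies the
Fourier coefficients of the sum with c; then Parseval applies. -/
theorem integral_norm_sq_fourierSeries (hL : 0 < L) {c : (Fin n → ℤ) → ℂ} (hc : Summable c) :
    HasSum (fun m => L ^ n * ‖c m‖ ^ 2) (∫ x in cell n L, ‖fourierSeries L c x‖ ^ 2) := by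
  obtain ⟨W, hW⟩ := (isPeriodic_fourierSeries hL c).exists_lift hL (continuous_fourierSeries hc)
  have h := setIntegral_cell_norm_sq hL (W := W)
  simp only [hW] at h
  have hm : ∀ k, UnitAddTorus.mFourierCoeff W k = c k := by
    intro k
    have h1 := setIntegral_cell_toTorus hL fun t => UnitAddTorus.mFourier (-k) t • W t
    have h2 : UnitAddTorus.mFourierCoeff W k
      = ∫ t, UnitAddTorus.mFourier (-k) t • W t ∂torusMeasure n := rfl
    rw [← h2] at h1
    simp only [hW, ← character_eq_mFourier, smul_eq_mul, Complex.real_smul] at h1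
    have h3 := hasSum_integral_of_summable_integral_norm (μ := volume.restrict (cell n L))
      (F := fun m x => character L (-k) x * (c m * character L m x))
      (fun m => integrableOn_cell ((continuous_character _).mul
        (continuous_const.mul (continuous_character m))))
      (by
        simp only [norm_mul, norm_character, one_mul, mul_one, integral_const]
        exact hc.norm.mul_left _)
    have h4 : ∀ m, ∫ x in cell n L, character L (-k) x * (c m * character L m x)
        = if m = k then L ^ n * c k else 0 := by
      intro m
      have h5 : ∀ x, character L (-k) x * (c m * character L m x) = c m * character L (m - k) x := by
        intro x
        rw [mul_left_comm, character_eq_mFourier, character_eq_mFourier, character_eq_mFourier,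
          ← UnitAddTorus.mFourier_add, neg_add_eq_sub]
      simp_rw [h5, integral_const_mul]
      split_ifs with hmk
      · subst hmk
        have h6 : ∀ x : E n, character L (m - m) x = 1 := by
          intro x; simp [character]
        simp_rw [h6]
        simp [measureReal_cell hL, mul_comm]
      · rw [integral_character hL (sub_ne_zero.2 hmk), mul_zero]
    simp_rw [h4, tsum_mul_left] at h3
    have h7 := h3.unique (hasSum_ite_eq k _)
    simp only [fourierSeries] at h1
    rw [h7] at h1
    have : (L : ℂ) ≠ 0 := by exact_mod_cast hL.ne'
    push_cast at h1
    exact (mul_left_cancel₀ (pow_ne_zero n this) h1).symm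
  simpa only [hm] using h

/-- The `L²` bound of a Fourier multiplier by the supremum of its symbol. Using |Re| ≤ |·| avoids
showing that the series is real. -/
theorem integral_re_sq_fourierSeries_le (hL : 0 < L) {c : (Fin n → ℤ) → ℂ} (hc : Summable c)
    {w : E n → ℝ} (hw : IsPeriodic L w) (hwc : Continuous w) {A : ℝ}
    (hA : ∀ m, ‖c m‖ ≤ A * ‖coeff L w m‖) :
    ∫ x in cell n L, (fourierSeries L c x).re ^ 2 ≤ A ^ 2 * ∫ x in cell n L, w x ^ 2 := by
  have hcont := continuous_fourierSeries (L := L) hc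
  calc ∫ x in cell n L, (fourierSeries L c x).re ^ 2
      ≤ ∫ x in cell n L, ‖fourierSeries L c x‖ ^ 2 := by
        refine setIntegral_mono (integrableOn_cell (by fun_prop)) (integrableOn_cell (by fun_prop))
          fun x => ?_
        dsimp only
        rw [← sq_abs]
        exact pow_le_pow_left₀ (abs_nonneg _) (Complex.abs_re_le_norm _) 2
    _ ≤ A ^ 2 * ∫ x in cell n L, w x ^ 2 := by
        refine hasSum_le (fun m => ?_) (integral_norm_sq_fourierSeries hL hc)
          ((hasSum_sq_coeff hL hw hwc).mul_left (A ^ 2))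
        have := pow_le_pow_left₀ (norm_nonneg _) (hA m) 2
        rw [mul_pow] at this
        rw [mul_left_comm]
        gcongr

/-- The sum of |m|⁻⁴ over a lattice of rank less than 4 converges. The library statement concerns
the sup norm, which is below the Euclidean one; the term m = 0 is zero by the convention 0⁻¹ = 0. -/
theorem summable_lattice (hn : n ≤ 3) :
    Summable fun m : Fin n → ℤ => ((∑ j, (m j : ℝ) ^ 2) ^ 2)⁻¹ := by
  let b := Pi.basisFun ℝ (Fin n)
  let Λ : Submodule ℤ (Fin n → ℝ) := Submodule.span ℤ (Set.range b)
  have hr : Module.finrank ℤ Λ = n := by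
    have := ZLattice.rank ℝ Λ
    simpa using this
  have h := ZLattice.summable_norm_pow_inv Λ 4 (by omega)
  have hmem : ∀ m : Fin n → ℤ, (fun j => (m j : ℝ)) ∈ Λ := by
    intro m
    have : (fun j => (m j : ℝ)) = ∑ j, m j • b j := by
      funext i
      simp [b, Pi.single_apply]
    rw [this]
    exact Submodule.sum_mem _ fun j _ => Submodule.smul_mem _ _ (Submodule.subset_span ⟨j, rfl⟩)
  have hinj : Function.Injective fun m : Fin n → ℤ => (⟨fun j => (m j : ℝ), hmem m⟩ : Λ) := by
    intro m m' h
    funext j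
    have : (m j : ℝ) = m' j := congrFun (congrArg Subtype.val h) j
    exact_mod_cast this
  refine Summable.of_nonneg_of_le (fun m => by positivity) (fun m => ?_) (h.comp_injective hinj)
  simp only [Function.comp]
  by_cases h0 : m = 0
  · subst h0; simp
  have hpos : 0 < ‖(⟨fun j => (m j : ℝ), hmem m⟩ : Λ)‖ := by
    rw [norm_pos_iff]
    intro h1
    refine h0 (hinj (h1.trans ?_))
    ext; simp
  rw [inv_pow]
  refine inv_anti₀ (by positivity) ?_
  have : ‖(⟨fun j => (m j : ℝ), hmem m⟩ : Λ)‖ ≤ Real.sqrt (∑ j, (m j : ℝ) ^ 2) := by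
    refine (pi_norm_le_iff_of_nonneg (by positivity)).2 fun j => ?_
    rw [Real.norm_eq_abs]
    refine Real.abs_le_sqrt (Finset.single_le_sum (f := fun j => (m j : ℝ) ^ 2)
      (fun _ _ => by positivity) (Finset.mem_univ j))
  calc ‖(⟨fun j => (m j : ℝ), hmem m⟩ : Λ)‖ ^ 4 ≤ Real.sqrt (∑ j, (m j : ℝ) ^ 2) ^ 4 := by gcongr
    _ = (∑ j, (m j : ℝ) ^ 2) ^ 2 := by
      rw [show 4 = 2 * 2 from rfl, pow_mul, Real.sq_sqrt (by positivity)]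

end PeriodicNSE

/-! ### The multiplier −∂ⱼΔ⁻¹ and summability of Fourier coefficients -/

namespace PeriodicNSE

variable {n : ℕ} {L : ℝ}

theorem norm_normSq_inv_mul_le (m : Fin n → ℤ) (j k : Fin n) :
    ‖(normSq m)⁻¹ * m j * m k‖ ≤ 1 := by
  have h1 : normSq m = ((∑ j, (m j : ℝ) ^ 2 : ℝ) : ℂ) := by simp [normSq]
  have h0 : 0 ≤ ∑ j, (m j : ℝ) ^ 2 := Finset.sum_nonneg fun _ _ => sq_nonneg _
  have hj := Finset.single_le_sum (f := fun j => (m j : ℝ) ^ 2)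
      (fun _ _ => by positivity) (Finset.mem_univ j)
  have hk := Finset.single_le_sum (f := fun j => (m j : ℝ) ^ 2)
      (fun _ _ => by positivity) (Finset.mem_univ k)
  rw [h1, norm_mul, norm_mul, norm_inv, Complex.norm_real, Complex.norm_intCast,
    Complex.norm_intCast, Real.norm_of_nonneg h0, mul_assoc]
  refine inv_mul_le_one_of_le₀ ?_ h0
  nlinarith [sq_nonneg (|(m j : ℝ)| - |(m k : ℝ)|), sq_abs (m j : ℝ), sq_abs (m k : ℝ)]

/-- A nonzero integer component has |m_j| ≥ 1, so multiplying by it once more can only increase the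
norm. -/
theorem norm_normSq_inv_mul_le' (m : Fin n → ℤ) (j : Fin n) :
    ‖(normSq m)⁻¹ * m j‖ ≤ 1 := by
  by_cases h : m j = 0
  · simp [h]
  refine le_trans ?_ (norm_normSq_inv_mul_le m j j)
  rw [norm_mul (_ * _) (m j : ℂ)]
  refine le_mul_of_one_le_right (by positivity) ?_
  rw [Complex.norm_intCast]
  exact_mod_cast Int.one_le_abs h

/-- The coefficients of the operator `gradInvLap`. -/
noncomputable def symbol (L : ℝ) (j : Fin n) (m : Fin n → ℤ) : ℂ :=
  Complex.I * L / (2 * Real.pi) * ((normSq m)⁻¹ * m j)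

/-- The operator with the symbol `(iL/2π) m_j/|m|²`. -/
noncomputable def gradInvLap (L : ℝ) (j : Fin n) (w : E n → ℝ) (x : E n) : ℝ :=
  (fourierSeries L (fun m => symbol L j m * coeff L w m) x).re

theorem norm_symbol_le (hL : 0 < L) (j : Fin n) (m : Fin n → ℤ) : ‖symbol L j m‖ ≤ L := by
  rw [symbol, norm_mul]
  have h1 : ‖(Complex.I * L / (2 * Real.pi) : ℂ)‖ = L / (2 * Real.pi) := by
    simp [abs_of_pos hL, abs_of_pos Real.pi_pos]
  rw [h1]
  calc L / (2 * Real.pi) * ‖(normSq m)⁻¹ * m j‖ ≤ L / (2 * Real.pi) * 1 := by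
        gcongr; exact norm_normSq_inv_mul_le' m j
    _ ≤ L := by
        rw [mul_one]
        exact div_le_self hL.le (by linarith [Real.pi_gt_three])

theorem symbol_mul (hL : 0 < L) (j k : Fin n) (m : Fin n → ℤ) :
    2 * Real.pi * Complex.I / L * m k * symbol L j m = -((normSq m)⁻¹ * m j * m k) := by
  have h1 : (L : ℂ) ≠ 0 := by exact_mod_cast hL.ne'
  have h2 : (Real.pi : ℂ) ≠ 0 := by exact_mod_cast Real.pi_ne_zero
  rw [symbol]
  field_simp
  rw [Complex.I_sq]
  ring

theorem norm_mul_symbol_le (hL : 0 < L) (j k : Fin n) (m : Fin n → ℤ) :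
    ‖(m k : ℂ) * symbol L j m‖ ≤ L := by
  have h1 : (m k : ℂ) * symbol L j m = Complex.I * L / (2 * Real.pi) * ((normSq m)⁻¹ * m j * m k) := by
    rw [symbol]; ring
  rw [h1, norm_mul]
  have h1 : ‖(Complex.I * L / (2 * Real.pi) : ℂ)‖ = L / (2 * Real.pi) := by
    simp [abs_of_pos hL, abs_of_pos Real.pi_pos]
  rw [h1]
  calc L / (2 * Real.pi) * ‖(normSq m)⁻¹ * m j * m k‖ ≤ L / (2 * Real.pi) * 1 := by
        gcongr; exact norm_normSq_inv_mul_le m j k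
    _ ≤ L := by
        rw [mul_one]
        exact div_le_self hL.le (by linarith [Real.pi_gt_three])

section summable

variable {w : E n → ℝ}

theorem summable_symbol_mul (hL : 0 < L) (j : Fin n) (hs : Summable (coeff L w)) :
    Summable fun m => symbol L j m * coeff L w m := by
  refine Summable.of_norm_bounded (hs.norm.mul_left L) fun m => ?_
  rw [norm_mul]
  gcongr
  exact norm_symbol_le hL j m

theorem summable_mul_symbol_mul (hL : 0 < L) (j k : Fin n) (hs : Summable (coeff L w)) :
    Summable fun m => (m k : ℂ) * (symbol L j m * coeff L w m) := by
  refine Summable.of_norm_bounded (hs.norm.mul_left L) fun m => ?_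
  rw [← mul_assoc, norm_mul _ (coeff L w m)]
  gcongr
  exact norm_mul_symbol_le hL j k m

theorem isPeriodic_gradInvLap (hL : 0 < L) (j : Fin n) : IsPeriodic L (gradInvLap L j w) :=
  (isPeriodic_fourierSeries hL _).comp Complex.re

theorem contDiff_gradInvLap (hL : 0 < L) (j : Fin n) (hs : Summable (coeff L w)) :
    ContDiff ℝ 1 (gradInvLap L j w) :=
  Complex.reCLM.contDiff.comp (contDiff_fourierSeries (fun k => summable_mul_symbol_mul hL j k hs)
    (summable_symbol_mul hL j hs))

theorem partialDeriv_gradInvLap (hL : 0 < L) (j k : Fin n) (hs : Summable (coeff L w)) (x : E n) :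
    partialDeriv k (gradInvLap L j w) x
      = (fourierSeries L (fun m => -((normSq m)⁻¹ * m j * m k) * coeff L w m) x).re := by
  have h1 := contDiff_fourierSeries (L := L) (fun k => summable_mul_symbol_mul hL j k hs)
    (summable_symbol_mul hL j hs)
  have h2 := partialDeriv_re (h1.differentiable one_ne_zero x) k
  rw [partialDeriv_fourierSeries (fun k => summable_mul_symbol_mul hL j k hs)
    (summable_symbol_mul hL j hs)] at h2
  simp_rw [← mul_assoc (_ * _) (symbol L j _), symbol_mul hL] at h2
  exact h2

/-- The composed symbol −m_j m_k/|m|² is symmetric in j and k. This is why the Biot-Savart field is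
divergence free. -/
theorem partialDeriv_gradInvLap_comm (hL : 0 < L) (j k : Fin n) (hs : Summable (coeff L w))
    (x : E n) :
    partialDeriv k (gradInvLap L j w) x = partialDeriv j (gradInvLap L k w) x := by
  rw [partialDeriv_gradInvLap hL j k hs, partialDeriv_gradInvLap hL k j hs]
  simp_rw [mul_right_comm _ ((_ : ℤ) : ℂ) ((_ : ℤ) : ℂ)]

theorem integral_gradInvLap_sq_le (hL : 0 < L) (j : Fin n) (hw : IsPeriodic L w)
    (hc : Continuous w) (hs : Summable (coeff L w)) :
    ∫ x in cell n L, gradInvLap L j w x ^ 2 ≤ L ^ 2 * ∫ x in cell n L, w x ^ 2 := by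
  refine integral_re_sq_fourierSeries_le hL (summable_symbol_mul hL j hs) hw hc fun m => ?_
  rw [norm_mul]
  gcongr
  exact norm_symbol_le hL j m

/-- The symbol −m_j m_k/|m|² has modulus at most 1: the operator gains one derivative in `L²`. -/
theorem integral_partialDeriv_gradInvLap_sq_le (hL : 0 < L) (j k : Fin n) (hw : IsPeriodic L w)
    (hc : Continuous w) (hs : Summable (coeff L w)) :
    ∫ x in cell n L, partialDeriv k (gradInvLap L j w) x ^ 2 ≤ ∫ x in cell n L, w x ^ 2 := by
  have hb : ∀ m, ‖-((normSq m)⁻¹ * m j * m k) * coeff L w m‖ ≤ 1 * ‖coeff L w m‖ := by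
    intro m
    rw [norm_mul, norm_neg]
    gcongr
    exact norm_normSq_inv_mul_le m j k
  simp_rw [partialDeriv_gradInvLap hL j k hs]
  have h := integral_re_sq_fourierSeries_le hL
    (Summable.of_norm_bounded (hs.norm.mul_left 1) hb) hw hc hb
  simpa using h

theorem coeff_sub {v : E n → ℝ} (hv : Continuous v) (hw : Continuous w) (m : Fin n → ℤ) :
    coeff L (fun x => v x - w x) m = coeff L v m - coeff L w m := by
  have hch := continuous_character (L := L) (-m)
  simp only [coeff, Complex.ofReal_sub, sub_mul]
  rw [integral_sub, mul_sub]
  · exact integrableOn_cell (by fun_prop)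
  · exact integrableOn_cell (by fun_prop)

theorem gradInvLap_sub (hL : 0 < L) {v : E n → ℝ} (hv : Continuous v) (hw : Continuous w)
    (hsv : Summable (coeff L v)) (hsw : Summable (coeff L w)) (j : Fin n) (x : E n) :
    gradInvLap L j (fun x => v x - w x) x = gradInvLap L j v x - gradInvLap L j w x := by
  simp only [gradInvLap, coeff_sub hv hw, mul_sub]
  rw [fourierSeries_sub (summable_symbol_mul hL j hsv) (summable_symbol_mul hL j hsw)]
  simp

theorem gradInvLap_partialDeriv_comm (hL : 0 < L) (hw : IsPeriodic L w) (hc : ContDiff ℝ 1 w)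
    (j k : Fin n) : gradInvLap L j (partialDeriv k w) = gradInvLap L k (partialDeriv j w) := by
  funext x
  simp only [gradInvLap, coeff_partialDeriv hL hw hc, symbol]
  congr 3
  funext m
  ring

theorem coeff_zero : coeff L w 0 = ((L ^ n)⁻¹ * ∫ x in cell n L, w x : ℝ) := by
  have : ∀ x : E n, character L (-0) x = 1 := fun x => by simp [character]
  simp only [coeff, this, mul_one]
  push_cast
  congr 1
  exact integral_ofReal

/-- The symbols add up to −Σ m_j²/|m|² = −1 for m ≠ 0, and the mode m = 0 is absent because the
average vanishes. Absolute convergence permits comparison of the series at every point, not only in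
`L²`. -/
theorem sum_gradInvLap_partialDeriv (hL : 0 < L) (hw : IsPeriodic L w) (hc : ContDiff ℝ 1 w)
    (hs : Summable (coeff L w)) (hs' : ∀ j, Summable (coeff L (partialDeriv j w)))
    (h0 : ∫ x in cell n L, w x = 0) (x : E n) :
    ∑ j, gradInvLap L j (partialDeriv j w) x = - w x := by
  have hsum := (hasSum_coeff_mul_character hL hw hc.continuous hs x).tsum_eq
  simp only [gradInvLap, ← Complex.re_sum, fourierSeries]
  rw [← Summable.tsum_finsetSum fun j _ =>
    summable_mul_character (summable_symbol_mul hL j (hs' j)) x]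
  rw [← Complex.ofReal_re (w x), ← hsum, ← Complex.neg_re, ← tsum_neg]
  congr 2
  funext m
  rw [← Finset.sum_mul, ← neg_mul]
  congr 1
  simp_rw [coeff_partialDeriv hL hw hc]
  by_cases hm : m = 0
  · subst hm
    simp [coeff_zero, h0]
  have hn : normSq m ≠ 0 := by
    have h1 : normSq m = ((∑ j, (m j : ℝ) ^ 2 : ℝ) : ℂ) := by simp [normSq]
    rw [h1]
    obtain ⟨j, hj⟩ := Function.ne_iff.1 hm
    have h2 : (m j : ℝ) ≠ 0 := by exact_mod_cast hj
    have : 0 < ∑ j, (m j : ℝ) ^ 2 :=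
      Finset.sum_pos' (fun _ _ => sq_nonneg _) ⟨j, Finset.mem_univ j, by positivity⟩
    exact_mod_cast this.ne'
  calc ∑ j, symbol L j m * (2 * Real.pi * Complex.I / L * m j * coeff L w m)
      = ∑ j, -((normSq m)⁻¹ * m j * m j) * coeff L w m := by
        refine Finset.sum_congr rfl fun j _ => ?_
        rw [← symbol_mul hL]; ring
    _ = -((normSq m)⁻¹ * normSq m) * coeff L w m := by
        rw [← Finset.sum_mul, Finset.sum_neg_distrib, normSq, Finset.mul_sum]
        simp_rw [mul_assoc, ← sq]
    _ = -coeff L w m := by rw [inv_mul_cancel₀ hn]; ring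

end summable

theorem ContDiff.partialDeriv {F : Type*} [NormedAddCommGroup F] [NormedSpace ℝ F] {w : E n → F}
    {k l : WithTop ℕ∞} (hw : ContDiff ℝ l w) (hk : k + 1 ≤ l) (i : Fin n) :
    ContDiff ℝ k (partialDeriv i w) :=
  (hw.fderiv_right hk).clm_apply contDiff_const

/-- Write |w_m| = |m|⁻² · |m|²|w_m|. The first factor is square summable for n ≤ 3, the second by
Parseval for the pure second derivatives. This is the reason why two continuous derivatives are
required of the vorticity at grid points. -/
theorem summable_coeff (hn : n ≤ 3) (hL : 0 < L) {w : E n → ℝ} (hw : IsPeriodic L w)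
    (hc : ContDiff ℝ 2 w) : Summable (coeff L w) := by
  have hc1 : ContDiff ℝ 1 w := hc.of_le one_le_two
  have hd : ∀ j, ContDiff ℝ 1 (partialDeriv j w) := fun j =>
    PeriodicNSE.ContDiff.partialDeriv hc (by norm_num) j
  have hdd : ∀ j, Continuous (partialDeriv j (partialDeriv j w)) := fun j =>
    continuous_partialDeriv (hd j) j
  have h1 : ∀ j, Summable fun m => ‖coeff L (partialDeriv j (partialDeriv j w)) m‖ ^ 2 := fun j => by
    have := (hasSum_sq_coeff hL ((hw.partialDeriv j).partialDeriv j) (hdd j)).summable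
    exact (summable_mul_left_iff (pow_ne_zero n hL.ne')).1 this
  have h2 : ∀ j, Summable fun m : Fin n → ℤ => ((m j : ℝ) ^ 2 * ‖coeff L w m‖) ^ 2 := fun j => by
    refine ((h1 j).mul_left ((L / (2 * Real.pi)) ^ 4)).congr fun m => ?_
    rw [coeff_partialDeriv hL (hw.partialDeriv j) (hd j), coeff_partialDeriv hL hw hc1]
    simp only [norm_mul, norm_div, Complex.norm_real, Complex.norm_I, Complex.norm_intCast,
      Complex.norm_ofNat, Real.norm_eq_abs, abs_of_pos hL, abs_of_pos Real.pi_pos, mul_pow, sq_abs]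
    have := hL.ne'
    have := Real.pi_ne_zero
    field_simp
  have h3 : Summable fun m : Fin n → ℤ =>
      ((∑ j, (m j : ℝ) ^ 2) ^ 2)⁻¹ + n * ∑ j, ((m j : ℝ) ^ 2 * ‖coeff L w m‖) ^ 2 :=
    (summable_lattice hn).add ((summable_sum fun j _ => h2 j).mul_left _)
  -- The mode m = 0 is discarded: there the majorant need not dominate the coefficient.
  refine Summable.of_norm_bounded_eventually h3 ?_
  rw [Filter.eventually_cofinite]
  refine (Set.finite_singleton (0 : Fin n → ℤ)).subset fun m hm => ?_
  by_contra h0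
  refine hm ?_
  obtain ⟨j, hj⟩ := Function.ne_iff.1 (h0 : m ≠ 0)
  have h4 : (m j : ℝ) ≠ 0 := by exact_mod_cast hj
  have hpos : 0 < ∑ j, (m j : ℝ) ^ 2 :=
      Finset.sum_pos' (fun _ _ => sq_nonneg _) ⟨j, Finset.mem_univ j, by positivity⟩
  set q := ∑ j, (m j : ℝ) ^ 2 with hq
  have h5 : (q * ‖coeff L w m‖) ^ 2 ≤ n * ∑ j, ((m j : ℝ) ^ 2 * ‖coeff L w m‖) ^ 2 := by
    rw [hq, Finset.sum_mul]
    simpa using sq_sum_le_card_mul_sum_sq (s := Finset.univ)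
      (f := fun j => (m j : ℝ) ^ 2 * ‖coeff L w m‖)
  refine le_trans ?_ (add_le_add_right h5 _)
  have h6 : ‖coeff L w m‖ = q⁻¹ * (q * ‖coeff L w m‖) := by field_simp
  rw [← inv_pow]
  conv_lhs => rw [h6]
  nlinarith [sq_nonneg (q⁻¹ - (q * ‖coeff L w m‖)), sq_nonneg (q⁻¹ + (q * ‖coeff L w m‖))]

end PeriodicNSE

/-! ### The Biot-Savart operator inverts the curl; H¹ control of the velocity error -/

namespace PeriodicNSE

variable {n : ℕ} {L : ℝ}

theorem coeff_neg (w : E n → ℝ) (m : Fin n → ℤ) :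
    coeff L (fun x => - w x) m = - coeff L w m := by
  simp only [coeff, Complex.ofReal_neg, neg_mul]
  rw [integral_neg, mul_neg]

theorem gradInvLap_neg (j : Fin n) (w : E n → ℝ) (x : E n) :
    gradInvLap L j (fun x => - w x) x = - gradInvLap L j w x := by
  simp only [gradInvLap, coeff_neg, fourierSeries, mul_neg, neg_mul, tsum_neg, Complex.neg_re]

theorem gradInvLap_zero (j : Fin n) (x : E n) :
    gradInvLap L j (fun _ => 0) x = 0 := by
  simp [gradInvLap, coeff, fourierSeries]

theorem sum_coeff {ι : Type*} (s : Finset ι) {w : ι → E n → ℝ} (hw : ∀ i ∈ s, Continuous (w i))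
    (m : Fin n → ℤ) : coeff L (fun x => ∑ i ∈ s, w i x) m = ∑ i ∈ s, coeff L (w i) m := by
  have hch := continuous_character (L := L) (-m)
  simp only [coeff, Complex.ofReal_sum, Finset.sum_mul]
  rw [integral_finsetSum, Finset.mul_sum]
  intro i hi
  have := hw i hi
  exact integrableOn_cell (by fun_prop)

/-- A periodic divergence-free field with zero average is recovered from its exterior
derivative. -/
theorem sum_gradInvLap_exterior (hn : n ≤ 3) (hL : 0 < L) {v : Fin n → E n → ℝ}
    (hv : ∀ i, IsPeriodic L (v i)) (hc : ∀ i, ContDiff ℝ 3 (v i))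
    (hdiv : ∀ x, ∑ j, partialDeriv j (v j) x = 0) (h0 : ∀ i, ∫ x in cell n L, v i x = 0)
    (i : Fin n) (x : E n) :
    ∑ j, gradInvLap L j (fun x => partialDeriv i (v j) x - partialDeriv j (v i) x) x = v i x := by
  have hd : ∀ i j, ContDiff ℝ 2 (partialDeriv j (v i)) := fun i j =>
    PeriodicNSE.ContDiff.partialDeriv (hc i) (by norm_num) j
  have hs : ∀ i j, Summable (coeff L (partialDeriv j (v i))) := fun i j =>
    summable_coeff hn hL ((hv i).partialDeriv j) (hd i j)
  have hc1 : ∀ i, ContDiff ℝ 1 (v i) := fun i => (hc i).of_le (by norm_num)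
  have h1 := sum_gradInvLap_partialDeriv hL (hv i) (hc1 i)
    (summable_coeff hn hL (hv i) ((hc i).of_le (by norm_num))) (hs i) (h0 i) x
  -- By linearity this is the multiplier with index i applied to div v = 0. It is computed on
  -- coefficients, where the finite sum can be taken inside.
  have h2 : ∑ j, gradInvLap L i (partialDeriv j (v j)) x = 0 := by
    simp only [gradInvLap, ← Complex.re_sum, fourierSeries]
    rw [← Summable.tsum_finsetSum fun j _ =>
      summable_mul_character (summable_symbol_mul hL i (hs j j)) x]
    have : ∀ m, ∑ j, symbol L i m * coeff L (partialDeriv j (v j)) m * character L m x = 0 := by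
      intro m
      rw [← Finset.sum_mul, ← Finset.mul_sum, ← sum_coeff _ fun j _ => (hd j j).continuous]
      simp [hdiv, coeff]
    simp [this]
  -- The indices i and j of multiplier and derivative may be exchanged in the first part, which
  -- turns it into a divergence after summation over j; the second part gives −v_i by inversion of
  -- the Laplacian.
  have h3 : ∀ j, gradInvLap L j (fun x => partialDeriv i (v j) x - partialDeriv j (v i) x) x
      = gradInvLap L i (partialDeriv j (v j)) x - gradInvLap L j (partialDeriv j (v i)) x := by
    intro j
    rw [gradInvLap_sub hL (hd j i).continuous (hd i j).continuous (hs j i) (hs i j),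
      gradInvLap_partialDeriv_comm hL (hv j) (hc1 j)]
  simp_rw [h3, Finset.sum_sub_distrib, h1, h2]
  simp

theorem partialDeriv_apply {k : ℕ} {v : E n → E k} {x : E n} (hv : DifferentiableAt ℝ v x)
    (i : Fin n) (j : Fin k) : partialDeriv i v x j = partialDeriv i (fun y => v y j) x := by
  have := (EuclideanSpace.proj (𝕜 := ℝ) j).hasFDerivAt.comp x hv.hasFDerivAt
  exact (congrArg (fun f => f (EuclideanSpace.single i 1)) this.fderiv).symm

theorem integral_cell_apply {k : ℕ} {v : E n → E k} (hv : Continuous v) (i : Fin k) :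
    ∫ x in cell n L, v x i = (∫ x in cell n L, v x) i :=
  (EuclideanSpace.proj (𝕜 := ℝ) i).integral_comp_comm (integrableOn_cell hv)

theorem biotSavart2_eq (w : E 2 → ℝ) (x : E 2) (i : Fin 2) :
    biotSavart2 L w x i = ![gradInvLap L 1 w x, - gradInvLap L 0 w x] i := by
  fin_cases i
  · simp only [biotSavart2, gradInvLap, fourierSeries, symbol, ← tsum_mul_left]
    dsimp
    congr 2
    funext m
    ring
  · simp only [biotSavart2, gradInvLap, fourierSeries, symbol, ← tsum_mul_left]
    dsimp
    rw [← Complex.neg_re, ← tsum_neg]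
    congr 2
    funext m
    ring

/-- The cross product in cyclic form: component i is built from the indices i + 1 and i + 2 in `Fin
3`. The same cyclic convention serves for the curl in `curl3_apply`. -/
theorem biotSavart3_eq (hL : 0 < L) {w : E 3 → E 3} (hs : ∀ i, Summable (coeff L fun y => w y i))
    (x : E 3) (i : Fin 3) :
    biotSavart3 L w x i = gradInvLap L (i + 1) (fun y => w y (i + 2)) x
      - gradInvLap L (i + 2) (fun y => w y (i + 1)) x := by
  rw [gradInvLap, gradInvLap, ← Complex.sub_re,
    ← fourierSeries_sub (summable_symbol_mul hL _ (hs _)) (summable_symbol_mul hL _ (hs _))]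
  simp only [biotSavart3, fourierSeries, symbol, ← tsum_mul_left]
  congr 2
  funext m
  fin_cases i <;> simp [cross_apply] <;> ring

/-- The data of a velocity error `V` that is controlled in `H¹` by the vorticity error, whose
square integral is at most `Y`. -/
structure IsVelocityError (L Y : ℝ) (V : Fin n → E n → ℝ) : Prop where
  contDiff : ∀ i, ContDiff ℝ 1 (V i)
  periodic : ∀ i, IsPeriodic L (V i)
  div_free : ∀ x, ∑ j, partialDeriv j (V j) x = 0
  sq_le : ∀ i, ∫ x in cell n L, V i x ^ 2 ≤ (2 * L ^ 2 + 2) * Y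
  deriv_sq_le : ∀ i j, ∫ x in cell n L, partialDeriv j (V i) x ^ 2 ≤ (2 * L ^ 2 + 2) * Y

theorem partialDeriv_neg (w : E n → ℝ) (i : Fin n) (x : E n) :
    partialDeriv i (fun x => - w x) x = - partialDeriv i w x := by
  simp only [partialDeriv]
  rw [fderiv_fun_neg]; rfl

theorem partialDeriv_sub {F : Type*} [NormedAddCommGroup F] [NormedSpace ℝ F] {v w : E n → F}
    {x : E n} (hv : DifferentiableAt ℝ v x)
    (hw : DifferentiableAt ℝ w x) (i : Fin n) :
    partialDeriv i (fun x => v x - w x) x = partialDeriv i v x - partialDeriv i w x := by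
  simp only [partialDeriv]
  rw [fderiv_fun_sub hv hw]; rfl

/-- Since U curl v = v, linearity gives v − U w = U(curl v − w), and this field is taken as V. Its
components are multipliers applied to the scalar vorticity error, so all bounds are multiplier
bounds. -/
theorem exists_velocityError2 (hL : 0 < L) {v : E 2 → E 2} (hv : IsPeriodic L v)
    (hc : ContDiff ℝ 3 v) (hdiv : ∀ x, div v x = 0) (h0 : ∫ x in cell 2 L, v x = 0)
    {w : E 2 → ℝ} (hw : IsPeriodic L w) (hwc : ContDiff ℝ 2 w) :
    ∃ V, IsVelocityError L (∫ x in cell 2 L, (curl2 v x - w x) ^ 2) V ∧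
      ∀ x i, biotSavart2 L w x i = v x i - V i x := by
  have hvd : Differentiable ℝ v := hc.differentiable (by norm_num)
  have hci : ∀ i, ContDiff ℝ 3 fun x => v x i := fun i => by fun_prop
  have hcurl : curl2 v = fun x => partialDeriv 0 (fun y => v y 1) x - partialDeriv 1 (fun y => v y 0) x := by
    funext x; simp only [curl2, partialDeriv_apply (hvd x)]
  have hcc : ContDiff ℝ 2 (curl2 v) := by
    rw [hcurl]
    exact (PeriodicNSE.ContDiff.partialDeriv (hci 1) (by norm_num) 0).sub
      (PeriodicNSE.ContDiff.partialDeriv (hci 0) (by norm_num) 1)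
  have hcp : IsPeriodic L (curl2 v) := (hv.partialDeriv 0).comp₂ (hv.partialDeriv 1)
    fun a b => a 1 - b 0
  have hs1 := summable_coeff (by norm_num) hL hcp hcc
  have hs2 := summable_coeff (by norm_num) hL hw hwc
  set Z : E 2 → ℝ := fun x => curl2 v x - w x with hZ
  have hZc : ContDiff ℝ 2 Z := hcc.sub hwc
  have hZp : IsPeriodic L Z := hcp.comp₂ hw (· - ·)
  have hsZ := summable_coeff (by norm_num) hL hZp hZc
  have hYnn : 0 ≤ ∫ x in cell 2 L, Z x ^ 2 := integral_nonneg fun _ => sq_nonneg _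
  have hG := sum_gradInvLap_exterior (v := fun i x => v x i) (by norm_num) hL
    (fun i => hv.comp fun y => y i) hci
    (fun x => by simpa [div, partialDeriv_apply (hvd x)] using hdiv x)
    (fun i => by rw [integral_cell_apply hc.continuous, h0]; rfl)
  refine ⟨![gradInvLap L 1 Z, fun x => - gradInvLap L 0 Z x], ⟨?_, ?_, ?_, ?_, ?_⟩, ?_⟩
  · intro i; fin_cases i
    · exact contDiff_gradInvLap hL 1 hsZ
    · exact (contDiff_gradInvLap hL 0 hsZ).neg
  · intro i; fin_cases i
    · exact isPeriodic_gradInvLap hL 1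
    · exact (isPeriodic_gradInvLap hL 0).comp (- ·)
  · intro x
    simp [partialDeriv_neg, partialDeriv_gradInvLap_comm hL 0 1 hsZ]
  · intro i
    have h1 := fun j => integral_gradInvLap_sq_le hL j hZp hZc.continuous hsZ
    fin_cases i <;> simp <;> nlinarith [h1 0, h1 1, sq_nonneg L]
  · intro i j
    have h1 := fun i => integral_partialDeriv_gradInvLap_sq_le hL i j hZp hZc.continuous hsZ
    fin_cases i <;> simp [partialDeriv_neg] <;> nlinarith [h1 0, h1 1, sq_nonneg L]
  · intro x i
    have h1 : ∀ j, gradInvLap L j Z x = gradInvLap L j (curl2 v) x - gradInvLap L j w x := fun j =>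
      gradInvLap_sub hL hcc.continuous hwc.continuous hs1 hs2 j x
    have h2 := hG i x
    rw [biotSavart2_eq]
    fin_cases i
    · simp only [Fin.sum_univ_two, Fin.zero_eta, sub_self, gradInvLap_zero, zero_add, ← hcurl] at h2
      simp [h1, h2]
    · have h3 : (fun x => partialDeriv 1 (fun y => v y 0) x - partialDeriv 0 (fun y => v y 1) x)
        = fun x => - curl2 v x := by rw [hcurl]; funext x; ring
      simp only [Fin.sum_univ_two, Fin.mk_one, sub_self, gradInvLap_zero, add_zero, h3,
        gradInvLap_neg] at h2
      simp [h1, ← h2]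
      ring

theorem integral_sub_sq_le {f g : E n → ℝ} (hf : Continuous f) (hg : Continuous g) :
    ∫ x in cell n L, (f x - g x) ^ 2
      ≤ 2 * (∫ x in cell n L, f x ^ 2) + 2 * ∫ x in cell n L, g x ^ 2 := by
  rw [← integral_const_mul, ← integral_const_mul, ← integral_add]
  · refine setIntegral_mono (integrableOn_cell (by fun_prop)) (integrableOn_cell (by fun_prop))
      fun x => ?_
    dsimp only
    nlinarith [sq_nonneg (f x + g x)]
  · exact integrableOn_cell (by fun_prop)
  · exact integrableOn_cell (by fun_prop)

theorem curl3_apply {v : E 3 → E 3} (hv : Differentiable ℝ v) (x : E 3) (i : Fin 3) :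
    curl3 v x i = partialDeriv (i + 1) (fun y => v y (i + 2)) x
      - partialDeriv (i + 2) (fun y => v y (i + 1)) x := by
  rw [← partialDeriv_apply (hv x), ← partialDeriv_apply (hv x)]
  fin_cases i <;> rfl

/-- Again V = U(curl v − w). Each component is now a difference of two multipliers, and (f − g)² ≤
2f² + 2g² produces 2L² for the field and 2 for its derivatives; the constant 2L² + 2 of
`IsVelocityError` covers both. -/
theorem exists_velocityError3 (hL : 0 < L) {v : E 3 → E 3} (hv : IsPeriodic L v)
    (hc : ContDiff ℝ 3 v) (hdiv : ∀ x, div v x = 0) (h0 : ∫ x in cell 3 L, v x = 0)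
    {w : E 3 → E 3} (hw : IsPeriodic L w) (hwc : ContDiff ℝ 2 w) :
    ∃ V, IsVelocityError L (∑ i, ∫ x in cell 3 L, (curl3 v x i - w x i) ^ 2) V ∧
      ∀ x i, biotSavart3 L w x i = v x i - V i x := by
  have hvd : Differentiable ℝ v := hc.differentiable (by norm_num)
  have hci : ∀ i, ContDiff ℝ 3 fun x => v x i := fun i => by fun_prop
  have hcc : ∀ i, ContDiff ℝ 2 fun x => curl3 v x i := fun i => by
    simp only [curl3_apply hvd]
    exact (PeriodicNSE.ContDiff.partialDeriv (hci _) (by norm_num) _).sub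
      (PeriodicNSE.ContDiff.partialDeriv (hci _) (by norm_num) _)
  have hcp : ∀ i, IsPeriodic L fun x => curl3 v x i := fun i => by
    simp only [curl3_apply hvd]
    exact ((hv.comp fun y => y (i + 2)).partialDeriv (i + 1)).comp₂
      ((hv.comp fun y => y (i + 1)).partialDeriv (i + 2)) (· - ·)
  have hwci : ∀ i, ContDiff ℝ 2 fun x => w x i := fun i => by fun_prop
  have hwp : ∀ i, IsPeriodic L fun x => w x i := fun i => hw.comp fun y => y i
  have hs1 := fun i => summable_coeff (by norm_num) hL (hcp i) (hcc i)
  have hs2 := fun i => summable_coeff (by norm_num) hL (hwp i) (hwci i)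
  set Z : Fin 3 → E 3 → ℝ := fun i x => curl3 v x i - w x i with hZ
  have hZc : ∀ i, ContDiff ℝ 2 (Z i) := fun i => (hcc i).sub (hwci i)
  have hZp : ∀ i, IsPeriodic L (Z i) := fun i => (hcp i).comp₂ (hwp i) (· - ·)
  have hsZ := fun i => summable_coeff (by norm_num) hL (hZp i) (hZc i)
  have hYnn : ∀ i, 0 ≤ ∫ x in cell 3 L, Z i x ^ 2 := fun i => integral_nonneg fun _ => sq_nonneg _
  have hY : ∀ i : Fin 3, ∑ i, ∫ x in cell 3 L, Z i x ^ 2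
      = (∫ x in cell 3 L, Z i x ^ 2) + (∫ x in cell 3 L, Z (i + 1) x ^ 2)
        + ∫ x in cell 3 L, Z (i + 2) x ^ 2 := by
    intro i
    rw [Fin.sum_univ_three]
    fin_cases i <;> simp <;> ring
  have hG := sum_gradInvLap_exterior (v := fun i x => v x i) (by norm_num) hL
    (fun i => hv.comp fun y => y i) hci
    (fun x => by simpa [div, partialDeriv_apply (hvd x)] using hdiv x)
    (fun i => by rw [integral_cell_apply hc.continuous, h0]; rfl)
  have hgc : ∀ j i, ContDiff ℝ 1 (gradInvLap L j (Z i)) := fun j i =>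
    contDiff_gradInvLap hL j (hsZ i)
  have hgd : ∀ i k x, partialDeriv k
      (fun x => gradInvLap L (i + 1) (Z (i + 2)) x - gradInvLap L (i + 2) (Z (i + 1)) x) x
      = partialDeriv k (gradInvLap L (i + 1) (Z (i + 2))) x
        - partialDeriv k (gradInvLap L (i + 2) (Z (i + 1))) x := fun i k x =>
    partialDeriv_sub ((hgc _ _).differentiable one_ne_zero x)
      ((hgc _ _).differentiable one_ne_zero x) k
  refine ⟨fun i x => gradInvLap L (i + 1) (Z (i + 2)) x - gradInvLap L (i + 2) (Z (i + 1)) x,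
    ⟨?_, ?_, ?_, ?_, ?_⟩, ?_⟩
  · exact fun i => (hgc _ _).sub (hgc _ _)
  · exact fun i => (isPeriodic_gradInvLap hL _).comp₂ (isPeriodic_gradInvLap hL _) (· - ·)
  · intro x
    have hcm := fun j k i => partialDeriv_gradInvLap_comm hL j k (hsZ i) x
    simp only [hgd, Fin.sum_univ_three]
    have e1 : (0 + 1 : Fin 3) = 1 := rfl
    have e2 : (0 + 2 : Fin 3) = 2 := rfl
    have e3 : (1 + 1 : Fin 3) = 2 := rfl
    have e4 : (1 + 2 : Fin 3) = 0 := rfl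
    have e5 : (2 + 1 : Fin 3) = 0 := rfl
    have e6 : (2 + 2 : Fin 3) = 1 := rfl
    rw [e1, e2, e3, e4, e5, e6, hcm 1 0, hcm 2 0, hcm 2 1]
    ring
  · intro i
    have h1 := fun j i => integral_gradInvLap_sq_le hL j (hZp i) (hZc i).continuous (hsZ i)
    refine (integral_sub_sq_le (hgc _ _).continuous (hgc _ _).continuous).trans ?_
    rw [hY i]
    nlinarith [h1 (i + 1) (i + 2), h1 (i + 2) (i + 1), hYnn i, hYnn (i + 1), hYnn (i + 2),
      mul_nonneg (sq_nonneg L) (hYnn i)]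
  · intro i j
    have h1 := fun i k => integral_partialDeriv_gradInvLap_sq_le hL i j (hZp k) (hZc k).continuous
      (hsZ k)
    simp only [hgd]
    refine (integral_sub_sq_le (continuous_partialDeriv (hgc _ _) _)
      (continuous_partialDeriv (hgc _ _) _)).trans ?_
    have hnn : 0 ≤ ∑ i, ∫ x in cell 3 L, Z i x ^ 2 := Finset.sum_nonneg fun i _ => hYnn i
    have := hY i
    nlinarith [h1 (i + 1) (i + 2), h1 (i + 2) (i + 1), hYnn i, hYnn (i + 1), hYnn (i + 2),
      mul_nonneg (sq_nonneg L) hnn]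
  · intro x i
    have h1 : ∀ j i, gradInvLap L j (Z i) x = gradInvLap L j (fun x => curl3 v x i) x
        - gradInvLap L j (fun x => w x i) x := fun j i =>
      gradInvLap_sub hL (hcc i).continuous (hwci i).continuous (hs1 i) (hs2 i) j x
    have h2 := hG i x
    -- Of the three summands, j = i vanishes, and j = i + 1, j = i + 2 carry the curl components i +
    -- 2 and i + 1, the latter with a minus sign.
    have h3 : ∑ j, gradInvLap L j (fun x => partialDeriv i (fun y => v y j) x
        - partialDeriv j (fun y => v y i) x) x
        = gradInvLap L (i + 1) (fun x => curl3 v x (i + 2)) x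
          - gradInvLap L (i + 2) (fun x => curl3 v x (i + 1)) x := by
      have h4 : ∀ j : Fin 3, (fun x => curl3 v x j) = fun x => partialDeriv (j + 1)
        (fun y => v y (j + 2)) x - partialDeriv (j + 2) (fun y => v y (j + 1)) x := fun j =>
        funext fun x => curl3_apply hvd x j
      have h5 : ∀ j : Fin 3, (fun x => partialDeriv (j + 2)
        (fun y => v y (j + 1)) x - partialDeriv (j + 1) (fun y => v y (j + 2)) x)
          = fun x => - curl3 v x j := fun j => by
        funext x; rw [curl3_apply hvd x j]; ring
      have e : ∀ f : Fin 3 → ℝ, ∑ j, f j = f i + f (i + 1) + f (i + 2) := by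
        intro f; rw [Fin.sum_univ_three]; fin_cases i <;> simp <;> ring
      have e1 : ∀ i : Fin 3, i + 2 + 1 = i ∧ i + 2 + 2 = i + 1 ∧ i + 1 + 2 = i ∧ i + 1 + 1 = i + 2 := by
        decide
      have h6 := h5 (i + 1)
      have h7 := h4 (i + 2)
      simp only [(e1 i).1, (e1 i).2.1, (e1 i).2.2.1, (e1 i).2.2.2] at h6 h7
      rw [e, h6, gradInvLap_neg, h7]
      simp only [sub_self, gradInvLap_zero]
      ring
    dsimp only
    rw [biotSavart3_eq hL hs2, h1, h1]
    linarith

end PeriodicNSE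

/-! ### Energy identities for periodic evolutions -/

namespace PeriodicNSE

variable {n : ℕ} {L : ℝ}

theorem partialDeriv_sum {F ι : Type*} [NormedAddCommGroup F] [NormedSpace ℝ F] {s : Finset ι}
    {w : ι → E n → F} {x : E n} (hw : ∀ j ∈ s, DifferentiableAt ℝ (w j) x) (i : Fin n) :
    partialDeriv i (fun x => ∑ j ∈ s, w j x) x = ∑ j ∈ s, partialDeriv i (w j) x := by
  simp only [partialDeriv]
  rw [fderiv_fun_sum hw]
  simp

theorem partialDeriv_add {F : Type*} [NormedAddCommGroup F] [NormedSpace ℝ F] {v w : E n → F}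
    {x : E n} (hv : DifferentiableAt ℝ v x)
    (hw : DifferentiableAt ℝ w x) (i : Fin n) :
    partialDeriv i (fun x => v x + w x) x = partialDeriv i v x + partialDeriv i w x := by
  simp only [partialDeriv]
  rw [fderiv_fun_add hv hw]; rfl

theorem partialDeriv_const_mul {w : E n → ℝ} {x : E n} (c : ℝ)
    (hw : DifferentiableAt ℝ w x) (i : Fin n) :
    partialDeriv i (fun x => c * w x) x = c * partialDeriv i w x := by
  simp only [partialDeriv]
  rw [fderiv_const_mul hw]; rfl

theorem partialDeriv_comm {F : Type*} [NormedAddCommGroup F] [NormedSpace ℝ F] {w : E n → F}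
    (hw : ContDiff ℝ 2 w) (i j : Fin n) (x : E n) :
    partialDeriv i (partialDeriv j w) x = partialDeriv j (partialDeriv i w) x := by
  have hd : Differentiable ℝ (fderiv ℝ w) :=
    (hw.fderiv_right (m := 1) (by norm_num)).differentiable one_ne_zero
  have h1 : ∀ i j, partialDeriv i (partialDeriv j w) x
      = fderiv ℝ (fderiv ℝ w) x (EuclideanSpace.single i 1) (EuclideanSpace.single j 1) := by
    intro i j
    have := ((hd x).hasFDerivAt.clm_apply (hasFDerivAt_const (EuclideanSpace.single j (1 : ℝ)) x))
    have h2 := congrArg (fun f => f (EuclideanSpace.single i 1)) this.fderiv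
    simpa using! h2
  rw [h1, h1]
  exact (hw.contDiffAt.isSymmSndFDerivAt (by simp)).eq _ _

theorem laplacian_eq_sum {F : Type*} [NormedAddCommGroup F] [NormedSpace ℝ F] {w : E n → F}
    (hw : ContDiff ℝ 2 w) (x : E n) :
    (Δ w) x = ∑ j, partialDeriv j (partialDeriv j w) x := by
  have hd : Differentiable ℝ (fderiv ℝ w) :=
    (hw.fderiv_right (m := 1) (by norm_num)).differentiable one_ne_zero
  rw [InnerProductSpace.laplacian_eq_iteratedFDeriv_orthonormalBasis w (EuclideanSpace.basisFun (Fin n) ℝ)]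
  dsimp only
  refine Finset.sum_congr rfl fun j _ => ?_
  rw [iteratedFDeriv_two_apply]
  have := ((hd x).hasFDerivAt.clm_apply (hasFDerivAt_const (EuclideanSpace.single j (1 : ℝ)) x))
  have h2 := congrArg (fun f => f (EuclideanSpace.single j 1)) this.fderiv
  simpa using! h2.symm

/-- The squared `L²(Q)` norm of the gradient. -/
noncomputable def dissipation (L : ℝ) (z : E n → ℝ) : ℝ :=
  ∑ j, ∫ x in cell n L, partialDeriv j z x ^ 2

theorem dissipation_nonneg (z : E n → ℝ) : 0 ≤ dissipation L z :=
  Finset.sum_nonneg fun _ _ => integral_nonneg fun _ => sq_nonneg _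

theorem integral_mul_laplacian (hL : 0 < L) {z : E n → ℝ} (hz : IsPeriodic L z)
    (hc : ContDiff ℝ 2 z) :
    ∫ x in cell n L, z x * (Δ z) x = - dissipation L z := by
  have hc1 : ContDiff ℝ 1 z := hc.of_le one_le_two
  have hd : ∀ j, ContDiff ℝ 1 (partialDeriv j z) := fun j =>
    PeriodicNSE.ContDiff.partialDeriv hc (by norm_num) j
  simp_rw [laplacian_eq_sum hc, Finset.mul_sum]
  have hdd : ∀ j, Continuous (partialDeriv j (partialDeriv j z)) := fun j =>
    continuous_partialDeriv (hd j) j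
  have h0 := hc.continuous
  rw [integral_finsetSum _ fun j _ => integrableOn_cell (by fun_prop), dissipation, ← Finset.sum_neg_distrib]
  refine Finset.sum_congr rfl fun j _ => ?_
  rw [hz.integral_mul_partialDeriv hL (hz.partialDeriv j) hc1 (hd j)]
  simp_rw [sq]

/-- The integrand is half of v·∇(z²), and integration by parts moves the derivative to v, where it
becomes the divergence. -/
theorem integral_mul_transport (hL : 0 < L) {z : E n → ℝ} (hz : IsPeriodic L z)
    (hc : ContDiff ℝ 1 z) {v : Fin n → E n → ℝ} (hv : ∀ i, IsPeriodic L (v i))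
    (hvc : ∀ i, ContDiff ℝ 1 (v i)) (hdiv : ∀ x, ∑ j, partialDeriv j (v j) x = 0) :
    ∫ x in cell n L, z x * ∑ j, v j x * partialDeriv j z x = 0 := by
  have h1 : ∀ j, ∫ x in cell n L, v j x * partialDeriv j (fun x => z x * z x) x
      = - ∫ x in cell n L, partialDeriv j (v j) x * (z x * z x) := fun j =>
    (hv j).integral_mul_partialDeriv hL (hz.comp₂ hz (· * ·)) (hvc j) (hc.mul hc) j
  have hzd := hc.differentiable one_ne_zero
  simp_rw [fun j x => partialDeriv_mul (hzd x) (hzd x) j] at h1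
  have hci : ∀ j, Continuous (partialDeriv j z) := fun j => continuous_partialDeriv hc j
  have hcv : ∀ j, Continuous (partialDeriv j (v j)) := fun j => continuous_partialDeriv (hvc j) j
  have h0 := hc.continuous
  have hv0 : ∀ j, Continuous (v j) := fun j => (hvc j).continuous
  have h2 : 2 * ∫ x in cell n L, z x * ∑ j, v j x * partialDeriv j z x = 0 := by
    calc 2 * ∫ x in cell n L, z x * ∑ j, v j x * partialDeriv j z x
        = ∑ j, ∫ x in cell n L, v j x * (z x * partialDeriv j z x + partialDeriv j z x * z x) := by
          rw [← integral_finsetSum _ fun j _ => integrableOn_cell (by fun_prop),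
            ← integral_const_mul]
          refine integral_congr_ae (Filter.Eventually.of_forall fun x => ?_)
          dsimp only
          rw [Finset.mul_sum, Finset.mul_sum]
          exact Finset.sum_congr rfl fun j _ => by ring
      _ = 0 := by
          simp_rw [h1]
          rw [Finset.sum_neg_distrib, ← integral_finsetSum _ fun j _ =>
            integrableOn_cell (by fun_prop)]
          simp_rw [← Finset.sum_mul, hdiv]
          simp
  linarith

/-- Joint regularity on `[a, b] × ℝⁿ` of a scalar periodic function with the time derivative
`zt` on `(a, b)`. -/
structure IsEvolution (L a b : ℝ) (z zt : ℝ → E n → ℝ) : Prop where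
  continuousOn : ContinuousOn (fun q : ℝ × E n => z q.1 q.2) (Icc a b ×ˢ univ)
  hasDerivAt : ∀ t ∈ Ioo a b, ∀ x, HasDerivAt (fun s => z s x) (zt t x) t
  continuousOn_deriv : ContinuousOn (fun q : ℝ × E n => zt q.1 q.2) (Ioo a b ×ˢ univ)
  contDiff : ∀ t ∈ Ioo a b, ContDiff ℝ 2 (z t)
  periodic : ∀ t ∈ Icc a b, IsPeriodic L (z t)

theorem IsEvolution.sub {a b : ℝ} {z zt w wt : ℝ → E n → ℝ} (hz : IsEvolution L a b z zt)
    (hw : IsEvolution L a b w wt) :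
    IsEvolution L a b (fun t x => z t x - w t x) fun t x => zt t x - wt t x where
  continuousOn := hz.continuousOn.sub hw.continuousOn
  hasDerivAt t ht x := (hz.hasDerivAt t ht x).sub (hw.hasDerivAt t ht x)
  continuousOn_deriv := hz.continuousOn_deriv.sub hw.continuousOn_deriv
  contDiff t ht := (hz.contDiff t ht).sub (hw.contDiff t ht)
  periodic t ht := (hz.periodic t ht).comp₂ (hw.periodic t ht) (· - ·)

theorem continuous_slice {F : Type*} [TopologicalSpace F] {z : ℝ → E n → F} {s : Set ℝ}
    (h : ContinuousOn (fun q : ℝ × E n => z q.1 q.2) (s ×ˢ univ)) {t : ℝ} (ht : t ∈ s) :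
    Continuous (z t) := by
  have : Continuous fun x : E n => ((t, x) : ℝ × E n) := by fun_prop
  exact h.comp_continuous this fun x => ⟨ht, mem_univ _⟩

theorem exists_bound_of_continuousOn {F : Type*} [NormedAddCommGroup F] {z : ℝ → E n → F}
    {a b : ℝ} (h : ContinuousOn (fun q : ℝ × E n => z q.1 q.2) (Icc a b ×ˢ univ)) (R : ℝ) :
    ∃ M, 0 ≤ M ∧ ∀ t ∈ Icc a b, ∀ x ∈ Metric.closedBall (0 : E n) R, ‖z t x‖ ≤ M := by
  obtain ⟨M, hM⟩ := (isCompact_Icc.prod (isCompact_closedBall (0 : E n) R)).exists_bound_of_continuousOn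
    (h.mono (prod_mono_right (subset_univ _)))
  exact ⟨max M 0, le_max_right _ _, fun t ht x hx => (hM (t, x) ⟨ht, hx⟩).trans (le_max_left _ _)⟩

theorem IsEvolution.continuousOn_energy {a b : ℝ} {z zt : ℝ → E n → ℝ}
    (hz : IsEvolution L a b z zt) :
    ContinuousOn (fun t => ∫ x in cell n L, z t x ^ 2) (Icc a b) := by
  obtain ⟨M, hM0, hM⟩ := exists_bound_of_continuousOn hz.continuousOn (Real.sqrt (n * L ^ 2))
  refine continuousOn_of_dominated (bound := fun _ => M ^ 2) (fun t ht => ?_) (fun t ht => ?_)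
    (integrable_const _) ?_
  · exact ((continuous_slice hz.continuousOn ht).pow 2).aestronglyMeasurable
  · refine (ae_restrict_iff' measurableSet_cell).2 (Filter.Eventually.of_forall fun x hx => ?_)
    rw [norm_pow]
    exact pow_le_pow_left₀ (norm_nonneg _) (hM t ht x (cell_subset_closedBall hx)) 2
  · refine Filter.Eventually.of_forall fun x => ?_
    have : ContinuousOn (fun t : ℝ => z t x) (Icc a b) :=
      hz.continuousOn.comp (f := fun t : ℝ => ((t, x) : ℝ × E n))
        (by fun_prop) fun t ht => ⟨ht, mem_univ _⟩
    exact this.pow 2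

theorem IsEvolution.hasDerivAt_energy {a b : ℝ} {z zt : ℝ → E n → ℝ}
    (hz : IsEvolution L a b z zt) {t : ℝ} (ht : t ∈ Ioo a b) :
    HasDerivAt (fun t => ∫ x in cell n L, z t x ^ 2) (∫ x in cell n L, 2 * (z t x * zt t x)) t := by
  -- The time derivative is continuous only on the open interval and may be unbounded near its ends;
  -- a compact subinterval around t supplies the constant that dominates the difference quotients.
  obtain ⟨a', ha'⟩ := exists_between ht.1
  obtain ⟨b', hb'⟩ := exists_between ht.2
  have hsub : Icc a' b' ⊆ Ioo a b := fun s hs => ⟨ha'.1.trans_le hs.1, hs.2.trans_lt hb'.2⟩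
  have hc1 : ContinuousOn (fun q : ℝ × E n => 2 * (z q.1 q.2 * zt q.1 q.2)) (Icc a' b' ×ˢ univ) :=
    continuousOn_const.mul ((hz.continuousOn.mono (prod_mono_left (hsub.trans Ioo_subset_Icc_self))).mul
      (hz.continuousOn_deriv.mono (prod_mono_left hsub)))
  obtain ⟨M, hM0, hM⟩ := exists_bound_of_continuousOn
    (z := fun t x => 2 * (z t x * zt t x)) hc1 (Real.sqrt (n * L ^ 2))
  have hcs : ∀ s ∈ Ioo a b, Continuous (z s) := fun s hs =>
    continuous_slice hz.continuousOn (Ioo_subset_Icc_self hs)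
  have hmem : Icc a' b' ∈ nhds t := Icc_mem_nhds ha'.2 hb'.1
  refine (hasDerivAt_integral_of_dominated_loc_of_deriv_le
    (F := fun s x => z s x ^ 2) (F' := fun s x => 2 * (z s x * zt s x))
    (bound := fun _ => M) hmem ?_ ?_ ?_ ?_ (integrable_const _) ?_).2
  · filter_upwards [hmem] with s hs
    exact ((hcs s (hsub hs)).pow 2).aestronglyMeasurable
  · exact integrableOn_cell ((hcs t ht).pow 2)
  · exact (continuous_const.mul ((hcs t ht).mul
      (continuous_slice hz.continuousOn_deriv ht))).aestronglyMeasurable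
  · refine (ae_restrict_iff' measurableSet_cell).2 (Filter.Eventually.of_forall fun x hx s hs => ?_)
    exact hM s hs x (cell_subset_closedBall hx)
  · refine Filter.Eventually.of_forall fun x s hs => ?_
    have := (hz.hasDerivAt s (hsub hs) x).pow 2
    convert! this using 1
    simp
    ring

end PeriodicNSE

/-! ### Regularity in space-time and the vorticity equation of the exact solution -/

namespace PeriodicNSE

variable {n : ℕ} {L T : ℝ} {F : Type*} [NormedAddCommGroup F] [NormedSpace ℝ F]

/-- `z` is of class `C^k` on `[0, T] × ℝⁿ`. -/
def IsJointly (T : ℝ) (k : WithTop ℕ∞) (z : ℝ → E n → F) : Prop :=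
  ContDiffOn ℝ k (fun q : ℝ × E n => z q.1 q.2) (Icc 0 T ×ˢ univ)

/-- The time derivative in `[0, T]`. -/
noncomputable def timeDeriv (T : ℝ) (z : ℝ → E n → F) (t : ℝ) (x : E n) : F :=
  derivWithin (fun s => z s x) (Icc 0 T) t

theorem uniqueDiffOn_slab (hT : 0 < T) :
    UniqueDiffOn ℝ (Icc 0 T ×ˢ univ : Set (ℝ × E n)) :=
  (uniqueDiffOn_Icc hT).prod uniqueDiffOn_univ

namespace IsJointly

variable {k l : WithTop ℕ∞} {z : ℝ → E n → F}

theorem mono (h : IsJointly T l z) (hk : k ≤ l) : IsJointly T k z := ContDiffOn.of_le h hk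

theorem slice (h : IsJointly T k z) {t : ℝ} (ht : t ∈ Icc 0 T) : ContDiff ℝ k (z t) := by
  have h1 : ContDiff ℝ k fun x : E n => ((t, x) : ℝ × E n) := by fun_prop
  exact contDiffOn_univ.1 (ContDiffOn.comp (g := fun q : ℝ × E n => z q.1 q.2)
    (t := Icc 0 T ×ˢ univ) h h1.contDiffOn fun x _ => ⟨ht, mem_univ _⟩)

theorem partialDeriv_eq (h : IsJointly T 1 z) {t : ℝ} (ht : t ∈ Icc 0 T) (x : E n) (j : Fin n) :
    partialDeriv j (z t) x = fderivWithin ℝ (fun q : ℝ × E n => z q.1 q.2) (Icc 0 T ×ˢ univ) (t, x)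
      (0, EuclideanSpace.single j 1) := by
  have h1 := (ContDiffOn.differentiableOn h one_ne_zero (t, x) ⟨ht, mem_univ _⟩).hasFDerivWithinAt
  have h2 : HasFDerivWithinAt (fun x : E n => ((t, x) : ℝ × E n)) (ContinuousLinearMap.inr ℝ ℝ (E n))
      univ x := (hasFDerivAt_prodMk_right t x).hasFDerivWithinAt
  have h3 := (HasFDerivWithinAt.comp x h1 h2 fun x _ => ⟨ht, mem_univ _⟩)
  exact congrArg (fun f => f (EuclideanSpace.single j 1)) (hasFDerivWithinAt_univ.1 h3).fderiv

theorem hasDerivWithinAt (h : IsJointly T 1 z) {t : ℝ} (ht : t ∈ Icc 0 T) (x : E n) :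
    HasDerivWithinAt (fun s => z s x) (fderivWithin ℝ (fun q : ℝ × E n => z q.1 q.2)
      (Icc 0 T ×ˢ univ) (t, x) (1, 0)) (Icc 0 T) t := by
  have h1 := (ContDiffOn.differentiableOn h one_ne_zero (t, x) ⟨ht, mem_univ _⟩).hasFDerivWithinAt
  have h2 : HasDerivWithinAt (fun s : ℝ => ((s, x) : ℝ × E n)) (1, 0) (Icc 0 T) t :=
    (hasDerivWithinAt_id t _).prodMk (hasDerivWithinAt_const t _ x)
  exact HasFDerivWithinAt.comp_hasDerivWithinAt (l := fun q : ℝ × E n => z q.1 q.2)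
    (t := Icc 0 T ×ˢ univ) t h1 h2 fun s hs => ⟨hs, mem_univ _⟩

theorem timeDeriv_eq (hT : 0 < T) (h : IsJointly T 1 z) {t : ℝ} (ht : t ∈ Icc 0 T) (x : E n) :
    timeDeriv T z t x = fderivWithin ℝ (fun q : ℝ × E n => z q.1 q.2) (Icc 0 T ×ˢ univ) (t, x)
      (1, 0) :=
  (h.hasDerivWithinAt ht x).derivWithin (uniqueDiffOn_Icc hT t ht)

theorem hasDerivAt_timeDeriv (h : IsJointly T 1 z) {t : ℝ} (ht : t ∈ Ioo 0 T) (x : E n) :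
    HasDerivAt (fun s => z s x) (timeDeriv T z t x) t := by
  rw [timeDeriv_eq (ht.1.trans ht.2) h (Ioo_subset_Icc_self ht)]
  exact (h.hasDerivWithinAt (Ioo_subset_Icc_self ht) x).hasDerivAt (Icc_mem_nhds ht.1 ht.2)

theorem partialDeriv (hT : 0 < T) (h : IsJointly T l z) (hk : k + 1 ≤ l) (j : Fin n) :
    IsJointly T k fun t => partialDeriv j (z t) := by
  have h1 := ContDiffOn.fderivWithin h (uniqueDiffOn_slab hT) hk
  refine ContDiffOn.congr (h1.clm_apply (contDiffOn_const (c := (0, EuclideanSpace.single j 1))))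
    fun q hq => ?_
  exact partialDeriv_eq (h.mono (le_add_self.trans hk)) hq.1 q.2 j

theorem timeDeriv (hT : 0 < T) (h : IsJointly T l z) (hk : k + 1 ≤ l) :
    IsJointly T k (timeDeriv T z) := by
  have h1 := ContDiffOn.fderivWithin h (uniqueDiffOn_slab hT) hk
  refine ContDiffOn.congr (h1.clm_apply (contDiffOn_const (c := (1, 0)))) fun q hq => ?_
  exact timeDeriv_eq hT (h.mono (le_add_self.trans hk)) hq.1 q.2

theorem sub {w : ℝ → E n → F} (h : IsJointly T k z) (hw : IsJointly T k w) :
    IsJointly T k fun t x => z t x - w t x := ContDiffOn.sub h hw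

/-- Both sides are entries of the second derivative of one function on space-time, which is
symmetric. The interior time makes the slab a neighbourhood, so derivatives within it are ordinary
ones. -/
theorem timeDeriv_partialDeriv (h : IsJointly T 2 z) {t : ℝ} (ht : t ∈ Ioo 0 T) (x : E n)
    (j : Fin n) :
    PeriodicNSE.timeDeriv T (fun t => PeriodicNSE.partialDeriv j (z t)) t x
      = PeriodicNSE.partialDeriv j (PeriodicNSE.timeDeriv T z t) x := by
  have hT := ht.1.trans ht.2
  have ht' := Ioo_subset_Icc_self ht
  set U : ℝ × E n → F := fun q => z q.1 q.2 with hU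
  set S : Set (ℝ × E n) := Icc 0 T ×ˢ univ with hS
  have hSn : ∀ q : ℝ × E n, q.1 ∈ Ioo 0 T → S ∈ nhds q := fun q hq =>
    prod_mem_nhds (Icc_mem_nhds hq.1 hq.2) Filter.univ_mem
  have hev : ∀ᶠ q : ℝ × E n in nhds (t, x), q.1 ∈ Ioo 0 T :=
    continuous_fst.continuousAt.eventually (Ioo_mem_nhds ht.1 ht.2)
  have hc : ContDiffAt ℝ 2 U (t, x) := ContDiffOn.contDiffAt h (hSn _ ht)
  have hd : DifferentiableAt ℝ (fderiv ℝ U) (t, x) :=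
    (hc.fderiv_right (m := 1) (by norm_num)).differentiableAt one_ne_zero
  have h1 : IsJointly T 1 z := h.mono one_le_two
  have key : ∀ a b : ℝ × E n, fderiv ℝ (fun q => fderiv ℝ U q a) (t, x) b
      = fderiv ℝ (fderiv ℝ U) (t, x) b a := by
    intro a b
    have := hd.hasFDerivAt.clm_apply (hasFDerivAt_const a (t, x))
    have h2 := congrArg (fun f => f b) this.fderiv
    simpa using! h2
  have hp : (fun q : ℝ × E n => PeriodicNSE.partialDeriv j (z q.1) q.2) =ᶠ[nhds (t, x)]
      fun q => fderiv ℝ U q (0, EuclideanSpace.single j 1) := by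
    filter_upwards [hev] with q hq
    rw [partialDeriv_eq h1 (Ioo_subset_Icc_self hq), fderivWithin_of_mem_nhds (hSn _ hq)]
  have hq : (fun q : ℝ × E n => PeriodicNSE.timeDeriv T z q.1 q.2) =ᶠ[nhds (t, x)]
      fun q => fderiv ℝ U q (1, 0) := by
    filter_upwards [hev] with q hq
    rw [timeDeriv_eq hT h1 (Ioo_subset_Icc_self hq), fderivWithin_of_mem_nhds (hSn _ hq)]
  rw [timeDeriv_eq hT (h.partialDeriv hT (by norm_num) j) ht',
    partialDeriv_eq (h.timeDeriv hT (by norm_num)) ht', fderivWithin_of_mem_nhds (hSn _ ht),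
    fderivWithin_of_mem_nhds (hSn _ ht), hp.fderiv_eq, hq.fderiv_eq, key, key]
  exact (hc.isSymmSndFDerivAt (by simp)).eq _ _

theorem exists_bound (h : IsJointly T 0 z) (R : ℝ) :
    ∃ M, 0 ≤ M ∧ ∀ t ∈ Icc 0 T, ∀ x ∈ Metric.closedBall (0 : E n) R, ‖z t x‖ ≤ M :=
  exists_bound_of_continuousOn (ContDiffOn.continuousOn h) R

theorem exists_lipschitz (hT : 0 < T) (h : IsJointly T 1 z) (R : ℝ) :
    ∃ M, 0 ≤ M ∧ ∀ s ∈ Icc 0 T, ∀ t ∈ Icc 0 T, ∀ x ∈ Metric.closedBall (0 : E n) R,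
      ‖z t x - z s x‖ ≤ M * |t - s| := by
  obtain ⟨M, hM0, hM⟩ := (h.timeDeriv (k := 0) hT (by norm_num)).exists_bound R
  refine ⟨M, hM0, fun s hs t ht x hx => ?_⟩
  refine (convex_Icc 0 T).norm_image_sub_le_of_norm_hasDerivWithin_le (f := fun s => z s x)
    (fun r hr => h.hasDerivWithinAt hr x) (fun r hr => ?_) hs ht
  rw [← timeDeriv_eq hT h hr]
  exact hM r hr x hx

theorem isEvolution {z : ℝ → E n → ℝ} (h : IsJointly T 2 z) (hT : 0 < T)
    (hz : ∀ t ∈ Icc 0 T, IsPeriodic L (z t)) {a b : ℝ} (ha : 0 ≤ a) (hb : b ≤ T) :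
    IsEvolution L a b z (PeriodicNSE.timeDeriv T z) where
  continuousOn := (ContDiffOn.continuousOn h).mono (prod_mono_left (Icc_subset_Icc ha hb))
  hasDerivAt t ht x := (h.mono one_le_two).hasDerivAt_timeDeriv (Ioo_subset_Ioo ha hb ht) x
  continuousOn_deriv := (ContDiffOn.continuousOn (h.timeDeriv hT (k := 1) (by norm_num))).mono
    (prod_mono_left (Ioo_subset_Icc_self.trans (Icc_subset_Icc ha hb)))
  contDiff t ht := h.slice (Icc_subset_Icc ha hb (Ioo_subset_Icc_self ht))
  periodic t ht := hz t (Icc_subset_Icc ha hb ht)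

end IsJointly

theorem timeDeriv_apply {k : ℕ} (hT : 0 < T) {z : ℝ → E n → E k} (h : IsJointly T 1 z) {t : ℝ}
    (ht : t ∈ Icc 0 T) (x : E n) (i : Fin k) :
    timeDeriv T z t x i = timeDeriv T (fun t x => z t x i) t x := by
  have h1 := (EuclideanSpace.proj (𝕜 := ℝ) i).hasFDerivAt.comp_hasDerivWithinAt t
    (h.hasDerivWithinAt ht x)
  rw [h.timeDeriv_eq hT ht]
  exact (h1.derivWithin (uniqueDiffOn_Icc hT t ht)).symm

theorem laplacian_apply {k : ℕ} {v : E n → E k} (hv : ContDiff ℝ 2 v) (x : E n) (i : Fin k) :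
    (Δ v) x i = (Δ fun y => v y i) x := by
  have h := (hv.contDiffAt (x := x)).laplacian_CLM_comp_left (l := EuclideanSpace.proj (𝕜 := ℝ) i)
  exact h.symm

/-- The exterior derivative `∂_k u_i - ∂_i u_k`. -/
noncomputable def exterior (u : ℝ → E n → E n) (k i : Fin n) (t : ℝ) (x : E n) : ℝ :=
  partialDeriv k (fun y => u t y i) x - partialDeriv i (fun y => u t y k) x

section solution

variable {σ : ℝ} {f : ℝ → E n → E n} {φ : E n → E n} {u : ℝ → E n → E n} {p : ℝ → E n → ℝ}

theorem IsNSESolution.isJointly_apply (h : IsNSESolution L T σ f φ u p) (i : Fin n) :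
    IsJointly T 3 fun t x => u t x i :=
  (EuclideanSpace.proj (𝕜 := ℝ) i).contDiff.comp_contDiffOn h.smooth_velocity

theorem IsNSESolution.isJointly_exterior (hT : 0 < T) (h : IsNSESolution L T σ f φ u p)
    (k i : Fin n) : IsJointly T 2 (exterior u k i) :=
  ((h.isJointly_apply i).partialDeriv hT (by norm_num) k).sub
    ((h.isJointly_apply k).partialDeriv hT (by norm_num) i)

theorem IsNSESolution.isPeriodic_exterior (h : IsNSESolution L T σ f φ u p) (k i : Fin n)
    {t : ℝ} (ht : t ∈ Icc 0 T) : IsPeriodic L (exterior u k i t) :=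
  (((h.periodic_velocity t ht).comp fun y => y i).partialDeriv k).comp₂
    (((h.periodic_velocity t ht).comp fun y => y k).partialDeriv i) (· - ·)

/-- The momentum equation is solved for the force because no smoothness of f is assumed: its
differentiability and its curl are read off from u and p. -/
theorem IsNSESolution.force_eq (hT : 0 < T) (h : IsNSESolution L T σ f φ u p) {t : ℝ}
    (ht : t ∈ Ioo 0 T) (x : E n) (i : Fin n) :
    f t x i = - timeDeriv T (fun t x => u t x i) t x
      - (σ ^ 2 / 2) * ∑ j, partialDeriv j (partialDeriv j fun y => u t y i) x
      + ∑ j, u t x j * partialDeriv j (fun y => u t y i) x + partialDeriv i (p t) x := by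
  have ht' := Ioo_subset_Icc_self ht
  have hm := congrArg (fun v : E n => v i) (h.momentum t (Ioo_subset_Ico_self ht) x)
  have hj : IsJointly T 3 u := h.smooth_velocity
  have hu := hj.slice ht'
  have h1 : derivWithin (fun s => u s x) (Icc 0 T) t i = timeDeriv T (fun t x => u t x i) t x :=
    timeDeriv_apply hT (hj.mono (by norm_num)) ht' x i
  have h2 : (Δ (u t)) x i = ∑ j, partialDeriv j (partialDeriv j fun y => u t y i) x := by
    rw [laplacian_apply (hu.of_le (by norm_num)),
      laplacian_eq_sum (((h.isJointly_apply i).slice ht').of_le (by norm_num))]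
  have h3 : advect (u t) (u t) x i = ∑ j, u t x j * partialDeriv j (fun y => u t y i) x := by
    simp [advect, partialDeriv_apply (hu.differentiable (by norm_num) x)]
  have h4 : gradient (p t) x i = partialDeriv i (p t) x := by
    have h5 : gradient (p t) x i = inner ℝ (gradient (p t) x) (EuclideanSpace.single i (1 : ℝ)) := by
      rw [EuclideanSpace.inner_single_right]; simp
    rw [h5, inner_gradient_left]
    rfl
  simp only [PiLp.add_apply, PiLp.sub_apply, PiLp.smul_apply, smul_eq_mul, h1, h2, h3, h4,
    PiLp.zero_apply] at hm
  linarith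

theorem IsNSESolution.differentiable_force (hT : 0 < T) (h : IsNSESolution L T σ f φ u p) {t : ℝ}
    (ht : t ∈ Ioo 0 T) : Differentiable ℝ (f t) := by
  have ht' := Ioo_subset_Icc_self ht
  have hu : ∀ i, IsJointly T 3 fun t x => u t x i := h.isJointly_apply
  rw [differentiable_piLp]
  intro i
  rw [funext fun y => h.force_eq hT ht y i]
  have hc : ∀ i, ContDiff ℝ 3 fun y => u t y i := fun i => (hu i).slice ht'
  have hd1 : ∀ i j, ContDiff ℝ 2 (partialDeriv j fun y => u t y i) := fun i j =>
    PeriodicNSE.ContDiff.partialDeriv (hc i) (by norm_num) j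
  have d1 : Differentiable ℝ (timeDeriv T (fun t x => u t x i) t) :=
    (((hu i).timeDeriv hT (k := 2) (by norm_num)).slice ht').differentiable (by norm_num)
  have d2 : ∀ j, Differentiable ℝ (partialDeriv j (partialDeriv j fun y => u t y i)) :=
    fun j => (PeriodicNSE.ContDiff.partialDeriv (k := 1) (hd1 i j) (by norm_num) j).differentiable
      (by norm_num)
  have d3 : ∀ j, Differentiable ℝ (fun y => u t y j) := fun j => (hc j).differentiable (by norm_num)
  have d4 : ∀ j, Differentiable ℝ (partialDeriv j fun y => u t y i) :=
    fun j => (hd1 i j).differentiable (by norm_num)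
  have d5 : Differentiable ℝ (partialDeriv i (p t)) :=
    (PeriodicNSE.ContDiff.partialDeriv (k := 1) (h.smooth_pressure t (Ioo_subset_Ico_self ht))
      (by norm_num) i).differentiable (by norm_num)
  fun_prop

/-- The vorticity equation for the exterior derivative of the velocity. -/
theorem IsNSESolution.exterior_equation (hT : 0 < T) (h : IsNSESolution L T σ f φ u p) {t : ℝ}
    (ht : t ∈ Ioo 0 T) (x : E n) (k i : Fin n) :
    timeDeriv T (exterior u k i) t x + σ ^ 2 / 2 * (Δ (exterior u k i t)) x
      - ∑ j, u t x j * partialDeriv j (exterior u k i t) x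
      - ∑ j, (partialDeriv k (fun y => u t y j) x * partialDeriv j (fun y => u t y i) x
        - partialDeriv i (fun y => u t y j) x * partialDeriv j (fun y => u t y k) x)
      + (partialDeriv k (f t) x i - partialDeriv i (f t) x k) = 0 := by
  have ht' := Ioo_subset_Icc_self ht
  have hu : ∀ i, IsJointly T 3 fun t x => u t x i := h.isJointly_apply
  have hc : ∀ i, ContDiff ℝ 3 fun y => u t y i := fun i => (hu i).slice ht'
  have hd1 : ∀ i j, ContDiff ℝ 2 (partialDeriv j fun y => u t y i) := fun i j =>
    PeriodicNSE.ContDiff.partialDeriv (hc i) (by norm_num) j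
  have hd2 : ∀ i j k, ContDiff ℝ 1 (partialDeriv k (partialDeriv j fun y => u t y i)) :=
    fun i j k => PeriodicNSE.ContDiff.partialDeriv (hd1 i j) (by norm_num) k
  have hp1 : ∀ j, ContDiff ℝ 1 (partialDeriv j (p t)) := fun j =>
    PeriodicNSE.ContDiff.partialDeriv (h.smooth_pressure t (Ioo_subset_Ico_self ht)) (by norm_num) j
  have hfd := h.differentiable_force hT ht
  have htd : ∀ i, ContDiff ℝ 2 (timeDeriv T (fun t x => u t x i) t) := fun i =>
    ((hu i).timeDeriv hT (by norm_num)).slice ht'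
  -- The derivative ∂_k of the solved momentum equation, with ∂_k moved innermost in every linear
  -- term. Antisymmetrising in k and i then yields the vorticity equation.
  have hf : ∀ k i, partialDeriv k (f t) x i =
      - timeDeriv T (fun t => partialDeriv k fun y => u t y i) t x
      - (σ ^ 2 / 2) * ∑ j, partialDeriv j (partialDeriv j (partialDeriv k fun y => u t y i)) x
      + ∑ j, (u t x j * partialDeriv j (partialDeriv k fun y => u t y i) x
        + partialDeriv k (fun y => u t y j) x * partialDeriv j (fun y => u t y i) x)
      + partialDeriv k (partialDeriv i (p t)) x := by
    intro k i
    rw [partialDeriv_apply (hfd x), funext fun y => h.force_eq hT ht y i]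
    have d1 : DifferentiableAt ℝ (timeDeriv T (fun t x => u t x i) t) x :=
      (htd i).differentiable (by norm_num) x
    have d2 : ∀ j, DifferentiableAt ℝ (partialDeriv j (partialDeriv j fun y => u t y i)) x :=
      fun j => (hd2 i j j).differentiable (by norm_num) x
    have d3 : ∀ j, DifferentiableAt ℝ (fun y => u t y j) x :=
      fun j => (hc j).differentiable (by norm_num) x
    have d4 : ∀ j, DifferentiableAt ℝ (partialDeriv j fun y => u t y i) x :=
      fun j => (hd1 i j).differentiable (by norm_num) x
    have d5 : DifferentiableAt ℝ (partialDeriv i (p t)) x :=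
      (hp1 i).differentiable (by norm_num) x
    rw [partialDeriv_add (by fun_prop) d5, partialDeriv_add (by fun_prop) (by fun_prop),
      partialDeriv_sub (by fun_prop) (by fun_prop), partialDeriv_neg,
      partialDeriv_const_mul _ (by fun_prop), partialDeriv_sum (fun j _ => d2 j),
      partialDeriv_sum (fun j _ => (d3 j).fun_mul (d4 j)),
      (hu i |>.mono (by norm_num)).timeDeriv_partialDeriv ht]
    congr 3
    · congr 1
      refine Finset.sum_congr rfl fun j _ => ?_
      rw [partialDeriv_comm (hd1 i j)]
      congr 1
      funext y
      exact partialDeriv_comm ((hc i).of_le (by norm_num)) k j y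
    · funext j
      rw [partialDeriv_mul (d3 j) (d4 j), partialDeriv_comm ((hc i).of_le (by norm_num)) k j]
  have hsub : ∀ j, partialDeriv j (exterior u k i t) = fun x =>
      partialDeriv j (partialDeriv k fun y => u t y i) x
        - partialDeriv j (partialDeriv i fun y => u t y k) x := fun j => funext fun y =>
    partialDeriv_sub ((hd1 i k).differentiable (by norm_num) y)
      ((hd1 k i).differentiable (by norm_num) y) j
  have hlap : (Δ (exterior u k i t)) x
      = ∑ j, partialDeriv j (partialDeriv j (partialDeriv k fun y => u t y i)) x
        - ∑ j, partialDeriv j (partialDeriv j (partialDeriv i fun y => u t y k)) x := by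
    rw [laplacian_eq_sum ((h.isJointly_exterior hT k i).slice ht'), ← Finset.sum_sub_distrib]
    refine Finset.sum_congr rfl fun j _ => ?_
    rw [hsub]
    exact partialDeriv_sub ((hd2 i k j).differentiable (by norm_num) x)
      ((hd2 k i j).differentiable (by norm_num) x) j
  have htime : timeDeriv T (exterior u k i) t x
      = timeDeriv T (fun t => partialDeriv k fun y => u t y i) t x
        - timeDeriv T (fun t => partialDeriv i fun y => u t y k) t x := by
    have e1 : IsJointly T 1 fun t => partialDeriv k fun y => u t y i :=
      (hu i).partialDeriv hT (by norm_num) k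
    have e2 : IsJointly T 1 fun t => partialDeriv i fun y => u t y k :=
      (hu k).partialDeriv hT (by norm_num) i
    exact (((h.isJointly_exterior hT k i).mono one_le_two).hasDerivAt_timeDeriv ht x).unique
      ((e1.hasDerivAt_timeDeriv ht x).sub (e2.hasDerivAt_timeDeriv ht x))
  -- Symmetry of the Hessian of p removes the pressure.
  rw [htime, hlap, hf, hf, partialDeriv_comm (h.smooth_pressure t (Ioo_subset_Ico_self ht)) i k]
  simp only [hsub, Finset.sum_add_distrib, Finset.sum_sub_distrib, mul_sub]
  ring

end solution

end PeriodicNSE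

/-! ### Sobolev and Ladyzhenskaya inequalities on the three-dimensional torus -/

namespace PeriodicNSE

variable {n : ℕ} {L : ℝ}

/-- Cauchy-Schwarz from the discriminant of the nonnegative quadratic s ↦ ∫(s f + g)². -/
theorem integral_mul_sq_le {f g : E n → ℝ} (hf : Continuous f) (hg : Continuous g) :
    (∫ x in cell n L, f x * g x) ^ 2
      ≤ (∫ x in cell n L, f x ^ 2) * ∫ x in cell n L, g x ^ 2 := by
  have h : ∀ s : ℝ, 0 ≤ (∫ x in cell n L, f x ^ 2) * (s * s)
      + (2 * ∫ x in cell n L, f x * g x) * s + ∫ x in cell n L, g x ^ 2 := by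
    intro s
    have h1 : 0 ≤ ∫ x in cell n L, (s * f x + g x) ^ 2 := integral_nonneg fun _ => sq_nonneg _
    have h2 : ∀ x, (s * f x + g x) ^ 2 = s * s * f x ^ 2 + 2 * s * (f x * g x) + g x ^ 2 :=
      fun x => by ring
    simp_rw [h2] at h1
    rw [integral_add (integrableOn_cell (by fun_prop)) (integrableOn_cell (by fun_prop)),
      integral_add (integrableOn_cell (by fun_prop)) (integrableOn_cell (by fun_prop)),
      integral_const_mul, integral_const_mul] at h1
    linarith
  have := discrim_le_zero h
  rw [discrim] at this
  linarith

/-- The integral over a ball is controlled by the integral over the period cell. -/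
theorem exists_setIntegral_closedBall_le (hL : 0 < L) (n : ℕ) (R : ℝ) :
    ∃ M : ℝ, 0 ≤ M ∧ ∀ q : E n → ℝ, IsPeriodic L q → Continuous q → (∀ x, 0 ≤ q x) →
      ∫ x in Metric.closedBall 0 R, q x ≤ M * ∫ x in cell n L, q x := by
  let B : ℤ := ⌈|R| / L⌉ + 1
  -- Finitely many translates of the cell cover the ball. The shift ⌈xᵢ/L⌉ − 1, rather than a floor,
  -- fits the half-open interval (0, L], and the additional 1 in `B` pays for its −1.
  let S : Finset (Fin n → ℤ) := Fintype.piFinset fun _ => Finset.Icc (-B) B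
  let a : (Fin n → ℤ) → E n := fun m => WithLp.toLp 2 fun i => - (m i * L)
  have hcov : Metric.closedBall (0 : E n) R ⊆ ⋃ m : S, (fun x => x + a m) ⁻¹' cell n L := by
    intro x hx
    rw [mem_closedBall_zero_iff] at hx
    have hxi : ∀ i, |x i| / L ≤ |R| / L := fun i => by
      have h1 := PiLp.norm_apply_le x i
      rw [Real.norm_eq_abs] at h1
      exact div_le_div_of_nonneg_right ((h1.trans hx).trans (le_abs_self R)) hL.le
    have hm : (fun i => ⌈x i / L⌉ - 1) ∈ S := by
      rw [Fintype.mem_piFinset]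
      intro i
      have h1 : |x i / L| ≤ ⌈|R| / L⌉ := by
        rw [abs_div, abs_of_pos hL]
        exact (hxi i).trans (Int.le_ceil _)
      have h2 := abs_le.1 h1
      rw [Finset.mem_Icc]
      constructor
      · have : (-⌈|R| / L⌉ : ℤ) ≤ ⌈x i / L⌉ := by
          have h3 : -(⌈|R| / L⌉ : ℝ) ≤ (⌈x i / L⌉ : ℝ) := h2.1.trans (Int.le_ceil (x i / L))
          exact_mod_cast h3
        simp only [B]; omega
      · have := Int.ceil_le.2 h2.2
        simp only [B]; omega
    refine mem_iUnion.2 ⟨⟨_, hm⟩, ?_⟩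
    show ∀ i, _
    intro i
    simp only [a, PiLp.add_apply, Int.cast_sub, Int.cast_one]
    have h1 := Int.le_ceil (x i / L)
    have h2 := Int.ceil_lt_add_one (x i / L)
    have h3 : x i = x i / L * L := by field_simp
    constructor
    · nlinarith
    · nlinarith
  refine ⟨S.card, by positivity, fun q hq hc h0 => ?_⟩
  have hae : ∀ s : Set (E n), 0 ≤ᵐ[volume.restrict s] q := fun s => Filter.Eventually.of_forall h0
  have hiB : IntegrableOn q (Metric.closedBall 0 R) :=
    hc.continuousOn.integrableOn_compact (isCompact_closedBall _ _)
  rw [← ENNReal.ofReal_le_ofReal_iff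
    (mul_nonneg (by positivity) (integral_nonneg h0)), ENNReal.ofReal_mul (by positivity),
    ofReal_integral_eq_lintegral_ofReal hiB (hae _),
    ofReal_integral_eq_lintegral_ofReal (integrableOn_cell hc) (hae _)]
  calc ∫⁻ x in Metric.closedBall 0 R, ENNReal.ofReal (q x)
      ≤ ∫⁻ x in ⋃ m : S, (fun x => x + a m) ⁻¹' cell n L, ENNReal.ofReal (q x) :=
        lintegral_mono_set hcov
    _ ≤ ∑' m : S, ∫⁻ x in (fun x => x + a m) ⁻¹' cell n L, ENNReal.ofReal (q x) :=
        lintegral_iUnion_le _ _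
    _ = ∑' _m : S, ∫⁻ x in cell n L, ENNReal.ofReal (q x) := by
        refine tsum_congr fun m => ?_
        have h1 := (measurePreserving_add_right (volume : Measure (E n)) (a m)).setLIntegral_comp_preimage
          measurableSet_cell (f := fun x => ENNReal.ofReal (q x)) (by fun_prop) (s := cell n L)
        rw [← h1]
        refine lintegral_congr fun x => ?_
        congr 1
        exact (hq.eq_of_int fun i => ⟨- (m : Fin n → ℤ) i, by simp [a]⟩).symm
    _ = _ := by
        rw [tsum_fintype]
        simp

theorem norm_fderiv_sq_le (z : E n → ℝ) (x : E n) :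
    ‖fderiv ℝ z x‖ ^ 2 ≤ n * ∑ j, partialDeriv j z x ^ 2 := by
  have h : ‖fderiv ℝ z x‖ ≤ ∑ j, |partialDeriv j z x| := by
    refine ContinuousLinearMap.opNorm_le_bound _ (Finset.sum_nonneg fun _ _ => abs_nonneg _)
      fun v => ?_
    have hv : v = ∑ j, v j • EuclideanSpace.single j (1 : ℝ) := by
      ext i; simp [Finset.sum_apply, Pi.single_apply]
    conv_lhs => rw [hv]
    rw [map_sum, Finset.sum_mul]
    refine (norm_sum_le _ _).trans (Finset.sum_le_sum fun j _ => ?_)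
    rw [map_smul, norm_smul, mul_comm]
    exact mul_le_mul_of_nonneg_left (PiLp.norm_apply_le v j) (norm_nonneg _)
  calc ‖fderiv ℝ z x‖ ^ 2 ≤ (∑ j, |partialDeriv j z x|) ^ 2 := by gcongr
    _ ≤ n * ∑ j, |partialDeriv j z x| ^ 2 := by
      simpa using sq_sum_le_card_mul_sum_sq (s := Finset.univ) (f := fun j => |partialDeriv j z x|)
    _ = _ := by simp_rw [sq_abs]

/-- The Gagliardo-Nirenberg-Sobolev inequality in dimension three, in terms of integrals. -/
theorem exists_integral_pow_six_le : ∃ K : ℝ, 0 ≤ K ∧ ∀ g : E 3 → ℝ, ContDiff ℝ 1 g →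
    HasCompactSupport g → ∫ x, ‖g x‖ ^ 6 ≤ K ^ 6 * (∫ x, ‖fderiv ℝ g x‖ ^ 2) ^ 3 := by
  set K : ℝ := NNReal.toReal (SNormLESNormFDerivOfEqConst ℝ (volume : Measure (E 3)) 2) with hK
  refine ⟨K, NNReal.coe_nonneg _, fun g hgc hgs => ?_⟩
  have hgd := hgc.continuous_fderiv one_ne_zero
  have hgds : HasCompactSupport (fderiv ℝ g) := hgs.fderiv ℝ
  have hgns := eLpNorm_le_eLpNorm_fderiv_of_eq (volume : Measure (E 3)) hgc hgs (p := 2) (p' := 6)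
    (by norm_num) (by simp) (by simp; norm_num)
  have m1 : MemLp g 6 volume := hgc.continuous.memLp_of_hasCompactSupport hgs
  have m2 : MemLp (fderiv ℝ g) 2 volume := hgd.memLp_of_hasCompactSupport hgds
  have e1 := m1.eLpNorm_eq_integral_rpow_norm (by norm_num) (by norm_num)
  have e2 := m2.eLpNorm_eq_integral_rpow_norm (by norm_num) (by norm_num)
  have e3 : eLpNorm g 6 volume ≤ ENNReal.ofReal K * eLpNorm (fderiv ℝ g) 2 volume := by
    rw [hK, ENNReal.ofReal_coe_nnreal]
    exact_mod_cast hgns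
  rw [e1, e2, ← ENNReal.ofReal_mul (by positivity), ENNReal.ofReal_le_ofReal_iff (by positivity)]
    at e3
  norm_num at e3
  have p1 : 0 ≤ ∫ x, |g x| ^ 6 := integral_nonneg fun _ => by positivity
  have p2 : 0 ≤ ∫ x, ‖fderiv ℝ g x‖ ^ 2 := integral_nonneg fun _ => by positivity
  have e4 := pow_le_pow_left₀ (by positivity) e3 6
  -- The sixth power clears the exponents 1/6 and 1/2 of the `L⁶` and `L²` norms.
  rw [mul_pow, ← Real.rpow_natCast (_ ^ (_ : ℝ)) 6, ← Real.rpow_natCast (_ ^ (_ : ℝ)) 6,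
    ← Real.rpow_mul p1, ← Real.rpow_mul p2] at e4
  norm_num at e4
  simpa using e4

theorem integrable_norm_pow_six {g : E 3 → ℝ} (hg : Continuous g) (hgs : HasCompactSupport g) :
    Integrable fun x => ‖g x‖ ^ 6 := by
  refine (hg.norm.pow 6).integrable_of_hasCompactSupport (hgs.mono fun x hx h => hx ?_)
  simp [h]

/-- The Sobolev inequality `H¹ ⊂ L⁶` on the three-dimensional torus. -/
theorem exists_sobolev (hL : 0 < L) :
    ∃ C : ℝ, 0 ≤ C ∧ ∀ z : E 3 → ℝ, IsPeriodic L z → ContDiff ℝ 1 z →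
      ∫ x in cell 3 L, z x ^ 6 ≤ C * ((∫ x in cell 3 L, z x ^ 2) + dissipation L z) ^ 3 := by
  set R : ℝ := Real.sqrt ((3 : ℕ) * L ^ 2) + 1 with hR
  have hR0 : 0 < R := by positivity
  -- A cutoff equal to 1 on a ball containing the cell reduces the periodic inequality to the one on
  -- the whole space; the integral over the larger ball is returned to the cell by `hM`.
  let χ : ContDiffBump (0 : E 3) := ⟨R, R + 1, hR0, by linarith⟩
  obtain ⟨M, hM0, hM⟩ := exists_setIntegral_closedBall_le hL 3 (R + 1)
  have hχc : ContDiff ℝ 1 χ := χ.contDiff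
  obtain ⟨A, hA⟩ := (isCompact_closedBall (0 : E 3) (R + 1)).exists_bound_of_continuousOn
    (hχc.continuous_fderiv one_ne_zero).continuousOn
  obtain ⟨K, hK0, hK⟩ := exists_integral_pow_six_le
  -- The factor 2A² + 6 comes from |∇(χz)|² ≤ 2|∇z|² + 2A²z², where A bounds ∇χ and the operator
  -- norm satisfies |∇z|² ≤ 3 Σ(∂_j z)².
  refine ⟨K ^ 6 * ((2 * A ^ 2 + 6) * M) ^ 3, by positivity, fun z hz hc => ?_⟩
  set g : E 3 → ℝ := fun x => χ x * z x with hg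
  have hgc : ContDiff ℝ 1 g := hχc.mul hc
  have hgs : HasCompactSupport g := χ.hasCompactSupport.mul_right
  have hgd := hgc.continuous_fderiv one_ne_zero
  have hgds : HasCompactSupport (fderiv ℝ g) := hgs.fderiv ℝ
  have key := hK g hgc hgs
  have hgz : ∀ x ∈ cell 3 L, g x = z x := by
    intro x hx
    have : χ x = 1 := χ.one_of_mem_closedBall
      (Metric.closedBall_subset_closedBall (by simp [χ, hR]) (cell_subset_closedBall hx))
    simp [hg, this]
  have l1 : ∫ x in cell 3 L, z x ^ 6 ≤ ∫ x, ‖g x‖ ^ 6 := by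
    have h1 : ∫ x in cell 3 L, z x ^ 6 = ∫ x in cell 3 L, ‖g x‖ ^ 6 := by
      refine setIntegral_congr_fun measurableSet_cell fun x hx => ?_
      have h2 : |z x| ^ 6 = z x ^ 6 := Even.pow_abs ⟨3, rfl⟩ _
      rw [hgz x hx, Real.norm_eq_abs, h2]
    rw [h1]
    refine setIntegral_le_integral ?_ (Filter.Eventually.of_forall fun x => by positivity)
    exact integrable_norm_pow_six hgc.continuous hgs
  have hpc : ∀ j, Continuous (partialDeriv j z) := fun j => continuous_partialDeriv hc j
  have hzc := hc.continuous
  set q : E 3 → ℝ := fun x => z x ^ 2 + ∑ j, partialDeriv j z x ^ 2 with hq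
  have hqc : Continuous q := by fun_prop
  have l2 : ∫ x, ‖fderiv ℝ g x‖ ^ 2 ≤ (2 * A ^ 2 + 6) * M * ∫ x in cell 3 L, q x := by
    have hsupp : Function.support (fun x => ‖fderiv ℝ g x‖ ^ 2) ⊆ Metric.closedBall 0 (R + 1) := by
      intro x hx
      have h1 : x ∈ Function.support (fderiv ℝ g) := fun h => hx (by simp [h])
      have h2 := support_fderiv_subset ℝ h1
      exact (closure_minimal ((Function.support_mul_subset_left _ _).trans
        (subset_tsupport _)) (isClosed_tsupport _)).trans χ.tsupport_eq.subset h2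
    rw [← setIntegral_eq_integral_of_forall_compl_eq_zero fun x hx =>
      Function.notMem_support.1 fun h => hx (hsupp h)]
    have hpt : ∀ x ∈ Metric.closedBall (0 : E 3) (R + 1),
        ‖fderiv ℝ g x‖ ^ 2 ≤ (2 * A ^ 2 + 6) * q x := by
      intro x hx
      have h1 : fderiv ℝ g x = χ x • fderiv ℝ z x + z x • fderiv ℝ χ x :=
        fderiv_fun_mul (hχc.differentiable one_ne_zero x) (hc.differentiable one_ne_zero x)
      have h2 : ‖fderiv ℝ g x‖ ≤ ‖fderiv ℝ z x‖ + A * |z x| := by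
        rw [h1]
        refine (norm_add_le _ _).trans (add_le_add ?_ ?_)
        · rw [norm_smul]
          refine mul_le_of_le_one_left (norm_nonneg _) ?_
          rw [Real.norm_of_nonneg χ.nonneg]
          exact χ.le_one
        · rw [norm_smul, mul_comm, Real.norm_eq_abs]
          exact mul_le_mul_of_nonneg_right (hA x hx) (abs_nonneg _)
      have h3 := norm_fderiv_sq_le z x
      have h4 := pow_le_pow_left₀ (norm_nonneg _) h2 2
      have h5 : (‖fderiv ℝ z x‖ + A * |z x|) ^ 2
          ≤ 2 * ‖fderiv ℝ z x‖ ^ 2 + 2 * A ^ 2 * z x ^ 2 := by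
        rw [← sq_abs (z x)]
        nlinarith [sq_nonneg (‖fderiv ℝ z x‖ - A * |z x|)]
      have h6 : 0 ≤ ∑ j, partialDeriv j z x ^ 2 := Finset.sum_nonneg fun _ _ => sq_nonneg _
      push_cast at h3
      simp only [hq]
      nlinarith [mul_nonneg (sq_nonneg A) h6, sq_nonneg (z x)]
    calc ∫ x in Metric.closedBall 0 (R + 1), ‖fderiv ℝ g x‖ ^ 2
        ≤ ∫ x in Metric.closedBall 0 (R + 1), (2 * A ^ 2 + 6) * q x :=
          setIntegral_mono_on
            ((hgd.norm.pow 2).continuousOn.integrableOn_compact (isCompact_closedBall _ _))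
            ((continuous_const.mul hqc).continuousOn.integrableOn_compact (isCompact_closedBall _ _))
            measurableSet_closedBall hpt
      _ ≤ (2 * A ^ 2 + 6) * (M * ∫ x in cell 3 L, q x) := by
          rw [integral_const_mul]
          gcongr
          refine hM q ?_ hqc fun x => by positivity
          exact (hz.comp (· ^ 2)).comp₂ (isPeriodic_sum fun j _ => (hz.partialDeriv j).comp (· ^ 2))
            (· + ·)
      _ = _ := by ring
  have l3 : ∫ x in cell 3 L, q x = (∫ x in cell 3 L, z x ^ 2) + dissipation L z := by
    rw [hq, integral_add (integrableOn_cell (by fun_prop)) (integrableOn_cell (by fun_prop)),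
      integral_finsetSum _ fun j _ => integrableOn_cell (by fun_prop), dissipation]
  rw [l3] at l2
  calc ∫ x in cell 3 L, z x ^ 6 ≤ K ^ 6 * (∫ x, ‖fderiv ℝ g x‖ ^ 2) ^ 3 := l1.trans key
    _ ≤ K ^ 6 * ((2 * A ^ 2 + 6) * M * ((∫ x in cell 3 L, z x ^ 2) + dissipation L z)) ^ 3 := by
      gcongr
    _ = _ := by rw [mul_pow]; ring

/-- A form of the Ladyzhenskaya inequality on the three-dimensional torus. -/
theorem exists_integral_sq_mul_abs_le (hL : 0 < L) {ε : ℝ} (hε : 0 < ε) :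
    ∃ C : ℝ, 0 ≤ C ∧ ∀ z : E 3 → ℝ, IsPeriodic L z → ContDiff ℝ 1 z →
      ∀ e : E 3 → ℝ, Continuous e → ∀ A : ℝ, ∫ x in cell 3 L, e x ^ 2 ≤ A →
        ∫ x in cell 3 L, z x ^ 2 * |e x|
          ≤ ε * dissipation L z + C * (1 + A ^ 2) * ∫ x in cell 3 L, z x ^ 2 := by
  obtain ⟨C, hC0, hC⟩ := exists_sobolev hL
  refine ⟨ε + C / ε ^ 3, by positivity, fun z hz hc e he A hA => ?_⟩
  have hzc := hc.continuous
  have hA0 : 0 ≤ A := (integral_nonneg fun _ => sq_nonneg _).trans hA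
  set y := ∫ x in cell 3 L, z x ^ 2 with hy
  have hy0 : 0 ≤ y := integral_nonneg fun _ => sq_nonneg _
  have hD0 := dissipation_nonneg (L := L) z
  set D := dissipation L z
  set I := ∫ x in cell 3 L, z x ^ 2 * |e x| with hI
  have hI0 : 0 ≤ I := integral_nonneg fun _ => by positivity
  have hz4 : 0 ≤ ∫ x in cell 3 L, z x ^ 4 := integral_nonneg fun _ => by positivity
  -- Cauchy-Schwarz separates e from z², and a second application, to z·z³, interpolates the fourth
  -- power between the second and the sixth, where the Sobolev inequality enters.
  have s1 : I ^ 2 ≤ (∫ x in cell 3 L, z x ^ 4) * A := by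
    have h := integral_mul_sq_le (L := L) (hzc.pow 2) he.abs
    simp only [Pi.pow_apply, ← pow_mul, sq_abs, Nat.reduceMul] at h
    exact h.trans (mul_le_mul_of_nonneg_left hA hz4)
  have s2 : (∫ x in cell 3 L, z x ^ 4) ^ 2 ≤ y * (C * (y + D) ^ 3) := by
    have h := integral_mul_sq_le (L := L) hzc (hzc.pow 3)
    simp only [Pi.pow_apply, ← pow_mul, ← pow_succ'] at h
    exact h.trans (mul_le_mul_of_nonneg_left (hC z hz hc) hy0)
  have s3 : I ^ 4 ≤ A ^ 2 * (y * (C * (y + D) ^ 3)) := by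
    calc I ^ 4 = (I ^ 2) ^ 2 := by ring
      _ ≤ ((∫ x in cell 3 L, z x ^ 4) * A) ^ 2 := by gcongr
      _ = A ^ 2 * (∫ x in cell 3 L, z x ^ 4) ^ 2 := by ring
      _ ≤ _ := by gcongr
  -- Young's inequality with exponents 4 and 4/3 by a case distinction: if I exceeds ε(y + D), then
  -- (y + D)³ is at most I³/ε³ and I³ cancels from the bound of I⁴.
  have s4 : I ≤ ε * (y + D) + A ^ 2 * C * y / ε ^ 3 := by
    by_cases hle : I ≤ ε * (y + D)
    · have : 0 ≤ A ^ 2 * C * y / ε ^ 3 := by positivity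
      linarith
    push Not at hle
    have hIpos : 0 < I := lt_of_le_of_lt (by positivity) hle
    have h3 : (ε * (y + D)) ^ 3 ≤ I ^ 3 := pow_le_pow_left₀ (by positivity) hle.le 3
    have h4 : I * I ^ 3 * ε ^ 3 ≤ A ^ 2 * C * y * I ^ 3 := by
      calc I * I ^ 3 * ε ^ 3 = I ^ 4 * ε ^ 3 := by ring
        _ ≤ A ^ 2 * (y * (C * (y + D) ^ 3)) * ε ^ 3 := by gcongr
        _ = A ^ 2 * C * y * (ε * (y + D)) ^ 3 := by ring
        _ ≤ _ := by gcongr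
    have h5 : I ≤ A ^ 2 * C * y / ε ^ 3 := by
      rw [le_div_iff₀ (by positivity)]
      have : 0 < I ^ 3 := by positivity
      nlinarith
    have : 0 ≤ ε * (y + D) := by positivity
    linarith
  refine s4.trans ?_
  have : 0 ≤ C / ε ^ 3 * y := by positivity
  have h6 : A ^ 2 * C * y / ε ^ 3 = A ^ 2 * (C / ε ^ 3 * y) := by ring
  rw [h6]
  nlinarith [mul_nonneg hε.le (mul_nonneg (sq_nonneg A) hy0)]

end PeriodicNSE

/-! ### Backward Gronwall inequality and accumulation of the error over the steps -/

namespace PeriodicNSE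

/-- A backward Gronwall inequality. -/
theorem backward_gronwall {a b c d : ℝ} (hc : 0 ≤ c) (hd : 0 ≤ d) {y y' : ℝ → ℝ}
    (hy : ContinuousOn y (Icc a b)) (hy' : ∀ t ∈ Ioo a b, HasDerivAt y (y' t) t)
    (h : ∀ t ∈ Ioo a b, -(c * y t + d) ≤ y' t) {t : ℝ} (ht : t ∈ Icc a b) :
    y t ≤ Real.exp (c * (b - t)) * (y b + d * (b - t)) := by
  -- The derivative is e^{c(t−b)}(c y + y') + d ≥ d(1 − e^{c(t−b)}) ≥ 0, since t ≤ b. Comparing the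
  -- values at t and b gives the claim.
  have hmono : MonotoneOn (fun t => Real.exp (c * (t - b)) * y t + d * (t - b)) (Icc a b) := by
    have hder : ∀ t ∈ Ioo a b, HasDerivAt (fun t => Real.exp (c * (t - b)) * y t + d * (t - b))
        (Real.exp (c * (t - b)) * (c * 1) * y t + Real.exp (c * (t - b)) * y' t + d * 1) t := by
      intro t ht
      have h1 : HasDerivAt (fun t => t - b) 1 t := (hasDerivAt_id t).sub_const b
      exact (((h1.const_mul c).exp).mul (hy' t ht)).add (h1.const_mul d)
    refine monotoneOn_of_deriv_nonneg (convex_Icc a b) ?_ ?_ ?_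
    · fun_prop
    · rw [interior_Icc]
      exact fun t ht => (hder t ht).differentiableAt.differentiableWithinAt
    · rw [interior_Icc]
      intro t ht
      rw [(hder t ht).deriv]
      have h1 : Real.exp (c * (t - b)) ≤ 1 := by
        rw [Real.exp_le_one_iff]
        exact mul_nonpos_of_nonneg_of_nonpos hc (by linarith [ht.2])
      have h2 := Real.exp_pos (c * (t - b))
      nlinarith [mul_le_mul_of_nonneg_left (h t ht) h2.le]
  have h1 := hmono ht ⟨ht.1.trans ht.2, le_rfl⟩ ht.2
  simp only [sub_self, mul_zero, Real.exp_zero, one_mul, add_zero] at h1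
  have h2 : Real.exp (c * (b - t)) * Real.exp (c * (t - b)) = 1 := by
    rw [← Real.exp_add]; simp [← mul_add]
  calc y t = Real.exp (c * (b - t)) * (Real.exp (c * (t - b)) * y t) := by
        rw [← mul_assoc, h2, one_mul]
    _ ≤ _ := by
        gcongr
        linarith

/-- Error propagation over the steps of a first-order method with a cubic nonlinearity, backwards
in time and starting from an exact value. -/
theorem exists_sqrt_energy_le {T C : ℝ} (hT : 0 < T) (hC : 0 ≤ C) :
    ∃ K : ℝ, ∀ N : ℕ, 1 ≤ N → ∀ y y' : ℕ → ℝ → ℝ,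
      (∀ k < N, ContinuousOn (y k) (Icc (gridTime T N k) (gridTime T N (k + 1)))) →
      (∀ k < N, ∀ t ∈ Icc (gridTime T N k) (gridTime T N (k + 1)), 0 ≤ y k t) →
      (∀ k < N, ∀ t ∈ Ioo (gridTime T N k) (gridTime T N (k + 1)), HasDerivAt (y k) (y' k t) t) →
      (∀ k < N, ∀ t ∈ Ioo (gridTime T N k) (gridTime T N (k + 1)),
        -(C * (1 + y k (gridTime T N (k + 1)) ^ 2) * y k t
          + C * ((T / N) ^ 2 + y k (gridTime T N (k + 1)))) ≤ y' k t) →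
      (∀ k < N, y k (gridTime T N (k + 1))
        = if k + 1 = N then 0 else y (k + 1) (gridTime T N (k + 1))) →
      ∀ k < N, ∀ t ∈ Icc (gridTime T N k) (gridTime T N (k + 1)),
        Real.sqrt (y k t) ≤ K * (T / N) := by
  -- K₁h² is the value reached after N steps that each contribute Ch³ and amplify by e^{3Ch}.
  set K₁ : ℝ := T * Real.exp (3 * C * T) * C with hK₁
  have hK₁0 : 0 ≤ K₁ := by positivity
  -- The one-step bound with h replaced by T. Its iterates from 0 bound the error after a given
  -- number of steps independently of the step size.
  let Ψ : ℝ → ℝ := fun Y => Real.exp (C * (1 + Y ^ 2) * T) * (Y + C * (T ^ 2 + Y) * T)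
  let b : ℕ → ℝ := fun j => Ψ^[j] 0
  have hb_succ : ∀ j, b (j + 1) = Ψ (b j) := fun j => Function.iterate_succ_apply' Ψ j 0
  have hb0 : ∀ j, 0 ≤ b j := by
    intro j
    induction j with
    | zero => exact le_rfl
    | succ j ih => rw [hb_succ]; simp only [Ψ]; positivity
  have hbmono : Monotone b := by
    refine monotone_nat_of_le_succ fun j => ?_
    rw [hb_succ]
    have h0 := hb0 j
    have h1 : 1 ≤ Real.exp (C * (1 + b j ^ 2) * T) := Real.one_le_exp (by positivity)
    have h2 : b j ≤ b j + C * (T ^ 2 + b j) * T := by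
      have : 0 ≤ C * (T ^ 2 + b j) * T := by positivity
      linarith
    calc b j ≤ 1 * (b j + C * (T ^ 2 + b j) * T) := by linarith
      _ ≤ Ψ (b j) := by simp only [Ψ]; gcongr
  -- Coarse grids, those with K₁h² > 1, have at most T²K₁ steps, so `B` bounds the error on all of
  -- them.
  set B := b ⌈T ^ 2 * K₁⌉₊ with hB
  have hB0 : 0 ≤ B := hb0 _
  refine ⟨Real.sqrt (K₁ * (1 + B)), fun N hN y y' hcont hnn hder hineq hterm => ?_⟩
  have hNpos : (0 : ℝ) < N := by exact_mod_cast hN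
  set h := T / N with hh
  have hh0 : 0 < h := by positivity
  have hhT : h ≤ T := div_le_self hT.le (by exact_mod_cast hN)
  have hNh : N * h = T := by rw [hh]; field_simp
  have hgrid : ∀ k, gridTime T N (k + 1) - gridTime T N k = h := by
    intro k; simp only [gridTime]; push_cast; ring
  have hgle : ∀ k, gridTime T N k ≤ gridTime T N (k + 1) := fun k => by linarith [hgrid k]
  have hYnn : ∀ k < N, 0 ≤ y k (gridTime T N (k + 1)) := fun k hk =>
    hnn k hk _ ⟨hgle k, le_rfl⟩
  have step : ∀ k < N, ∀ t ∈ Icc (gridTime T N k) (gridTime T N (k + 1)), ∀ Y,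
      y k (gridTime T N (k + 1)) ≤ Y →
      y k t ≤ Real.exp (C * (1 + Y ^ 2) * h) * (Y + C * (h ^ 2 + Y) * h) := by
    intro k hk t ht Y hY
    have h0 := hYnn k hk
    have hbt : gridTime T N (k + 1) - t ≤ h := by linarith [ht.1, hgrid k]
    have hbt0 : 0 ≤ gridTime T N (k + 1) - t := by linarith [ht.2]
    refine (backward_gronwall (by positivity) (by positivity) (hcont k hk) (hder k hk)
      (hineq k hk) ht).trans ?_
    have : 0 ≤ Y := h0.trans hY
    gcongr
  -- the bound for all the steps, by induction on the distance from the final step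
  have main : ∀ j k t, k < N → k + j + 1 = N →
      t ∈ Icc (gridTime T N k) (gridTime T N (k + 1)) →
      y k t ≤ b (j + 1) ∧
        (K₁ * h ^ 2 ≤ 1 → y k t ≤ (j + 1) * Real.exp (3 * C * h * (j + 1)) * (C * h ^ 3)) := by
    intro j
    -- For Y ≤ 1 the rate C(1 + Y²) is at most 2C, and Y + C(h² + Y)h = (1 + Ch)Y + Ch³ costs one
    -- further factor e^{Ch}: a linear recursion with amplification e^{3Ch}.
    have small : ∀ k t Y, k < N → t ∈ Icc (gridTime T N k) (gridTime T N (k + 1)) →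
        y k (gridTime T N (k + 1)) ≤ Y → Y ≤ 1 →
        y k t ≤ Real.exp (3 * C * h) * (Y + C * h ^ 3) := by
      intro k t Y hk ht hY hY1
      have hY0 := (hYnn k hk).trans hY
      refine (step k hk t ht Y hY).trans ?_
      have h1 : Y + C * (h ^ 2 + Y) * h ≤ Real.exp (C * h) * (Y + C * h ^ 3) := by
        have h2 : C * h + 1 ≤ Real.exp (C * h) := Real.add_one_le_exp _
        have h3 : 0 ≤ C * h ^ 3 := by positivity
        have h4 : 0 ≤ C * h := by positivity
        nlinarith [mul_le_mul_of_nonneg_right h2 (add_nonneg hY0 h3), mul_nonneg h4 h3]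
      have h2 : C * (1 + Y ^ 2) * h ≤ 2 * C * h := by
        have : Y ^ 2 ≤ 1 := pow_le_one₀ hY0 hY1
        have h4 : 0 ≤ C * h := by positivity
        nlinarith
      calc Real.exp (C * (1 + Y ^ 2) * h) * (Y + C * (h ^ 2 + Y) * h)
          ≤ Real.exp (2 * C * h) * (Real.exp (C * h) * (Y + C * h ^ 3)) := by gcongr
        _ = Real.exp (3 * C * h) * (Y + C * h ^ 3) := by
          rw [← mul_assoc, ← Real.exp_add]; ring_nf
    have large : ∀ k t Y, k < N → t ∈ Icc (gridTime T N k) (gridTime T N (k + 1)) →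
        y k (gridTime T N (k + 1)) ≤ Y → y k t ≤ Ψ Y := by
      intro k t Y hk ht hY
      have hY0 := (hYnn k hk).trans hY
      refine (step k hk t ht Y hY).trans ?_
      simp only [Ψ]
      gcongr
    induction j with
    | zero =>
      intro k t hk hkN ht
      have hY : y k (gridTime T N (k + 1)) ≤ 0 := by
        rw [hterm k hk, if_pos (by omega)]
      refine ⟨?_, fun _ => ?_⟩
      · rw [hb_succ]; exact large k t 0 hk ht hY
      · have := small k t 0 hk ht hY zero_le_one
        simpa using this
    | succ j ih =>
      intro k t hk hkN ht
      have hmem : gridTime T N (k + 1) ∈ Icc (gridTime T N (k + 1)) (gridTime T N (k + 1 + 1)) :=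
        ⟨le_rfl, hgle _⟩
      obtain ⟨i1, i2⟩ := ih (k + 1) _ (by omega) (by omega) hmem
      have hY : y k (gridTime T N (k + 1)) = y (k + 1) (gridTime T N (k + 1)) := by
        rw [hterm k hk, if_neg (by omega)]
      rw [← hY] at i1 i2
      refine ⟨?_, fun hs => ?_⟩
      · rw [hb_succ]; exact large k t _ hk ht i1
      · have i3 := i2 hs
        have hj : (j : ℝ) + 1 ≤ N := by
          have : j + 1 ≤ N := by omega
          exact_mod_cast this
        -- The bound already obtained is at most K₁h² ≤ 1, so the linear recursion remains
        -- applicable at the next step. This closes the bootstrap for the nonlinear rate.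
        have hle : ((j : ℝ) + 1) * Real.exp (3 * C * h * (j + 1)) * (C * h ^ 3) ≤ 1 := by
          refine le_trans ?_ hs
          have e1 : 3 * C * h * (j + 1) ≤ 3 * C * T := by
            rw [← hNh]
            have : 0 ≤ 3 * C * h := by positivity
            nlinarith
          have e2 : ((j : ℝ) + 1) * h ≤ T := by rw [← hNh]; gcongr
          calc ((j : ℝ) + 1) * Real.exp (3 * C * h * (j + 1)) * (C * h ^ 3)
              = ((j : ℝ) + 1) * h * Real.exp (3 * C * h * (j + 1)) * C * h ^ 2 := by ring
            _ ≤ T * Real.exp (3 * C * T) * C * h ^ 2 := by gcongr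
        refine (small k t _ hk ht i3 hle).trans ?_
        push_cast
        have e3 : 1 ≤ Real.exp (3 * C * h * (j + 1)) := Real.one_le_exp (by positivity)
        have e4 : 0 ≤ C * h ^ 3 := by positivity
        calc Real.exp (3 * C * h) * ((j + 1) * Real.exp (3 * C * h * (j + 1)) * (C * h ^ 3) + C * h ^ 3)
            ≤ Real.exp (3 * C * h) * ((j + 1) * Real.exp (3 * C * h * (j + 1)) * (C * h ^ 3)
              + Real.exp (3 * C * h * (j + 1)) * (C * h ^ 3)) := by
              refine mul_le_mul_of_nonneg_left ?_ (Real.exp_pos _).le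
              linarith [le_mul_of_one_le_left e4 e3]
          _ = (j + 1 + 1) * (Real.exp (3 * C * h) * Real.exp (3 * C * h * (j + 1))) * (C * h ^ 3) := by
              ring
          _ = _ := by rw [← Real.exp_add]; ring_nf
  intro k hk t ht
  obtain ⟨m1, m2⟩ := main (N - 1 - k) k t hk (by omega) ht
  rw [Real.sqrt_le_left (by positivity), mul_pow, Real.sq_sqrt (by positivity)]
  -- On fine grids the recursion gives K₁h². On coarse grids 1 < K₁h², so the crude bound B is below
  -- B·K₁h². The constant K₁(1 + B) serves both.
  by_cases hs : K₁ * h ^ 2 ≤ 1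
  · refine (m2 hs).trans ?_
    set j := N - 1 - k
    have hj : (j : ℝ) + 1 ≤ N := by
      have : j + 1 ≤ N := by omega
      exact_mod_cast this
    have e1 : 3 * C * h * (j + 1) ≤ 3 * C * T := by
      rw [← hNh]
      have : 0 ≤ 3 * C * h := by positivity
      nlinarith
    have e2 : ((j : ℝ) + 1) * h ≤ T := by rw [← hNh]; gcongr
    calc ((j : ℝ) + 1) * Real.exp (3 * C * h * (j + 1)) * (C * h ^ 3)
        = ((j : ℝ) + 1) * h * Real.exp (3 * C * h * (j + 1)) * C * h ^ 2 := by ring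
      _ ≤ K₁ * h ^ 2 := by rw [hK₁]; gcongr
      _ ≤ K₁ * (1 + B) * h ^ 2 := by
        gcongr
        nlinarith
  · push Not at hs
    have hNle : N ≤ ⌈T ^ 2 * K₁⌉₊ := by
      have e1 : (N : ℝ) ≤ T ^ 2 * K₁ := by
        have e2 : T ^ 2 * K₁ = N * (N * (K₁ * h ^ 2)) := by rw [← hNh]; ring
        have e3 : (1 : ℝ) ≤ N := by exact_mod_cast hN
        rw [e2]
        have : 1 ≤ N * (K₁ * h ^ 2) := by nlinarith
        nlinarith
      exact_mod_cast e1.trans (Nat.le_ceil _)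
    have e4 : y k t ≤ B := m1.trans (hbmono (by omega))
    nlinarith

end PeriodicNSE

/-! ### The differential inequality for the vorticity error in the plane -/

namespace PeriodicNSE

variable {n : ℕ} {L T : ℝ}

/-- Diffusion contributes the dissipation with a positive sign because time is reversed, and the
divergence-free transport drops out. Only the remainder R needs an estimate. -/
theorem IsEvolution.hasDerivAt_energy_of_equation (hL : 0 < L) {a b : ℝ} {z zt : ℝ → E n → ℝ}
    (hz : IsEvolution L a b z zt) {t : ℝ} (ht : t ∈ Ioo a b) (σ : ℝ) {v : Fin n → E n → ℝ}
    (hv : ∀ i, IsPeriodic L (v i)) (hvc : ∀ i, ContDiff ℝ 1 (v i))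
    (hdiv : ∀ x, ∑ j, partialDeriv j (v j) x = 0) {R : E n → ℝ} (hR : Continuous R)
    (heq : ∀ x, zt t x = -(σ ^ 2 / 2 * (Δ (z t)) x) + ∑ j, v j x * partialDeriv j (z t) x + R x) :
    HasDerivAt (fun t => ∫ x in cell n L, z t x ^ 2)
      (σ ^ 2 * dissipation L (z t) + 2 * ∫ x in cell n L, z t x * R x) t := by
  have h := hz.hasDerivAt_energy ht
  have hc := hz.contDiff t ht
  have hp := hz.periodic t (Ioo_subset_Icc_self ht)
  have hc0 := hc.continuous
  have hpd : ∀ j, Continuous (partialDeriv j (z t)) := fun j =>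
    continuous_partialDeriv (hc.of_le one_le_two) j
  have hv0 : ∀ j, Continuous (v j) := fun j => (hvc j).continuous
  have hlap : Continuous (Δ (z t)) := by
    have : (Δ (z t)) = fun x => ∑ j, partialDeriv j (partialDeriv j (z t)) x :=
      funext (laplacian_eq_sum hc)
    rw [this]
    have : ∀ j, Continuous (partialDeriv j (partialDeriv j (z t))) := fun j =>
      continuous_partialDeriv (PeriodicNSE.ContDiff.partialDeriv hc (by norm_num) j) j
    fun_prop
  convert h using 1
  have e : ∀ x, 2 * (z t x * zt t x) = -(σ ^ 2) * (z t x * (Δ (z t)) x)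
      + 2 * (z t x * ∑ j, v j x * partialDeriv j (z t) x) + 2 * (z t x * R x) := by
    intro x; rw [heq]; ring
  simp_rw [e]
  rw [integral_add (integrableOn_cell (by fun_prop)) (integrableOn_cell (by fun_prop)),
    integral_add (integrableOn_cell (by fun_prop)) (integrableOn_cell (by fun_prop)),
    integral_const_mul, integral_const_mul, integral_const_mul,
    integral_mul_laplacian hL hp hc,
    integral_mul_transport hL hp (hc.of_le one_le_two) hv hvc hdiv]
  ring

/-- From 2ab ≥ −a² − b² and Cauchy-Schwarz over κ. One factor of the cardinality comes from
Cauchy-Schwarz, the other from summing the bounds of the q_k. It treats every product of a bounded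
coefficient with a quantity small in `L²`. -/
theorem two_mul_integral_mul_sum_ge {κ : Type*} [Fintype κ] {z : E n → ℝ} (hz : Continuous z)
    {c q : κ → E n → ℝ} (hc : ∀ k, Continuous (c k)) (hq : ∀ k, Continuous (q k)) {M P : ℝ}
    (hM : ∀ k, ∀ x ∈ cell n L, |c k x| ≤ M) (hP : ∀ k, ∫ x in cell n L, q k x ^ 2 ≤ P) :
    -((∫ x in cell n L, z x ^ 2) + M ^ 2 * (Fintype.card κ) ^ 2 * P)
      ≤ 2 * ∫ x in cell n L, z x * ∑ k, c k x * q k x := by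
  have h1 : ∀ x ∈ cell n L, (∑ k, c k x * q k x) ^ 2
      ≤ Fintype.card κ * (M ^ 2 * ∑ k, q k x ^ 2) := by
    intro x hx
    have h := sq_sum_le_card_mul_sum_sq (s := Finset.univ) (f := fun k => c k x * q k x)
    rw [Finset.card_univ] at h
    refine h.trans ?_
    gcongr
    rw [Finset.mul_sum]
    refine Finset.sum_le_sum fun k _ => ?_
    rw [mul_pow]
    refine mul_le_mul_of_nonneg_right ?_ (sq_nonneg _)
    rw [← sq_abs]
    exact pow_le_pow_left₀ (abs_nonneg _) (hM k x hx) 2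
  have h2 : ∫ x in cell n L, (Fintype.card κ * (M ^ 2 * ∑ k, q k x ^ 2) : ℝ)
      ≤ M ^ 2 * (Fintype.card κ) ^ 2 * P := by
    rw [integral_const_mul, integral_const_mul,
      integral_finsetSum _ fun k _ => integrableOn_cell (by have := hq k; fun_prop)]
    have : ∑ k, ∫ x in cell n L, q k x ^ 2 ≤ Fintype.card κ * P := by
      simpa using Finset.sum_le_sum fun k (_ : k ∈ Finset.univ) => hP k
    calc (Fintype.card κ : ℝ) * (M ^ 2 * ∑ k, ∫ x in cell n L, q k x ^ 2)
        ≤ Fintype.card κ * (M ^ 2 * (Fintype.card κ * P)) := by gcongr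
      _ = _ := by ring
  have h3 : ∫ x in cell n L, -(z x ^ 2 + Fintype.card κ * (M ^ 2 * ∑ k, q k x ^ 2))
      ≤ ∫ x in cell n L, 2 * (z x * ∑ k, c k x * q k x) := by
    refine setIntegral_mono_on (integrableOn_cell (by fun_prop)) (integrableOn_cell (by fun_prop))
      measurableSet_cell fun x hx => ?_
    nlinarith [h1 x hx, sq_nonneg (z x + ∑ k, c k x * q k x)]
  rw [integral_neg, integral_add (integrableOn_cell (by fun_prop))
    (integrableOn_cell (by fun_prop)), integral_const_mul 2] at h3
  linarith

theorem integral_sq_le_of_abs_le (hL : 0 < L) {q : E n → ℝ} (hq : Continuous q) {A : ℝ}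
    (h : ∀ x ∈ cell n L, |q x| ≤ A) : ∫ x in cell n L, q x ^ 2 ≤ A ^ 2 * L ^ n := by
  have h1 : ∫ x in cell n L, q x ^ 2 ≤ ∫ _x in cell n L, A ^ 2 := by
    refine setIntegral_mono_on (integrableOn_cell (by fun_prop)) (integrableOn_cell (by fun_prop))
      measurableSet_cell fun x hx => ?_
    rw [← sq_abs]
    exact pow_le_pow_left₀ (abs_nonneg _) (h x hx) 2
  simpa [measureReal_cell hL, mul_comm] using h1

theorem exists_uniform_bound {ι : Type*} [Fintype ι] {z : ι → ℝ → E n → ℝ}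
    (h : ∀ i, IsJointly T 0 (z i)) (L : ℝ) :
    ∃ M, 0 ≤ M ∧ ∀ i, ∀ t ∈ Icc 0 T, ∀ x ∈ cell n L, |z i t x| ≤ M := by
  choose M hM0 hM using fun i => (h i).exists_bound (Real.sqrt (n * L ^ 2))
  refine ⟨∑ i, M i, Finset.sum_nonneg fun i _ => hM0 i, fun i t ht x hx => ?_⟩
  exact (hM i t ht x (cell_subset_closedBall hx)).trans
    (Finset.single_le_sum (fun i _ => hM0 i) (Finset.mem_univ i))

theorem exists_uniform_lipschitz (hT : 0 < T) {ι : Type*} [Fintype ι] {z : ι → ℝ → E n → ℝ}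
    (h : ∀ i, IsJointly T 1 (z i)) (L : ℝ) :
    ∃ M, 0 ≤ M ∧ ∀ i, ∀ s ∈ Icc 0 T, ∀ t ∈ Icc 0 T, ∀ x ∈ cell n L,
      |z i t x - z i s x| ≤ M * |t - s| := by
  choose M hM0 hM using fun i => (h i).exists_lipschitz hT (Real.sqrt (n * L ^ 2))
  refine ⟨∑ i, M i, Finset.sum_nonneg fun i _ => hM0 i, fun i s hs t ht x hx => ?_⟩
  refine (hM i s hs t ht x (cell_subset_closedBall hx)).trans ?_
  gcongr
  exact Finset.single_le_sum (fun i _ => hM0 i) (Finset.mem_univ i)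

theorem IsClassicalOn.isEvolution {a b : ℝ} {w : ℝ → E n → ℝ} (hw : IsClassicalOn a b w)
    (hp : ∀ t ∈ Icc a b, IsPeriodic L (w t)) :
    IsEvolution L a b w fun t x => derivWithin (fun s => w s x) (Icc a b) t where
  continuousOn := hw.continuous
  hasDerivAt t ht x := (hw.time_diff t (Ioo_subset_Ico_self ht) x).hasDerivWithinAt.hasDerivAt
    (Icc_mem_nhds ht.1 ht.2)
  continuousOn_deriv := hw.time_cont.mono (prod_mono_left Ioo_subset_Ico_self)
  contDiff t ht := hw.space_diff t (Ioo_subset_Ico_self ht)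
  periodic := hp

theorem IsClassicalOn.isEvolution_apply {m : ℕ} {a b : ℝ} {w : ℝ → E n → E m}
    (hw : IsClassicalOn a b w) (hp : ∀ t ∈ Icc a b, IsPeriodic L (w t)) (i : Fin m) :
    IsEvolution L a b (fun t x => w t x i)
      fun t x => derivWithin (fun s => w s x) (Icc a b) t i where
  continuousOn := (EuclideanSpace.proj (𝕜 := ℝ) i).continuous.comp_continuousOn hw.continuous
  hasDerivAt t ht x := (EuclideanSpace.proj (𝕜 := ℝ) i).hasFDerivAt.comp_hasDerivAt t
    ((hw.time_diff t (Ioo_subset_Ico_self ht) x).hasDerivWithinAt.hasDerivAt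
      (Icc_mem_nhds ht.1 ht.2))
  continuousOn_deriv := (EuclideanSpace.proj (𝕜 := ℝ) i).continuous.comp_continuousOn
    (hw.time_cont.mono (prod_mono_left Ioo_subset_Ico_self))
  contDiff t ht := (EuclideanSpace.proj (𝕜 := ℝ) i).contDiff.comp
    (hw.space_diff t (Ioo_subset_Ico_self ht))
  periodic t ht := (hp t ht).comp fun y => y i

theorem laplacian_sub {v w : E n → ℝ} (hv : ContDiff ℝ 2 v) (hw : ContDiff ℝ 2 w) (x : E n) :
    (Δ fun x => v x - w x) x = (Δ v) x - (Δ w) x := by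
  have h1 : ∀ j, partialDeriv j (fun x => v x - w x)
      = fun x => partialDeriv j v x - partialDeriv j w x := fun j => funext fun x =>
    partialDeriv_sub (hv.differentiable (by norm_num) x) (hw.differentiable (by norm_num) x) j
  have h2 : ∀ {f : E n → ℝ}, ContDiff ℝ 2 f → ∀ j, Differentiable ℝ (partialDeriv j f) :=
    fun hf j => (PeriodicNSE.ContDiff.partialDeriv (k := 1) hf (by norm_num) j).differentiable
      one_ne_zero
  rw [laplacian_eq_sum (hv.sub hw), laplacian_eq_sum hv, laplacian_eq_sum hw,
    ← Finset.sum_sub_distrib]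
  refine Finset.sum_congr rfl fun j _ => ?_
  rw [h1]
  exact partialDeriv_sub (h2 hv j x) (h2 hw j x) j

section planar

variable {σ : ℝ} {f : ℝ → E 2 → E 2} {φ : E 2 → E 2} {u : ℝ → E 2 → E 2} {p : ℝ → E 2 → ℝ}

theorem IsNSESolution.curl2_eq (h : IsNSESolution L T σ f φ u p) {t : ℝ} (ht : t ∈ Icc 0 T) :
    curl2 (u t) = exterior u 0 1 t := by
  have hj : IsJointly T 3 u := h.smooth_velocity
  have hd := (hj.slice ht).differentiable (by norm_num)
  funext x
  simp only [curl2, exterior, partialDeriv_apply (hd x)]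

/-- The differential inequality for the squared vorticity error over one step, in the plane. -/
theorem exists_energy_inequality2 (hL : 0 < L) (hT : 0 < T) (h : IsNSESolution L T σ f φ u p) :
    ∃ C : ℝ, 0 ≤ C ∧ ∀ a b : ℝ, 0 ≤ a → a < b → b ≤ T → ∀ w : ℝ → E 2 → ℝ,
      IsClassicalOn a b w → (∀ t ∈ Icc a b, IsPeriodic L (w t)) → ContDiff ℝ 2 (w b) →
      (∀ t ∈ Ico a b, ∀ x, derivWithin (fun s => w s x) (Icc a b) t + (σ ^ 2 / 2) * (Δ (w t)) x
        - advect (biotSavart2 L (w b)) (w t) x + curl2 (f t) x = 0) →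
      ∀ y : ℝ → ℝ, (∀ t, y t = ∫ x in cell 2 L, (exterior u 0 1 t x - w t x) ^ 2) →
      ContinuousOn y (Icc a b) ∧ ∃ y' : ℝ → ℝ, ∀ t ∈ Ioo a b, HasDerivAt y (y' t) t ∧
        -(C * (1 + y b ^ 2) * y t + C * ((b - a) ^ 2 + y b)) ≤ y' t := by
  have hu := h.isJointly_apply
  have hω := h.isJointly_exterior hT 0 1
  obtain ⟨M, hM0, hM⟩ := exists_uniform_bound
    (z := fun j t => partialDeriv j (exterior u 0 1 t))
    (fun j => (hω.partialDeriv hT (k := 1) (by norm_num) j).mono (by norm_num)) L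
  obtain ⟨Λ, hΛ0, hΛ⟩ := exists_uniform_lipschitz hT
    (z := fun (i : Fin 2) t x => u t x i) (fun i => (hu i).mono (by norm_num)) L
  set c : ℝ := 2 * L ^ 2 + 2 with hc
  -- 16 is the squared cardinality of the index set `κ` of products; Λ²L² accounts for the Lipschitz
  -- error of u(t) − u(b), and c for the velocity error V.
  refine ⟨1 + M ^ 2 * 16 * (Λ ^ 2 * L ^ 2 + c), by positivity,
    fun a b ha hab hb w hw hwp hwb heq y hy => ?_⟩
  have hbI : b ∈ Icc 0 T := ⟨ha.trans hab.le, hb⟩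
  have hbI' : b ∈ Icc a b := ⟨hab.le, le_rfl⟩
  have huj : IsJointly T 3 u := h.smooth_velocity
  obtain ⟨V, hV, hVeq⟩ := exists_velocityError2 hL (h.periodic_velocity b hbI) (huj.slice hbI)
    (h.div_free b hbI) (h.mean_zero b hbI) (hwp b hbI') hwb
  rw [h.curl2_eq hbI, ← hy b] at hV
  have hev := (hω.isEvolution hT (fun t ht => h.isPeriodic_exterior 0 1 ht) ha hb).sub
    (hw.isEvolution hwp)
  obtain rfl : y = fun t => ∫ x in cell 2 L, (exterior u 0 1 t x - w t x) ^ 2 := funext hy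
  refine ⟨hev.continuousOn_energy, ?_⟩
  set y : ℝ → ℝ := fun t => ∫ x in cell 2 L, (exterior u 0 1 t x - w t x) ^ 2 with hydef
  have hynn : ∀ t, 0 ≤ y t := fun t => integral_nonneg fun _ => sq_nonneg _
  have hucb : ∀ j, ContDiff ℝ 3 fun x => u b x j := fun j => (hu j).slice hbI
  set v : Fin 2 → E 2 → ℝ := fun j x => u b x j - V j x with hv
  have hvp : ∀ j, IsPeriodic L (v j) := fun j =>
    ((h.periodic_velocity b hbI).comp fun y => y j).comp₂ (hV.periodic j) (· - ·)
  have hvc : ∀ j, ContDiff ℝ 1 (v j) := fun j => ((hucb j).of_le (by norm_num)).sub (hV.contDiff j)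
  have hvd : ∀ i j x, partialDeriv j (v i) x
      = partialDeriv j (fun y => u b y i) x - partialDeriv j (V i) x := fun i j x =>
    partialDeriv_sub ((hucb i).differentiable (by norm_num) x)
      ((hV.contDiff i).differentiable (by norm_num) x) j
  have hvdiv : ∀ x, ∑ j, partialDeriv j (v j) x = 0 := by
    intro x
    have h1 := h.div_free b hbI x
    simp only [div, partialDeriv_apply ((huj.slice hbI).differentiable (by norm_num) x)] at h1
    simp only [hvd, Finset.sum_sub_distrib, h1, hV.div_free, sub_zero]
  -- The first index is the direction j; the second chooses between u(t) − u(b) and V, both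
  -- multiplied by ∂_jω.
  let κ := Fin 2 × Fin 2
  let q : ℝ → κ → E 2 → ℝ := fun t k => ![fun x => u t x k.1 - u b x k.1, V k.1] k.2
  let cf : ℝ → κ → E 2 → ℝ := fun t k => partialDeriv k.1 (exterior u 0 1 t)
  have hder : ∀ t ∈ Ioo a b, HasDerivAt y (σ ^ 2 * dissipation L (fun x => exterior u 0 1 t x - w t x)
      + 2 * ∫ x in cell 2 L, (exterior u 0 1 t x - w t x) * ∑ k, cf t k x * q t k x) t ∧
      -(y t + M ^ 2 * 16 * (Λ ^ 2 * L ^ 2 * (b - a) ^ 2 + c * y b))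
        ≤ 2 * ∫ x in cell 2 L, (exterior u 0 1 t x - w t x) * ∑ k, cf t k x * q t k x := by
    intro t ht
    have htI : t ∈ Icc 0 T := Icc_subset_Icc ha hb (Ioo_subset_Icc_self ht)
    have htI' : t ∈ Ioo 0 T := Ioo_subset_Ioo ha hb ht
    have hωc : ContDiff ℝ 2 (exterior u 0 1 t) := hω.slice htI
    have hwc : ContDiff ℝ 2 (w t) := hw.space_diff t (Ioo_subset_Ico_self ht)
    have huc : ∀ j, ContDiff ℝ 3 fun x => u t x j := fun j => (hu j).slice htI
    have hqc : ∀ k, Continuous (q t k) := by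
      rintro ⟨j, l⟩
      fin_cases l
      · exact (huc j).continuous.sub (hucb j).continuous
      · exact (hV.contDiff j).continuous
    have hcc : ∀ k, Continuous (cf t k) := fun k =>
      continuous_partialDeriv (hωc.of_le one_le_two) k.1
    refine ⟨hev.hasDerivAt_energy_of_equation hL ht σ hvp hvc hvdiv
      (R := fun x => ∑ k, cf t k x * q t k x) (by fun_prop) fun x => ?_, ?_⟩
    · have e1 := h.exterior_equation hT htI' x 0 1
      have e2 := heq t (Ioo_subset_Ico_self ht) x
      have e3 := h.div_free t htI x
      simp only [div, partialDeriv_apply ((huj.slice htI).differentiable (by norm_num) x)] at e3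
      have e4 : ∀ j, partialDeriv j (fun x => exterior u 0 1 t x - w t x) x
          = partialDeriv j (exterior u 0 1 t) x - partialDeriv j (w t) x := fun j =>
        partialDeriv_sub (hωc.differentiable (by norm_num) x) (hwc.differentiable (by norm_num) x) j
      simp only [advect, hVeq, smul_eq_mul, curl2] at e2
      simp only [laplacian_sub hωc hwc, e4, Fintype.sum_prod_type, κ, cf, q, hv]
      simp only [Fin.sum_univ_two, Matrix.cons_val_zero, Matrix.cons_val_one] at e1 e2 e3 ⊢
      have e5 : exterior u 0 1 t x
        = partialDeriv 0 (fun y => u t y 1) x - partialDeriv 1 (fun y => u t y 0) x := rfl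
      -- In the plane the quadratic terms of `e1` combine to ω div u, so there is no stretching; the
      -- multiple of `e3` removes them.
      linear_combination e1 - e2 + (partialDeriv 0 (fun y => u t y 1) x
        - partialDeriv 1 (fun y => u t y 0) x) * e3
    · have h1 := two_mul_integral_mul_sum_ge (L := L) (z := fun x => exterior u 0 1 t x - w t x)
        (hωc.continuous.sub hwc.continuous) hcc hqc (M := M)
        (P := Λ ^ 2 * L ^ 2 * (b - a) ^ 2 + c * y b) (fun k x hx => hM k.1 t htI x hx) ?_
      · refine le_trans (le_of_eq ?_) h1
        simp only [κ, Fintype.card_prod, Fintype.card_fin, hydef]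
        norm_num
      · rintro ⟨j, l⟩
        have hb0 := hynn b
        fin_cases l
        · have h2 : ∫ x in cell 2 L, (u t x j - u b x j) ^ 2 ≤ (Λ * (b - a)) ^ 2 * L ^ 2 := by
            refine integral_sq_le_of_abs_le hL ((huc j).continuous.sub (hucb j).continuous)
              fun x hx => (hΛ j b hbI t htI x hx).trans ?_
            gcongr
            rw [abs_sub_comm, abs_of_nonneg (by linarith [ht.2])]
            linarith [ht.1]
          refine h2.trans ?_
          have : 0 ≤ c * y b := by positivity
          nlinarith
        · refine (hV.sq_le j).trans ?_
          have : 0 ≤ Λ ^ 2 * L ^ 2 * (b - a) ^ 2 := by positivity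
          linarith
  refine ⟨_, fun t ht => ⟨(hder t ht).1, ?_⟩⟩
  have h1 := (hder t ht).2
  have h2 : 0 ≤ σ ^ 2 * dissipation L (fun x => exterior u 0 1 t x - w t x) :=
    mul_nonneg (sq_nonneg _) (dissipation_nonneg _)
  refine le_trans ?_ (add_le_add h2 h1)
  have e0 := hynn t
  have e1 := hynn b
  have e2 : 0 ≤ M ^ 2 * 16 * (Λ ^ 2 * L ^ 2 + c) := by positivity
  have e3 : 0 ≤ M ^ 2 * 16 := by positivity
  have e4 : 0 ≤ Λ ^ 2 * L ^ 2 := by positivity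
  have e5 : 0 ≤ c := by positivity
  have e6 : y t ≤ (1 + M ^ 2 * 16 * (Λ ^ 2 * L ^ 2 + c)) * (1 + y b ^ 2) * y t := by
    refine le_mul_of_one_le_left e0 ?_
    nlinarith [mul_nonneg e2 (sq_nonneg (y b)), sq_nonneg (y b)]
  have e7 : M ^ 2 * 16 * (Λ ^ 2 * L ^ 2 * (b - a) ^ 2 + c * y b)
      ≤ (1 + M ^ 2 * 16 * (Λ ^ 2 * L ^ 2 + c)) * ((b - a) ^ 2 + y b) := by
    have : Λ ^ 2 * L ^ 2 * (b - a) ^ 2 + c * y b ≤ (Λ ^ 2 * L ^ 2 + c) * ((b - a) ^ 2 + y b) := by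
      nlinarith [mul_nonneg e4 e1, mul_nonneg e5 (sq_nonneg (b - a))]
    have := mul_le_mul_of_nonneg_left this e3
    nlinarith [sq_nonneg (b - a)]
  linarith

end planar

end PeriodicNSE

/-! ### The differential inequality for the vorticity error in space -/

namespace PeriodicNSE

variable {L T : ℝ}

section spatial

variable {σ : ℝ} {f : ℝ → E 3 → E 3} {φ : E 3 → E 3} {u : ℝ → E 3 → E 3} {p : ℝ → E 3 → ℝ}

theorem IsNSESolution.curl3_eq (h : IsNSESolution L T σ f φ u p) {t : ℝ} (ht : t ∈ Icc 0 T)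
    (x : E 3) (i : Fin 3) : curl3 (u t) x i = exterior u (i + 1) (i + 2) t x := by
  have hj : IsJointly T 3 u := h.smooth_velocity
  exact curl3_apply ((hj.slice ht).differentiable (by norm_num)) x i

/-- The antisymmetrised quadratic terms of the exterior equation equal −(ω,∇)uᵢ up to ωᵢ div u,
which vanishes. The identity is checked for each cyclic index. -/
theorem IsNSESolution.vorticity_equation3 (hT : 0 < T) (h : IsNSESolution L T σ f φ u p) {t : ℝ}
    (ht : t ∈ Ioo 0 T) (x : E 3) (i : Fin 3) :
    timeDeriv T (exterior u (i + 1) (i + 2)) t x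
      + σ ^ 2 / 2 * (Δ (exterior u (i + 1) (i + 2) t)) x
      - ∑ j, u t x j * partialDeriv j (exterior u (i + 1) (i + 2) t) x
      + ∑ j, exterior u (j + 1) (j + 2) t x * partialDeriv j (fun y => u t y i) x
      + curl3 (f t) x i = 0 := by
  have e1 := h.exterior_equation hT ht x (i + 1) (i + 2)
  have hj : IsJointly T 3 u := h.smooth_velocity
  have hd := (hj.slice (Ioo_subset_Icc_self ht)).differentiable (by norm_num) x
  have e3 := h.div_free t (Ioo_subset_Icc_self ht) x
  simp only [div, partialDeriv_apply hd] at e3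
  have e4 : curl3 (f t) x i
      = partialDeriv (i + 1) (f t) x (i + 2) - partialDeriv (i + 2) (f t) x (i + 1) := by
    fin_cases i <;> rfl
  rw [e4]
  have e5 : ∑ j, exterior u (j + 1) (j + 2) t x * partialDeriv j (fun y => u t y i) x
      = - ∑ j, (partialDeriv (i + 1) (fun y => u t y j) x
          * partialDeriv j (fun y => u t y (i + 2)) x
        - partialDeriv (i + 2) (fun y => u t y j) x
          * partialDeriv j (fun y => u t y (i + 1)) x) := by
    have f1 : (0 + 1 : Fin 3) = 1 := rfl
    have f2 : (0 + 2 : Fin 3) = 2 := rfl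
    have f3 : (1 + 1 : Fin 3) = 2 := rfl
    have f4 : (1 + 2 : Fin 3) = 0 := rfl
    have f5 : (2 + 1 : Fin 3) = 0 := rfl
    have f6 : (2 + 2 : Fin 3) = 1 := rfl
    simp only [Fin.sum_univ_three, exterior] at e3 ⊢
    fin_cases i
    · simp only [Fin.zero_eta, f1, f2, f3, f4, f5, f6]
      linear_combination (partialDeriv 1 (fun y => u t y 2) x
        - partialDeriv 2 (fun y => u t y 1) x) * e3
    · simp only [Fin.mk_one, f1, f2, f3, f4, f5, f6]
      linear_combination (partialDeriv 2 (fun y => u t y 0) x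
        - partialDeriv 0 (fun y => u t y 2) x) * e3
    · simp only [Fin.reduceFinMk, f1, f2, f3, f4, f5, f6]
      linear_combination (partialDeriv 0 (fun y => u t y 1) x
        - partialDeriv 1 (fun y => u t y 0) x) * e3
  rw [e5]
  linarith

/-- The bound of the term that is cubic in the vorticity error. -/
theorem exists_cubic_ge (hL : 0 < L) {ε : ℝ} (hε : 0 < ε) :
    ∃ C : ℝ, 0 ≤ C ∧ ∀ z : Fin 3 → E 3 → ℝ, (∀ i, IsPeriodic L (z i)) →
      (∀ i, ContDiff ℝ 1 (z i)) → ∀ e : Fin 3 → Fin 3 → E 3 → ℝ, (∀ i j, Continuous (e i j)) →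
      ∀ A : ℝ, (∀ i j, ∫ x in cell 3 L, e i j x ^ 2 ≤ A) →
        -(ε * ∑ i, dissipation L (z i) + C * (1 + A ^ 2) * ∑ i, ∫ x in cell 3 L, z i x ^ 2)
          ≤ ∑ i, 2 * ∫ x in cell 3 L, z i x * ∑ j, z j x * e i j x := by
  -- By 2|z_i z_j| ≤ z_i² + z_j², every pair (i, j) costs F i + F j; summing over the nine pairs
  -- counts each F i six times.
  obtain ⟨C, hC0, hC⟩ := exists_integral_sq_mul_abs_le hL (ε := ε / 6) (by positivity)
  refine ⟨6 * C, by positivity, fun z hz hc e he A hA => ?_⟩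
  have hzc : ∀ i, Continuous (z i) := fun i => (hc i).continuous
  set F : Fin 3 → ℝ := fun i => ε / 6 * dissipation L (z i)
    + C * (1 + A ^ 2) * ∫ x in cell 3 L, z i x ^ 2 with hF
  have h1 : ∀ i, -(∑ j, (F i + F j)) ≤ 2 * ∫ x in cell 3 L, z i x * ∑ j, z j x * e i j x := by
    intro i
    have h2 : ∀ j, (∫ x in cell 3 L, z i x ^ 2 * |e i j x|) + (∫ x in cell 3 L, z j x ^ 2 * |e i j x|)
        ≤ F i + F j := fun j =>
      add_le_add (hC (z i) (hz i) (hc i) (e i j) (he i j) A (hA i j))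
        (hC (z j) (hz j) (hc j) (e i j) (he i j) A (hA i j))
    have h3 : ∫ x in cell 3 L, -(∑ j, (z i x ^ 2 * |e i j x| + z j x ^ 2 * |e i j x|))
        ≤ ∫ x in cell 3 L, 2 * (z i x * ∑ j, z j x * e i j x) := by
      refine setIntegral_mono (integrableOn_cell (by fun_prop)) (integrableOn_cell (by fun_prop))
        fun x => ?_
      dsimp only
      rw [Finset.mul_sum, Finset.mul_sum, ← Finset.sum_neg_distrib]
      refine Finset.sum_le_sum fun j _ => ?_
      have h4 := abs_le.1 (le_refl |e i j x|)
      have h5 : |z i x * (z j x * e i j x)| = |z i x| * |z j x| * |e i j x| := by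
        rw [abs_mul, abs_mul, mul_assoc]
      have h6 := neg_abs_le (z i x * (z j x * e i j x))
      rw [h5] at h6
      have h7 : 2 * (|z i x| * |z j x|) ≤ z i x ^ 2 + z j x ^ 2 := by
        nlinarith [sq_nonneg (|z i x| - |z j x|), sq_abs (z i x), sq_abs (z j x)]
      nlinarith [mul_le_mul_of_nonneg_right h7 (abs_nonneg (e i j x))]
    rw [integral_neg, integral_const_mul,
      integral_finsetSum _ fun j _ => integrableOn_cell (by fun_prop)] at h3
    refine le_trans (neg_le_neg ?_) h3
    refine Finset.sum_le_sum fun j _ => ?_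
    rw [integral_add (integrableOn_cell (by fun_prop)) (integrableOn_cell (by fun_prop))]
    exact h2 j
  refine le_trans (le_of_eq ?_) (Finset.sum_le_sum fun i _ => h1 i)
  simp only [Fin.sum_univ_three, hF]
  ring

/-- Collects the spatial estimate into one constant: G weights the products with bounded
coefficients, H the time-Lipschitz error with r = (b − a)², c the velocity error, and C the cubic
term; Y and z are the energies at b and t. -/
theorem energy_constants_le {G H c C r Y z : ℝ} (hG : 0 ≤ G) (hH : 0 ≤ H) (hc : 0 ≤ c)
    (hC : 0 ≤ C) (hr : 0 ≤ r) (hY : 0 ≤ Y) (hz : 0 ≤ z) :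
    z + G * (H * r + c * Y + z) + C * (1 + (c * Y) ^ 2) * z
      ≤ (1 + G * (1 + H + c) + C * (1 + c ^ 2)) * (1 + Y ^ 2) * z
        + (1 + G * (1 + H + c) + C * (1 + c ^ 2)) * (r + Y) := by
  have h1 : 0 ≤ z * (G * (H + c) + C * c ^ 2) := by positivity
  have h2 : 0 ≤ z * ((1 + G * (1 + H + c)) * Y ^ 2 + C * Y ^ 2) := by positivity
  have h3 : 0 ≤ (1 + G + C * (1 + c ^ 2)) * (r + Y) + G * (H * Y + c * r) := by positivity
  linear_combination h1 + h2 + h3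

set_option maxHeartbeats 1000000 in
/-- The differential inequality for the squared vorticity error over one step, in space. -/
theorem exists_energy_inequality3 (hL : 0 < L) (hT : 0 < T) (hσ : σ ≠ 0)
    (h : IsNSESolution L T σ f φ u p) :
    ∃ C : ℝ, 0 ≤ C ∧ ∀ a b : ℝ, 0 ≤ a → a < b → b ≤ T → ∀ w : ℝ → E 3 → E 3,
      IsClassicalOn a b w → (∀ t ∈ Icc a b, IsPeriodic L (w t)) → ContDiff ℝ 2 (w b) →
      (∀ t ∈ Ico a b, ∀ x, derivWithin (fun s => w s x) (Icc a b) t + (σ ^ 2 / 2) • (Δ (w t)) x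
        - advect (biotSavart3 L (w b)) (w t) x + advect (w t) (biotSavart3 L (w b)) x
        + curl3 (f t) x = 0) →
      ∀ y : ℝ → ℝ,
      (∀ t, y t = ∑ i, ∫ x in cell 3 L, (exterior u (i + 1) (i + 2) t x - w t x i) ^ 2) →
      ContinuousOn y (Icc a b) ∧ ∃ y' : ℝ → ℝ, ∀ t ∈ Ioo a b, HasDerivAt y (y' t) t ∧
        -(C * (1 + y b ^ 2) * y t + C * ((b - a) ^ 2 + y b)) ≤ y' t := by
  have hu := h.isJointly_apply
  set ω : Fin 3 → ℝ → E 3 → ℝ := fun i => exterior u (i + 1) (i + 2) with hωdef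
  have hω : ∀ i, IsJointly T 2 (ω i) := fun i => h.isJointly_exterior hT _ _
  have hdu : ∀ i j, IsJointly T 2 fun t => partialDeriv j fun y => u t y i := fun i j =>
    (hu i).partialDeriv hT (by norm_num) j
  obtain ⟨M₁, hM₁0, hM₁⟩ := exists_uniform_bound (fun i => (hω i).mono (by norm_num)) L
  obtain ⟨M₂, hM₂0, hM₂⟩ := exists_uniform_bound
    (z := fun (k : Fin 3 × Fin 3) t => partialDeriv k.2 (ω k.1 t))
    (fun k => ((hω k.1).partialDeriv hT (k := 1) (by norm_num) k.2).mono (by norm_num)) L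
  obtain ⟨M₃, hM₃0, hM₃⟩ := exists_uniform_bound
    (z := fun (k : Fin 3 × Fin 3) t => partialDeriv k.2 fun y => u t y k.1)
    (fun k => (hdu k.1 k.2).mono (by norm_num)) L
  obtain ⟨Λ₁, hΛ₁0, hΛ₁⟩ := exists_uniform_lipschitz hT
    (z := fun (i : Fin 3) t x => u t x i) (fun i => (hu i).mono (by norm_num)) L
  obtain ⟨Λ₂, hΛ₂0, hΛ₂⟩ := exists_uniform_lipschitz hT
    (z := fun (k : Fin 3 × Fin 3) t => partialDeriv k.2 fun y => u t y k.1)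
    (fun k => (hdu k.1 k.2).mono (by norm_num)) L
  -- The choice ε = σ² spends the viscous dissipation exactly. This is where σ ≠ 0 enters.
  obtain ⟨C₁, hC₁0, hC₁⟩ := exists_cubic_ge hL (ε := σ ^ 2) (by positivity)
  set M := M₁ + M₂ + M₃ with hMdef
  set Λ := Λ₁ + Λ₂ with hΛdef
  have hM0 : 0 ≤ M := by positivity
  have hΛ0 : 0 ≤ Λ := by positivity
  set c : ℝ := 2 * L ^ 2 + 2 with hc
  have hc0 : 0 ≤ c := by positivity
  -- 675 = 3 · 15²: fifteen products in each of the three components, squared by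
  -- `two_mul_integral_mul_sum_ge`.
  refine ⟨1 + 675 * M ^ 2 * (1 + Λ ^ 2 * L ^ 3 + c) + C₁ * (1 + c ^ 2), by positivity,
    fun a b ha hab hb w hw hwp hwb heq y hy => ?_⟩
  have hbI : b ∈ Icc 0 T := ⟨ha.trans hab.le, hb⟩
  have hbI' : b ∈ Icc a b := ⟨hab.le, le_rfl⟩
  have huj : IsJointly T 3 u := h.smooth_velocity
  obtain ⟨V, hV, hVeq⟩ := exists_velocityError3 hL (h.periodic_velocity b hbI) (huj.slice hbI)
    (h.div_free b hbI) (h.mean_zero b hbI) (hwp b hbI') hwb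
  simp only [h.curl3_eq hbI] at hV
  rw [← hy b] at hV
  have hev : ∀ i, IsEvolution L a b (fun t x => ω i t x - w t x i) _ := fun i =>
    ((hω i).isEvolution hT (fun t ht => h.isPeriodic_exterior _ _ ht) ha hb).sub
      (hw.isEvolution_apply hwp i)
  obtain rfl : y = fun t => ∑ i, ∫ x in cell 3 L, (ω i t x - w t x i) ^ 2 := funext hy
  refine ⟨continuousOn_finsetSum _ fun i _ => (hev i).continuousOn_energy, ?_⟩
  set y : ℝ → ℝ := fun t => ∑ i, ∫ x in cell 3 L, (ω i t x - w t x i) ^ 2 with hydef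
  have hzn : ∀ i t, 0 ≤ ∫ x in cell 3 L, (ω i t x - w t x i) ^ 2 := fun i t =>
    integral_nonneg fun _ => sq_nonneg _
  have hynn : ∀ t, 0 ≤ y t := fun t => Finset.sum_nonneg fun i _ => hzn i t
  have hucb : ∀ j, ContDiff ℝ 3 fun x => u b x j := fun j => (hu j).slice hbI
  set v : Fin 3 → E 3 → ℝ := fun j x => u b x j - V j x with hv
  have hvp : ∀ j, IsPeriodic L (v j) := fun j =>
    ((h.periodic_velocity b hbI).comp fun y => y j).comp₂ (hV.periodic j) (· - ·)
  have hvc : ∀ j, ContDiff ℝ 1 (v j) := fun j => ((hucb j).of_le (by norm_num)).sub (hV.contDiff j)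
  have hvd : ∀ i j x, partialDeriv j (v i) x
      = partialDeriv j (fun y => u b y i) x - partialDeriv j (V i) x := fun i j x =>
    partialDeriv_sub ((hucb i).differentiable (by norm_num) x)
      ((hV.contDiff i).differentiable (by norm_num) x) j
  have hvdiv : ∀ x, ∑ j, partialDeriv j (v j) x = 0 := by
    intro x
    have h1 := h.div_free b hbI x
    simp only [div, partialDeriv_apply ((huj.slice hbI).differentiable (by norm_num) x)] at h1
    simp only [hvd, Finset.sum_sub_distrib, h1, hV.div_free, sub_zero]
  have hbsd : Differentiable ℝ (biotSavart3 L (w b)) := by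
    rw [differentiable_piLp]
    intro i
    simp only [hVeq]
    exact (hvc i).differentiable one_ne_zero
  have hbs : ∀ i j x, partialDeriv j (biotSavart3 L (w b)) x i
      = partialDeriv j (fun y => u b y i) x - partialDeriv j (V i) x := by
    intro i j x
    rw [partialDeriv_apply (hbsd x), ← hvd]
    simp only [hVeq, hv]
  -- Five kinds of products in each direction j: ∂_jω with u(t) − u(b) and with V; −∂_j u(b) with
  -- z_j; −ω_j with ∂_j(u(t) − u(b)) and with ∂_jV. The remaining product z_j ∂_jV has no bounded
  -- factor and is kept apart as the cubic term.
  let κ := Fin 3 × Fin 5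
  let q : Fin 3 → ℝ → κ → E 3 → ℝ := fun i t k => ![fun x => u t x k.1 - u b x k.1, V k.1,
    fun x => ω k.1 t x - w t x k.1,
    fun x => partialDeriv k.1 (fun y => u t y i) x - partialDeriv k.1 (fun y => u b y i) x,
    partialDeriv k.1 (V i)] k.2
  let cf : Fin 3 → ℝ → κ → E 3 → ℝ := fun i t k => ![partialDeriv k.1 (ω i t),
    partialDeriv k.1 (ω i t), fun x => - partialDeriv k.1 (fun y => u b y i) x,
    fun x => - ω k.1 t x, fun x => - ω k.1 t x] k.2
  have hder : ∀ t ∈ Ioo a b, ∀ i,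
      HasDerivAt (fun t => ∫ x in cell 3 L, (ω i t x - w t x i) ^ 2)
        (σ ^ 2 * dissipation L (fun x => ω i t x - w t x i)
          + ((2 * ∫ x in cell 3 L, (ω i t x - w t x i) * ∑ k, cf i t k x * q i t k x)
            + 2 * ∫ x in cell 3 L, (ω i t x - w t x i)
              * ∑ j, (ω j t x - w t x j) * partialDeriv j (V i) x)) t ∧
      -((∫ x in cell 3 L, (ω i t x - w t x i) ^ 2)
          + M ^ 2 * 225 * (Λ ^ 2 * L ^ 3 * (b - a) ^ 2 + c * y b + y t))
        ≤ 2 * ∫ x in cell 3 L, (ω i t x - w t x i) * ∑ k, cf i t k x * q i t k x := by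
    intro t ht i
    have htI : t ∈ Icc 0 T := Icc_subset_Icc ha hb (Ioo_subset_Icc_self ht)
    have htI' : t ∈ Ioo 0 T := Ioo_subset_Ioo ha hb ht
    have hωc : ∀ i, ContDiff ℝ 2 (ω i t) := fun i => (hω i).slice htI
    have hwt : ContDiff ℝ 2 (w t) := hw.space_diff t (Ioo_subset_Ico_self ht)
    have hwc : ∀ i, ContDiff ℝ 2 fun x => w t x i := fun i => by fun_prop
    have huc : ∀ j, ContDiff ℝ 3 fun x => u t x j := fun j => (hu j).slice htI
    have hzc : ∀ i, Continuous fun x => ω i t x - w t x i := fun i =>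
      (hωc i).continuous.sub (hwc i).continuous
    have hVd : ∀ i j, Continuous (partialDeriv j (V i)) := fun i j =>
      continuous_partialDeriv (hV.contDiff i) j
    have hud : ∀ {s}, s ∈ Icc 0 T → ∀ i j, Continuous (partialDeriv j fun y => u s y i) :=
      fun hs i j => continuous_partialDeriv (((hu i).slice hs).of_le (by norm_num)) j
    have hωd : ∀ i j, Continuous (partialDeriv j (ω i t)) := fun i j =>
      continuous_partialDeriv ((hωc i).of_le one_le_two) j
    have hqc : ∀ k, Continuous (q i t k) := by
      rintro ⟨j, l⟩
      fin_cases l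
      · exact (huc j).continuous.sub (hucb j).continuous
      · exact (hV.contDiff j).continuous
      · exact hzc j
      · exact (hud htI i j).sub (hud hbI i j)
      · exact hVd i j
    have hcc : ∀ k, Continuous (cf i t k) := by
      rintro ⟨j, l⟩
      fin_cases l
      · exact hωd i j
      · exact hωd i j
      · exact (hud hbI i j).neg
      · exact (hωc j).continuous.neg
      · exact (hωc j).continuous.neg
    constructor
    · rw [← mul_add, ← integral_add (integrableOn_cell (by fun_prop))
        (integrableOn_cell (by fun_prop))]
      simp only [← mul_add]
      refine (hev i).hasDerivAt_energy_of_equation hL ht σ hvp hvc hvdiv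
        (R := fun x => (∑ k, cf i t k x * q i t k x)
          + ∑ j, (ω j t x - w t x j) * partialDeriv j (V i) x) (by fun_prop) fun x => ?_
      have e1 := h.vorticity_equation3 hT htI' x i
      have e2 := congrArg (fun v : E 3 => v i) (heq t (Ioo_subset_Ico_self ht) x)
      have e4 : ∀ j, partialDeriv j (fun x => ω i t x - w t x i) x
          = partialDeriv j (ω i t) x - partialDeriv j (fun x => w t x i) x := fun j =>
        partialDeriv_sub ((hωc i).differentiable (by norm_num) x)
          ((hwc i).differentiable (by norm_num) x) j
      have e5 : advect (biotSavart3 L (w b)) (w t) x i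
          = ∑ j, (u b x j - V j x) * partialDeriv j (fun x => w t x i) x := by
        simp [advect, hVeq, partialDeriv_apply (hwt.differentiable (by norm_num) x)]
      have e6 : advect (w t) (biotSavart3 L (w b)) x i
          = ∑ j, w t x j * (partialDeriv j (fun y => u b y i) x - partialDeriv j (V i) x) := by
        simp [advect, hbs]
      simp only [PiLp.add_apply, PiLp.sub_apply, PiLp.smul_apply, smul_eq_mul, PiLp.zero_apply,
        e5, e6, laplacian_apply hwt] at e2
      have e7 : timeDeriv T (ω i) t x + σ ^ 2 / 2 * (Δ (ω i t)) x
          - ∑ j, u t x j * partialDeriv j (ω i t) x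
          + ∑ j, ω j t x * partialDeriv j (fun y => u t y i) x + curl3 (f t) x i = 0 := e1
      simp only [laplacian_sub (hωc i) (hwc i), e4, Fintype.sum_prod_type, κ, cf, q, hv]
      simp only [Fin.sum_univ_five, Matrix.cons_val_zero, Matrix.cons_val_one, Matrix.cons_val]
      simp only [Fin.sum_univ_three] at e2 e7 ⊢
      linear_combination e7 - e2
    · have h1 := two_mul_integral_mul_sum_ge (L := L) (hzc i) hcc hqc (M := M)
        (P := Λ ^ 2 * L ^ 3 * (b - a) ^ 2 + c * y b + y t) ?_ ?_
      · refine le_trans (le_of_eq ?_) h1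
        simp only [κ, Fintype.card_prod, Fintype.card_fin]
        norm_num
      · rintro ⟨j, l⟩ x hx
        fin_cases l
        · exact (hM₂ (i, j) t htI x hx).trans (by linarith)
        · exact (hM₂ (i, j) t htI x hx).trans (by linarith)
        · exact (abs_neg _).le.trans ((hM₃ (i, j) b hbI x hx).trans (by linarith))
        · exact (abs_neg _).le.trans ((hM₁ j t htI x hx).trans (by linarith))
        · exact (abs_neg _).le.trans ((hM₁ j t htI x hx).trans (by linarith))
      · have hb0 := hynn b
        have ht0 := hynn t
        have p1 : 0 ≤ c * y b := by positivity
        have p2 : 0 ≤ Λ ^ 2 * L ^ 3 * (b - a) ^ 2 := by positivity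
        have hba : |t - b| ≤ b - a := by
          rw [abs_sub_comm, abs_of_nonneg (by linarith [ht.2])]
          linarith [ht.1]
        rintro ⟨j, l⟩
        fin_cases l
        · have h2 : ∫ x in cell 3 L, (u t x j - u b x j) ^ 2 ≤ (Λ * (b - a)) ^ 2 * L ^ 3 := by
            refine integral_sq_le_of_abs_le hL ((huc j).continuous.sub (hucb j).continuous)
              fun x hx => (hΛ₁ j b hbI t htI x hx).trans ?_
            have : Λ₁ ≤ Λ := by linarith
            gcongr
          refine h2.trans ?_
          nlinarith
        · refine (hV.sq_le j).trans ?_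
          linarith
        · refine (Finset.single_le_sum (fun i _ => hzn i t) (Finset.mem_univ j)).trans ?_
          linarith
        · have h2 : ∫ x in cell 3 L, (partialDeriv j (fun y => u t y i) x
              - partialDeriv j (fun y => u b y i) x) ^ 2 ≤ (Λ * (b - a)) ^ 2 * L ^ 3 := by
            refine integral_sq_le_of_abs_le hL ((hud htI i j).sub (hud hbI i j))
              fun x hx => (hΛ₂ (i, j) b hbI t htI x hx).trans ?_
            have : Λ₂ ≤ Λ := by linarith
            gcongr
          refine h2.trans ?_
          nlinarith
        · refine (hV.deriv_sq_le i j).trans ?_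
          linarith
  refine ⟨_, fun t ht => ⟨HasDerivAt.fun_sum fun i _ => (hder t ht i).1, ?_⟩⟩
  have htI : t ∈ Icc 0 T := Icc_subset_Icc ha hb (Ioo_subset_Icc_self ht)
  have hwt : ContDiff ℝ 2 (w t) := hw.space_diff t (Ioo_subset_Ico_self ht)
  -- The bound A = c·y(b) of the squared `L²` norm of ∇V is what brings y(b)² into the growth rate.
  have hcub := hC₁ (fun i x => ω i t x - w t x i)
    (fun i => (hev i).periodic t (Ioo_subset_Icc_self ht))
    (fun i => ((hev i).contDiff t ht).of_le one_le_two) (fun i j => partialDeriv j (V i))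
    (fun i j => continuous_partialDeriv (hV.contDiff i) j) (c * y b) fun i j => hV.deriv_sq_le i j
  have hlin := Finset.sum_le_sum fun i (_ : i ∈ Finset.univ) => (hder t ht i).2
  rw [Finset.sum_add_distrib, Finset.sum_add_distrib, ← Finset.mul_sum]
  rw [Finset.sum_neg_distrib, Finset.sum_add_distrib] at hlin
  simp only [Finset.sum_const, Finset.card_univ, Fintype.card_fin, nsmul_eq_mul] at hlin
  have hyt : ∑ i, ∫ x in cell 3 L, (ω i t x - w t x i) ^ 2 = y t := rfl
  rw [hyt] at hlin hcub
  push_cast at hlin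
  have e0 := hynn t
  have e1 := hynn b
  have key := energy_constants_le (G := 675 * M ^ 2) (H := Λ ^ 2 * L ^ 3) (by positivity)
    (by positivity) hc0 hC₁0 (sq_nonneg (b - a)) e1 e0
  linarith

end spatial

end PeriodicNSE

/-! ### Grid points and the convergence theorems -/

namespace PeriodicNSE

variable {L T σ : ℝ}

theorem gridTime_self (T : ℝ) {N : ℕ} (hN : 1 ≤ N) : gridTime T N N = T := by
  have : (N : ℝ) ≠ 0 := by positivity
  simp only [gridTime]
  field_simp

theorem gridTime_succ_sub (T : ℝ) (N k : ℕ) :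
    gridTime T N (k + 1) - gridTime T N k = T / N := by
  simp only [gridTime]
  push_cast
  ring

theorem gridTime_nonneg (hT : 0 < T) (N k : ℕ) : 0 ≤ gridTime T N k := by
  simp only [gridTime]
  positivity

theorem gridTime_lt_succ (hT : 0 < T) {N : ℕ} (hN : 1 ≤ N) (k : ℕ) :
    gridTime T N k < gridTime T N (k + 1) := by
  have h1 := gridTime_succ_sub T N k
  have h2 : 0 < T / N := by positivity
  linarith

theorem gridTime_le (hT : 0 < T) {N k : ℕ} (hN : 1 ≤ N) (hk : k ≤ N) : gridTime T N k ≤ T := by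
  calc gridTime T N k ≤ gridTime T N N := by simp only [gridTime]; gcongr
    _ = T := gridTime_self T hN

/-- A classical solution need not be smooth at the right end of its interval. There, however, it
equals either the terminal value or the next function at the left end of its own interval, where
smoothness is part of the definition. -/
theorem contDiff_grid_end {F : Type*} [NormedAddCommGroup F] [NormedSpace ℝ F] {n : ℕ}
    (hT : 0 < T) {N : ℕ} (hN : 1 ≤ N) {w : ℕ → ℝ → E n → F} {w₀ : E n → F} (hw₀ : ContDiff ℝ 2 w₀)
    (hw : ∀ k < N, IsClassicalOn (gridTime T N k) (gridTime T N (k + 1)) (w k))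
    (hterm : ∀ k < N, w k (gridTime T N (k + 1)) =
      if k + 1 = N then w₀ else w (k + 1) (gridTime T N (k + 1))) {k : ℕ} (hk : k < N) :
    ContDiff ℝ 2 (w k (gridTime T N (k + 1))) := by
  rw [hterm k hk]
  split_ifs with h
  · exact hw₀
  · exact (hw (k + 1) (by omega)).space_diff _ ⟨le_rfl, gridTime_lt_succ hT hN _⟩

theorem convergence2 (hL : 0 < L) (hT : 0 < T) {f : ℝ → E 2 → E 2} {φ : E 2 → E 2}
    {u : ℝ → E 2 → E 2} {p : ℝ → E 2 → ℝ} (h : IsNSESolution L T σ f φ u p) :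
    ∃ K : ℝ, ∀ N : ℕ, 1 ≤ N → ∀ w : ℕ → ℝ → E 2 → ℝ, IsFrozenApprox2 L T σ f φ N w →
      ∀ k < N, ∀ t ∈ Icc (gridTime T N k) (gridTime T N (k + 1)),
        l2Norm L (fun x => curl2 (u t) x - w k t x) ≤ K * (T / N) := by
  obtain ⟨C, hC0, hC⟩ := exists_energy_inequality2 hL hT h
  obtain ⟨K, hK⟩ := exists_sqrt_energy_le hT hC0
  refine ⟨K, fun N hN w hw k hk t ht => ?_⟩
  have hTI : T ∈ Icc 0 T := ⟨hT.le, le_rfl⟩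
  have hφ : curl2 φ = exterior u 0 1 T := by rw [← h.terminal, h.curl2_eq hTI]
  set y : ℕ → ℝ → ℝ := fun k t => ∫ x in cell 2 L, (exterior u 0 1 t x - w k t x) ^ 2 with hy
  -- The condition k < N stands under the existential quantifier so that `choose` gives derivatives
  -- indexed by all k.
  have hstep : ∀ k, ∃ y' : ℝ → ℝ, k < N →
      ContinuousOn (y k) (Icc (gridTime T N k) (gridTime T N (k + 1))) ∧
      ∀ t ∈ Ioo (gridTime T N k) (gridTime T N (k + 1)), HasDerivAt (y k) (y' t) t ∧
        -(C * (1 + y k (gridTime T N (k + 1)) ^ 2) * y k t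
          + C * ((T / N) ^ 2 + y k (gridTime T N (k + 1)))) ≤ y' t := by
    intro k
    by_cases hk : k < N
    · obtain ⟨h1, y', h2⟩ := hC _ _ (gridTime_nonneg hT N k) (gridTime_lt_succ hT hN k)
        (gridTime_le hT hN hk) (w k) (hw.classical k hk) (hw.periodic k hk)
        (contDiff_grid_end hT hN (hφ ▸ (h.isJointly_exterior hT 0 1).slice hTI) hw.classical
          hw.terminal hk) (hw.equation k hk) (y k) fun _ => rfl
      rw [gridTime_succ_sub] at h2
      exact ⟨y', fun _ => ⟨h1, h2⟩⟩
    · exact ⟨0, fun h => absurd h hk⟩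
  choose y' hy' using hstep
  have hmain := hK N hN y y' (fun k hk => (hy' k hk).1)
    (fun k _ t _ => integral_nonneg fun _ => sq_nonneg _)
    (fun k hk t ht => ((hy' k hk).2 t ht).1) (fun k hk t ht => ((hy' k hk).2 t ht).2) ?_ k hk t ht
  · have htI : t ∈ Icc 0 T := Icc_subset_Icc (gridTime_nonneg hT N k) (gridTime_le hT hN hk) ht
    simpa only [l2Norm, h.curl2_eq htI, Real.norm_eq_abs, sq_abs] using hmain
  · intro k hk
    simp only [hy]
    rw [hw.terminal k hk]
    split_ifs with hkN
    · rw [hφ, hkN, gridTime_self T hN]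
      simp
    · rfl

theorem convergence3 (hL : 0 < L) (hT : 0 < T) (hσ : σ ≠ 0) {f : ℝ → E 3 → E 3} {φ : E 3 → E 3}
    {u : ℝ → E 3 → E 3} {p : ℝ → E 3 → ℝ} (h : IsNSESolution L T σ f φ u p) :
    ∃ K : ℝ, ∀ N : ℕ, 1 ≤ N → ∀ w : ℕ → ℝ → E 3 → E 3, IsFrozenApprox3 L T σ f φ N w →
      ∀ k < N, ∀ t ∈ Icc (gridTime T N k) (gridTime T N (k + 1)),
        l2Norm L (fun x => curl3 (u t) x - w k t x) ≤ K * (T / N) := by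
  obtain ⟨C, hC0, hC⟩ := exists_energy_inequality3 hL hT hσ h
  obtain ⟨K, hK⟩ := exists_sqrt_energy_le hT hC0
  refine ⟨K, fun N hN w hw k hk t ht => ?_⟩
  have hTI : T ∈ Icc 0 T := ⟨hT.le, le_rfl⟩
  have hφ : ∀ x i, curl3 φ x i = exterior u (i + 1) (i + 2) T x := by
    intro x i
    rw [← h.terminal, h.curl3_eq hTI]
  -- No smoothness of φ is assumed separately; it is inherited from u at time T.
  have hφc : ContDiff ℝ 2 (curl3 φ) := by
    rw [contDiff_piLp]
    intro i
    simp only [hφ]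
    exact (h.isJointly_exterior hT _ _).slice hTI
  set y : ℕ → ℝ → ℝ := fun k t =>
    ∑ i, ∫ x in cell 3 L, (exterior u (i + 1) (i + 2) t x - w k t x i) ^ 2 with hy
  have hstep : ∀ k, ∃ y' : ℝ → ℝ, k < N →
      ContinuousOn (y k) (Icc (gridTime T N k) (gridTime T N (k + 1))) ∧
      ∀ t ∈ Ioo (gridTime T N k) (gridTime T N (k + 1)), HasDerivAt (y k) (y' t) t ∧
        -(C * (1 + y k (gridTime T N (k + 1)) ^ 2) * y k t
          + C * ((T / N) ^ 2 + y k (gridTime T N (k + 1)))) ≤ y' t := by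
    intro k
    by_cases hk : k < N
    · obtain ⟨h1, y', h2⟩ := hC _ _ (gridTime_nonneg hT N k) (gridTime_lt_succ hT hN k)
        (gridTime_le hT hN hk) (w k) (hw.classical k hk) (hw.periodic k hk)
        (contDiff_grid_end hT hN hφc hw.classical hw.terminal hk) (hw.equation k hk) (y k)
        fun _ => rfl
      rw [gridTime_succ_sub] at h2
      exact ⟨y', fun _ => ⟨h1, h2⟩⟩
    · exact ⟨0, fun h => absurd h hk⟩
  choose y' hy' using hstep
  have hmain := hK N hN y y' (fun k hk => (hy' k hk).1)
    (fun k _ t _ => Finset.sum_nonneg fun i _ => integral_nonneg fun _ => sq_nonneg _)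
    (fun k hk t ht => ((hy' k hk).2 t ht).1) (fun k hk t ht => ((hy' k hk).2 t ht).2) ?_ k hk t ht
  · have htI : t ∈ Icc 0 T := Icc_subset_Icc (gridTime_nonneg hT N k) (gridTime_le hT hN hk) ht
    have hwc : Continuous (w k t) := continuous_slice (hw.classical k hk).continuous ht
    have hωc : ∀ i, Continuous (exterior u (i + 1) (i + 2) t) := fun i =>
      ((h.isJointly_exterior hT _ _).slice htI).continuous
    have e : ∫ x in cell 3 L, ‖curl3 (u t) x - w k t x‖ ^ 2 = y k t := by
      simp only [EuclideanSpace.real_norm_sq_eq, PiLp.sub_apply, h.curl3_eq htI, hy]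
      exact integral_finsetSum _ fun i _ => integrableOn_cell (by fun_prop)
    rwa [l2Norm, e]
  · intro k hk
    simp only [hy]
    rw [hw.terminal k hk]
    split_ifs with hkN
    · simp only [hφ, hkN, gridTime_self T hN]
      simp
    · rfl

end PeriodicNSE

theorem mainTheorem2 (L T σ : ℝ) (hL : 0 < L) (hT : 0 < T) (hσ : σ ≠ 0) :
    (∀ (f : ℝ → PeriodicNSE.E 2 → PeriodicNSE.E 2) (φ : PeriodicNSE.E 2 → PeriodicNSE.E 2)
        (u : ℝ → PeriodicNSE.E 2 → PeriodicNSE.E 2) (p : ℝ → PeriodicNSE.E 2 → ℝ),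
        PeriodicNSE.IsNSESolution L T σ f φ u p →
        ∃ K : ℝ, ∀ N : ℕ, 1 ≤ N → ∀ w : ℕ → ℝ → PeriodicNSE.E 2 → ℝ,
          PeriodicNSE.IsFrozenApprox2 L T σ f φ N w →
          ∀ k < N, ∀ t ∈ Set.Icc (PeriodicNSE.gridTime T N k) (PeriodicNSE.gridTime T N (k + 1)),
            PeriodicNSE.l2Norm L (fun x => PeriodicNSE.curl2 (u t) x - w k t x) ≤ K * (T / N)) ∧
    (∀ (f : ℝ → PeriodicNSE.E 3 → PeriodicNSE.E 3) (φ : PeriodicNSE.E 3 → PeriodicNSE.E 3)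
        (u : ℝ → PeriodicNSE.E 3 → PeriodicNSE.E 3) (p : ℝ → PeriodicNSE.E 3 → ℝ),
        PeriodicNSE.IsNSESolution L T σ f φ u p →
        ∃ K : ℝ, ∀ N : ℕ, 1 ≤ N → ∀ w : ℕ → ℝ → PeriodicNSE.E 3 → PeriodicNSE.E 3,
          PeriodicNSE.IsFrozenApprox3 L T σ f φ N w →
          ∀ k < N, ∀ t ∈ Set.Icc (PeriodicNSE.gridTime T N k) (PeriodicNSE.gridTime T N (k + 1)),
            PeriodicNSE.l2Norm L (fun x => PeriodicNSE.curl3 (u t) x - w k t x) ≤ K * (T / N)) := by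
  exact ⟨fun _ _ _ _ h => PeriodicNSE.convergence2 hL hT h,
    fun _ _ _ _ h => PeriodicNSE.convergence3 hL hT hσ h⟩
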